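/- Let $0<\beta<1$. For $0<\nu<1$ and real $z$ let $M_\nu(z)=\sum_{n\ge0}\frac{(-z)^n}{n!\,\Gamma(-\nu n+1-\nu)}$ be the $M$-Wright function, and for $z\in\mathbb C$ let $E_\beta(z)=\sum_{n\ge0}\frac{z^n}{\Gamma(\beta n+1)}$ be the Mittag-Leffler function. Write $J_t^{\mu}f(t)=\frac1{\Gamma(\mu)}\int_0^t(t-\tau)^{\mu-1}f(\tau)\,d\tau$, $D_t^{\mu}f=\frac{d}{dt}J_t^{1-\mu}f$ (Riemann–Liouville) and ${}_*D_t^{\mu}f=J_t^{1-\mu}f'$ (Caputo) for $0<\mu<1$. Powers of complex $s$ with $\operatorname{Re}s>0$ are principal values. A *fundamental solution* of one of the equations below is a family $u(\cdot,t)\in L^1(\mathbb R)$, $t>0$, bounded in $L^1$ for $t$ in bounded intervals $(0,T]$, such that for every $\varphi\in C_c^\infty(\mathbb R)$ the function $t\mapsto\int u(x,t)\varphi(x)\,dx$ tends to $\varphi(0)$ as $t\to0^+$ (that is, $u(\cdot,0^+)=\delta$) and the equation, with the $x$-derivatives moved onto $\varphi$, holds for every $t>0$ (all the time derivatives and integrals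 in it being required to exist). **(1) Diffusion.** For every $K>0$ the function $$\mathcal G_\beta(x,t)=\frac{1}{2\sqrt K\,t^{\beta/2}}\,M_{\beta/2}\!\left(\frac{|x|}{\sqrt K\,t^{\beta/2}}\right)$$ is a fundamental solution, unique up to equality for almost every $x$ for each $t>0$, of each of the three forms of the time-fractional diffusion equation: ${}_*D_t^\beta u=K\,\partial_x^2u$; $\ \partial_tu=K\,D_t^{1-\beta}\partial_x^2u$; $\ u=\delta+K\,J_t^\beta\partial_x^2u$. For $K=1$ it is $\mathcal G_\beta(x,t)=\frac12t^{-\beta/2}M_{\beta/2}(|x|t^{-\beta/2})$. **(2) Drift.** The function $\mathcal G^*_\beta(x,t)=t^{-\beta}M_\beta(x\,t^{-\beta})$ for $x>0$ and $\mathcal G^*_\beta(x,t)=0$ for $x<0$ is a fundamental solution, unique in the same sense, of the time-fractional drift equation ${}_*D_t^\beta u=-\partial_xu$. **(3) Transforms.** Write $\widehat f(\kappa)=\int_{\mathbb R}e^{i\kappa x}f(x)\,dx$, $\kappa\in\mathbb R$, and $\widetilde f(s)=\int_0^\infty e^{-st}f(t)\,dt$, $\operatorname{Re}s>0$. That $f$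 is the inverse transform of $F$ means that the integral that defines the transform of $f$ converges absolutely and equals $F$, and that any other such function equals $f$ almost everywhere. Both Green functions (with $K=1$ in (1)) are obtained by inverting the Fourier–Laplace transforms $$\frac{s^{\beta-1}}{s^\beta+\kappa^2}\quad\text{and}\quad\frac{s^{\beta-1}}{s^\beta-i\kappa}$$ in either order: (S1) For each $s$ with $\operatorname{Re}s>0$, their inverse Fourier transforms in $\kappa$ are, respectively, $\frac12s^{\beta/2-1}e^{-|x|s^{\beta/2}}$, and $s^{\beta-1}e^{-xs^\beta}$ for $x>0$, $0$ for $x<0$. The inverse Laplace transforms in $s$ of the latter functions are $\mathcal G_\beta(x,\cdot)$ for every real $x$, and $\mathcal G^*_\beta(x,\cdot)$ for every $x\ne0$. (S2) For each $\kappa\in\mathbb R$, their inverse Laplace transforms in $s$ are, respectively, $E_\beta(-\kappa^2t^\beta)$ and $E_\beta(i\kappa t^\beta)$. For each $t>0$ the inverse Fourier transforms in $\kappa$ of the latter functions are $\mathcal G_\beta(\cdot,t)$ and $\mathcal G^*_\beta(\cdot,t)$. -/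

import Mathlib

open MeasureTheory Filter Topology Set

noncomputable section

/-! Special functions -/

/-- The Wright function `W_{lam, mu}(z) = ∑ zⁿ / (n! Γ(lam n + mu))` of a real argument. `Real.Gamma`
vanishes at the poles of the Gamma function, so that `1 / Γ` has its correct value `0` there. -/
def wrightFunction (lam mu z : ℝ) : ℝ :=
  ∑' n : ℕ, z ^ n / ((n.factorial : ℝ) * Real.Gamma (lam * n + mu))

/-- The `M`-Wright (Mainardi) function `M_ν(z) = W_{-ν, 1-ν}(-z)`. -/
def mWright (ν z : ℝ) : ℝ := wrightFunction (-ν) (1 - ν) (-z)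

/-- The Mittag-Leffler function `E_α(z) = ∑ zⁿ / Γ(α n + 1)`. -/
def mittagLeffler (α : ℝ) (z : ℂ) : ℂ :=
  ∑' n : ℕ, z ^ n / Complex.Gamma ((α : ℂ) * n + 1)

/-! Fractional calculus in the time variable -/

/-- The Riemann-Liouville fractional integral `J^μ f (t)`. -/
def rlIntegral (μ : ℝ) (f : ℝ → ℝ) (t : ℝ) : ℝ :=
  1 / Real.Gamma μ * ∫ τ in (0 : ℝ)..t, (t - τ) ^ (μ - 1) * f τ

/-- The integral that defines `J^μ f (t)` converges absolutely. -/
def RLIntegrableAt (μ : ℝ) (f : ℝ → ℝ) (t : ℝ) : Prop :=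
  IntervalIntegrable (fun τ : ℝ => (t - τ) ^ (μ - 1) * f τ) volume 0 t

/-- `J^μ f (t)` exists and equals `v`. -/
def HasRLIntegralAt (μ : ℝ) (f : ℝ → ℝ) (v t : ℝ) : Prop :=
  RLIntegrableAt μ f t ∧ rlIntegral μ f t = v

/-- For `0 < μ < 1`: the Riemann-Liouville derivative `D^μ f (t) = d/dt J^{1-μ} f (t)` exists and
equals `v`. -/
def HasRLDerivAt (μ : ℝ) (f : ℝ → ℝ) (v t : ℝ) : Prop :=
  (∀ᶠ τ in 𝓝 t, RLIntegrableAt (1 - μ) f τ) ∧ HasDerivAt (rlIntegral (1 - μ) f) v t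

/-- For `0 < μ < 1`: the Caputo derivative `J^{1-μ} f' (t)` exists and equals `v`. -/
def HasCaputoDerivAt (μ : ℝ) (f : ℝ → ℝ) (v t : ℝ) : Prop :=
  (∀ τ ∈ Ioo 0 t, DifferentiableAt ℝ f τ) ∧ HasRLIntegralAt (1 - μ) (deriv f) v t

/-! Solutions in the sense of distributions in `x`, with initial datum `δ` -/

/-- Test functions: smooth functions of compact support on the line. -/
def IsTestFunction (φ : ℝ → ℝ) : Prop :=
  ContDiff ℝ (⊤ : ℕ∞) φ ∧ HasCompactSupport φ

/-- The pairing `⟨u(·, t), φ⟩` as a function of `t`. -/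
def pairing (u : ℝ → ℝ → ℝ) (φ : ℝ → ℝ) (t : ℝ) : ℝ := ∫ x, u x t * φ x

/-- `u(·, t)`, `t > 0`, is a family of integrable functions, bounded in `L¹` for bounded times, with
`u(·, 0⁺) = δ` in the sense of distributions. -/
structure StartsFromDelta (u : ℝ → ℝ → ℝ) : Prop where
  integrable : ∀ t, 0 < t → Integrable (fun x => u x t)
  bounded : ∀ T, 0 < T → ∃ C : ℝ, ∀ t ∈ Ioc 0 T, ∫ x, |u x t| ≤ C
  initial : ∀ φ, IsTestFunction φ → Tendsto (pairing u φ) (𝓝[>] 0) (𝓝 (φ 0))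

/-- `∂u/∂t = K D_t^{1-β} ∂²u/∂x²` (Riemann-Liouville form), tested against `φ`. -/
def SolvesDiffusionRL (β K : ℝ) (u : ℝ → ℝ → ℝ) : Prop :=
  ∀ φ, IsTestFunction φ → ∀ t, 0 < t →
    ∃ v : ℝ, HasRLDerivAt (1 - β) (pairing u (deriv (deriv φ))) v t ∧
      HasDerivAt (pairing u φ) (K * v) t

/-- `*D_t^β u = K ∂²u/∂x²` (Caputo form), tested against `φ`. -/
def SolvesDiffusionCaputo (β K : ℝ) (u : ℝ → ℝ → ℝ) : Prop :=
  ∀ φ, IsTestFunction φ → ∀ t, 0 < t →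
    HasCaputoDerivAt β (pairing u φ) (K * pairing u (deriv (deriv φ)) t) t

/-- `u = δ + K J_t^β ∂²u/∂x²` (integral form with initial datum `δ`), tested against `φ`. -/
def SolvesDiffusionIntegral (β K : ℝ) (u : ℝ → ℝ → ℝ) : Prop :=
  ∀ φ, IsTestFunction φ → ∀ t, 0 < t →
    ∃ v : ℝ, HasRLIntegralAt β (pairing u (deriv (deriv φ))) v t ∧
      pairing u φ t = φ 0 + K * v

/-- `*D_t^β u = - ∂u/∂x` (Caputo form), tested against `φ`; note `⟨-∂u/∂x, φ⟩ = ⟨u, φ'⟩`. -/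
def SolvesDriftCaputo (β : ℝ) (u : ℝ → ℝ → ℝ) : Prop :=
  ∀ φ, IsTestFunction φ → ∀ t, 0 < t →
    HasCaputoDerivAt β (pairing u φ) (pairing u (deriv φ) t) t

/-- `G` is the fundamental solution of the equation `Solves`: it solves it with initial datum `δ`,
and every other such solution coincides with it. -/
def IsTheFundamentalSolution (Solves : (ℝ → ℝ → ℝ) → Prop) (G : ℝ → ℝ → ℝ) : Prop :=
  (StartsFromDelta G ∧ Solves G) ∧
    ∀ u : ℝ → ℝ → ℝ, StartsFromDelta u → Solves u →
      ∀ t, 0 < t → (fun x => u x t) =ᵐ[volume] fun x => G x t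

/-! Fourier and Laplace transforms -/

/-- `F` is the Fourier transform of `f`, with the convention `∫ e^{iκx} f(x) dx`. -/
def IsFourierPair (f : ℝ → ℂ) (F : ℝ → ℂ) : Prop :=
  Integrable f ∧ ∀ κ : ℝ, ∫ x : ℝ, Complex.exp (Complex.I * κ * x) * f x = F κ

/-- `F` is the Laplace transform of `f` on the half-plane `Re s > 0`. -/
def IsLaplacePair (f : ℝ → ℂ) (F : ℂ → ℂ) : Prop :=
  ∀ s : ℂ, 0 < s.re →
    IntegrableOn (fun t : ℝ => Complex.exp (-s * t) * f t) (Ioi 0) ∧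
      ∫ t in Ioi (0 : ℝ), Complex.exp (-s * t) * f t = F s

/-- `f` is the inverse Fourier transform of `F`. -/
def IsInverseFourier (F : ℝ → ℂ) (f : ℝ → ℂ) : Prop :=
  IsFourierPair f F ∧ ∀ g : ℝ → ℂ, IsFourierPair g F → g =ᵐ[volume] f

/-- `f` is the inverse Laplace transform of `F`. -/
def IsInverseLaplace (F : ℂ → ℂ) (f : ℝ → ℂ) : Prop :=
  IsLaplacePair f F ∧
    ∀ g : ℝ → ℂ, IsLaplacePair g F → g =ᵐ[volume.restrict (Ioi 0)] f

/-! The two Green functions -/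

/-- `G(x,t) = ½ (√K t^{β/2})⁻¹ M_{β/2}(|x| / (√K t^{β/2}))`. -/
def diffusionGreen (β K x t : ℝ) : ℝ :=
  1 / 2 * (1 / (√K * t ^ (β / 2))) * mWright (β / 2) (|x| / (√K * t ^ (β / 2)))

/-- `G*(x,t) = t^{-β} M_β(x / t^β)` for `x > 0` and `0` for `x < 0` (the value at the single point
`x = 0` is immaterial). -/
def driftGreen (β x t : ℝ) : ℝ :=
  if 0 < x then t ^ (-β) * mWright β (x / t ^ β) else 0

end

/-! ### The Gamma integral with a complex rate -/

/-! Everything rests on one Hankel-type representation of `mWright`. Integrate z^{p-1} e^{tz - x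
z^ν} along the two rays arg z = ±θ and divide the difference by 2πi. Expanding e^{-x z^ν} produces
Gamma integrals, and the reflection formula turns their phases into the reciprocal Gamma factors of
the Wright series; p = ν gives t^{-ν} M_ν(x t^{-ν}) (`mWright_scaled_eq`). The angle is chosen so
that e^{tz} decays while z^ν stays in the right half-plane. Hence M_ν is bounded on x ≥ 0, and p = 1
gives ν x M_ν(x) and with it integrability on the half-line.

Taking the Laplace transform under the ray integral replaces e^{tz} by 1/(s - z). Cauchy's theorem,
applied after removing the singularity at z = s, gives the transform s^{ν-1} e^{-x s^ν}
(`laplace_mWright`). A Fourier transform in x then yields s^{ν-1}/(s^ν - iκ). Termwise integration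
of E_ν(iκ t^ν) gives the same function for large Re s, so injectivity of the Laplace transform and
continuity identify the Fourier transform of M_ν on the half-line with E_ν(iκ)
(`mWrightFourier_eq_mittagLeffler`). The drift kernel is the case ν = β. The diffusion kernel is the
even extension with ν = β/2, and the even part of E_{β/2}(iκ) is E_β(-κ²). The inverse transforms
are unique because the Fourier transform is injective on L¹.

For the equations, every form is reduced to the mild one, ⟨u,φ⟩ = φ(0) + J^β⟨u,Aφ⟩ with A = a∂ +
K∂². A Green function has Fourier transform E_β(S t^β), where S is the symbol of A; since E_β(S t^β)
= 1 + S J^β E_β(S τ^β), integrating against the inverse Fourier transform of φ shows that it is a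
mild solution (`IsSelfSimilarKernel.isMildSolution`). Self-similarity makes the pairings
differentiable in time, with derivative O(t^{β-1}), which suffices to pass from the mild form to the
Caputo form through J^β J^{1-β} = J^1.

For uniqueness (`IsMildSolution.ae_eq`), the difference of two mild solutions is tested against cos
κx and sin κx, whose span A preserves. A fractional Gronwall argument makes both pairings vanish, so
the Fourier transform of the difference is zero. -/

theorem integrableOn_rpow_mul_exp_neg {a c : ℝ} (ha : 0 < a) (hc : 0 < c) :
    IntegrableOn (fun t : ℝ => t ^ (a - 1) * Real.exp (-c * t)) (Ioi 0) := by
  have := integrableOn_rpow_mul_exp_neg_mul_rpow (s := a - 1) (p := 1) (b := c)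
    (by linarith) zero_lt_one hc
  simpa using this

theorem norm_rpow_mul_cexp {a t : ℝ} {z : ℂ} (ht : 0 < t) :
    ‖((t ^ (a - 1) : ℝ) : ℂ) * Complex.exp z‖ = t ^ (a - 1) * Real.exp z.re := by
  rw [norm_mul, Complex.norm_exp, Complex.norm_real, Real.norm_of_nonneg (by positivity)]

/-- Both sides are holomorphic on Re s > 0 and agree at the real numbers r > 1, which accumulate at
1; the identity theorem extends the real formula to the half-plane. -/
theorem integral_rpow_mul_cexp_neg_mul {a : ℝ} (ha : 0 < a) {s : ℂ} (hs : 0 < s.re) :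
    IntegrableOn (fun t : ℝ => ((t ^ (a - 1) : ℝ) : ℂ) * Complex.exp (-s * t)) (Ioi 0) ∧
    ∫ t in Ioi (0 : ℝ), ((t ^ (a - 1) : ℝ) : ℂ) * Complex.exp (-s * t) =
      Complex.Gamma a * s ^ (-(a : ℂ)) := by
  have hmeas : ∀ (b : ℝ) (z : ℂ), AEStronglyMeasurable
      (fun t : ℝ => ((t ^ (b - 1) : ℝ) : ℂ) * Complex.exp (-z * t)) (volume.restrict (Ioi 0)) :=
    fun b z => by
      apply Measurable.aestronglyMeasurable
      fun_prop
  have hint : ∀ b : ℝ, 0 < b → ∀ z : ℂ, 0 < z.re → IntegrableOn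
      (fun t : ℝ => ((t ^ (b - 1) : ℝ) : ℂ) * Complex.exp (-z * t)) (Ioi 0) := by
    intro b hb z hz
    refine (integrableOn_rpow_mul_exp_neg hb hz).mono' (hmeas b z) ?_
    filter_upwards [ae_restrict_mem measurableSet_Ioi] with t ht
    rw [norm_rpow_mul_cexp ht]
    simp
  refine ⟨hint a ha s hs, ?_⟩
  let U : Set ℂ := {z | 0 < z.re}
  have hU : IsOpen U := isOpen_lt continuous_const Complex.continuous_re
  have hUc : IsPreconnected U := (convex_halfSpace_re_gt 0).isPreconnected
  let F : ℂ → ℂ := fun z => ∫ t in Ioi (0 : ℝ), ((t ^ (a - 1) : ℝ) : ℂ) * Complex.exp (-z * t)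
  let G : ℂ → ℂ := fun z => Complex.Gamma a * z ^ (-(a : ℂ))
  have hF : DifferentiableOn ℂ F U := by
    intro z hz
    have hz : 0 < z.re := hz
    -- The derivative in `w` brings down a factor t, whence the exponent `a + 1` in the bound; on Re
    -- w > Re z / 2 the exponential rate is uniform.
    have hder := hasDerivAt_integral_of_dominated_loc_of_deriv_le (𝕜 := ℂ)
      (μ := volume.restrict (Ioi (0 : ℝ))) (x₀ := z) (s := {w : ℂ | z.re / 2 < w.re})
      (F := fun (w : ℂ) (t : ℝ) => ((t ^ (a - 1) : ℝ) : ℂ) * Complex.exp (-w * t))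
      (F' := fun (w : ℂ) (t : ℝ) => ((t ^ (a - 1) : ℝ) : ℂ) * (Complex.exp (-w * t) * (-1 * t)))
      (bound := fun t => t ^ ((a + 1) - 1) * Real.exp (-(z.re / 2) * t))
      ((isOpen_lt continuous_const Complex.continuous_re).mem_nhds (by simp; linarith))
      (Eventually.of_forall fun w => hmeas a w) (hint a ha z hz)
      (by
        apply Measurable.aestronglyMeasurable
        fun_prop) ?_ (integrableOn_rpow_mul_exp_neg (by linarith) (by linarith)) ?_
    · exact hder.2.differentiableAt.differentiableWithinAt
    · filter_upwards [ae_restrict_mem measurableSet_Ioi] with t ht w hw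
      have ht : 0 < t := ht
      have hw : z.re / 2 < w.re := hw
      rw [← mul_assoc, norm_mul, norm_rpow_mul_cexp ht]
      have : t ^ (a + 1 - 1) = t ^ (a - 1) * t := by
        rw [show a + 1 - 1 = (a - 1) + 1 by ring, Real.rpow_add_one ht.ne']
      rw [this]
      have h2 : ‖(-1 * t : ℂ)‖ = t := by simp [abs_of_pos ht]
      rw [h2, mul_assoc, mul_assoc, mul_comm t]
      gcongr
      simp
      nlinarith
    · filter_upwards with t w hw
      have : HasDerivAt (fun w : ℂ => -w * t) (-1 * (t : ℂ)) w := (hasDerivAt_neg w).mul_const _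
      exact this.cexp.const_mul _
  have hG : DifferentiableOn ℂ G U := by
    intro z hz
    have hz' : z ∈ Complex.slitPlane := Or.inl hz
    exact ((differentiableAt_id.cpow_const hz').const_mul _).differentiableWithinAt
  have hfreq : ∃ᶠ z in 𝓝[≠] (1 : ℂ), F z = G z := by
    have htend : Tendsto (fun r : ℝ => (r : ℂ)) (𝓝[>] 1) (𝓝[≠] (1 : ℂ)) := by
      refine tendsto_nhdsWithin_iff.2 ⟨?_, ?_⟩
      · exact (Complex.continuous_ofReal.tendsto' 1 1 (by simp)).mono_left nhdsWithin_le_nhds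
      · filter_upwards [self_mem_nhdsWithin] with r hr
        have hr : 1 < r := hr
        simpa using (ne_of_gt hr)
    refine htend.frequently (Eventually.frequently ?_)
    filter_upwards [self_mem_nhdsWithin] with r hr
    have hr : 0 < r := lt_trans zero_lt_one hr
    have := Complex.integral_cpow_mul_exp_neg_mul_Ioi (a := a) (r := r) (by simpa) hr
    simp only [F, G]
    rw [mul_comm, Complex.cpow_neg, ← Complex.inv_cpow _ _ (by
      rw [Complex.arg_ofReal_of_nonneg hr.le]; exact Real.pi_pos.ne), ← one_div, ← this]
    refine setIntegral_congr_fun measurableSet_Ioi fun t ht => ?_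
    have ht : 0 < t := ht
    rw [Complex.ofReal_cpow ht.le]
    push_cast
    ring_nf
  exact (hF.analyticOnNhd hU).eqOn_of_preconnected_of_frequently_eq (hG.analyticOnNhd hU) hUc
    (by simp [U]) hfreq hs

/-! ### Uniqueness of inverse Fourier and Laplace transforms -/

open scoped FourierTransform in
theorem integral_cexp_eq_fourier (f : ℝ → ℂ) (κ : ℝ) :
    ∫ x : ℝ, Complex.exp (Complex.I * κ * x) * f x = 𝓕 f (-κ / (2 * Real.pi)) := by
  rw [Real.fourier_real_eq_integral_exp_smul]
  refine integral_congr_ae (Eventually.of_forall fun x => ?_)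
  simp only [smul_eq_mul]
  congr 2
  push_cast
  have : (Real.pi : ℂ) ≠ 0 := by exact_mod_cast Real.pi_ne_zero
  field_simp

open scoped FourierTransform in
theorem fourier_eq_integral_cexp (f : ℝ → ℂ) (ξ : ℝ) :
    𝓕 f ξ = ∫ x : ℝ, Complex.exp (Complex.I * ((-2 * Real.pi * ξ : ℝ) : ℂ) * x) * f x := by
  rw [integral_cexp_eq_fourier]
  have := Real.pi_ne_zero
  field_simp

open scoped FourierTransform SchwartzMap in
/-- Multiplication formula for the Fourier transform and a Schwartz function. -/
theorem integral_fourier_mul_schwartz {f : ℝ → ℂ} (hf : Integrable f) (ψ : 𝓢(ℝ, ℂ)) :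
    ∫ x, 𝓕 f x * ψ x = ∫ x, f x * 𝓕 (ψ : ℝ → ℂ) x := by
  have h := VectorFourier.integral_fourierIntegral_smul_eq_flip (L := innerₗ ℝ) (μ := volume)
    (ν := volume) Real.continuous_fourierChar continuous_inner hf ψ.integrable
  rw [flip_innerₗ] at h
  exact h

open scoped FourierTransform SchwartzMap in
-- Every smooth g of compact support is the Fourier transform of a Schwartz function, so the
-- multiplication formula moves the transform onto f and gives ∫ g f = 0.
theorem ae_eq_zero_of_fourier_eq_zero {f : ℝ → ℂ} (hf : Integrable f) (h : ∀ ξ, 𝓕 f ξ = 0) :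
    f =ᵐ[volume] 0 := by
  refine ae_eq_zero_of_integral_contDiff_smul_eq_zero hf.locallyIntegrable fun g hg hgc => ?_
  have hgc' : HasCompactSupport (fun x => (g x : ℂ)) := hgc.comp_left Complex.ofReal_zero
  let φ : 𝓢(ℝ, ℂ) := hgc'.toSchwartzMap (Complex.ofRealCLM.contDiff.comp hg)
  have h1 := integral_fourier_mul_schwartz hf (𝓕⁻ φ)
  rw [← SchwartzMap.fourier_coe, FourierTransform.fourier_fourierInv_eq] at h1
  simp only [h, zero_mul, integral_zero] at h1
  rw [h1]
  refine integral_congr_ae (Eventually.of_forall fun x => ?_)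
  have hφ : φ x = g x := rfl
  simp [hφ, mul_comm]

theorem IsFourierPair.ae_eq {f g F : ℝ → ℂ} (hf : IsFourierPair f F) (hg : IsFourierPair g F) :
    g =ᵐ[volume] f := by
  have h : (fun x => g x - f x) =ᵐ[volume] 0 := by
    refine ae_eq_zero_of_fourier_eq_zero (hg.1.sub hf.1) fun ξ => ?_
    rw [fourier_eq_integral_cexp]
    have key : ∀ (u : ℝ → ℂ), Integrable u → ∀ κ : ℝ,
        Integrable fun x : ℝ => Complex.exp (Complex.I * κ * x) * u x := by
      intro u hu κ
      refine hu.bdd_mul (c := 1) (by fun_prop) (Eventually.of_forall fun x => ?_)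
      rw [mul_assoc, ← Complex.ofReal_mul, mul_comm Complex.I, Complex.norm_exp_ofReal_mul_I]
    simp only [mul_sub]
    rw [integral_sub (key g hg.1 _) (key f hf.1 _), hg.2, hf.2, sub_self]
  filter_upwards [h] with x hx using sub_eq_zero.1 hx

theorem IsFourierPair.isInverseFourier {f F : ℝ → ℂ} (hf : IsFourierPair f F) :
    IsInverseFourier F f :=
  ⟨hf, fun _ hg => hf.ae_eq hg⟩

/-- Two functions whose Laplace transforms agree on one vertical line agree almost everywhere. -/
theorem ae_eq_of_laplace_eq_on_line {f g : ℝ → ℂ} (σ : ℝ)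
    (hf : ∀ s : ℂ, s.re = σ →
      IntegrableOn (fun t : ℝ => Complex.exp (-s * t) * f t) (Ioi 0))
    (hg : ∀ s : ℂ, s.re = σ →
      IntegrableOn (fun t : ℝ => Complex.exp (-s * t) * g t) (Ioi 0))
    (h : ∀ s : ℂ, s.re = σ → ∫ t in Ioi (0 : ℝ), Complex.exp (-s * t) * f t =
      ∫ t in Ioi (0 : ℝ), Complex.exp (-s * t) * g t) :
    f =ᵐ[volume.restrict (Ioi 0)] g := by
  -- With s = σ - iκ, the Laplace integral of u is the Fourier transform at κ of e^{-σt} u(t) cut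
  -- off to t > 0.
  have key : ∀ u : ℝ → ℂ, (∀ s : ℂ, s.re = σ →
      IntegrableOn (fun t : ℝ => Complex.exp (-s * t) * u t) (Ioi 0)) →
      IsFourierPair ((Ioi 0).indicator fun t : ℝ => Complex.exp (-(σ : ℂ) * t) * u t)
        fun κ => ∫ t in Ioi (0 : ℝ), Complex.exp (-((σ : ℂ) - Complex.I * κ) * t) * u t := by
    intro u hu
    refine ⟨(integrable_indicator_iff measurableSet_Ioi).2 (hu σ (by simp)), fun κ => ?_⟩
    beta_reduce
    rw [← integral_indicator measurableSet_Ioi]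
    refine integral_congr_ae (Eventually.of_forall fun t => ?_)
    by_cases ht : t ∈ Ioi (0 : ℝ)
    · simp only [indicator_of_mem ht]
      rw [← mul_assoc, ← Complex.exp_add]
      ring_nf
    · simp only [indicator_of_notMem ht, mul_zero]
  have hF : (fun κ : ℝ => ∫ t in Ioi (0 : ℝ), Complex.exp (-((σ : ℂ) - Complex.I * κ) * t) * g t)
      = fun κ : ℝ => ∫ t in Ioi (0 : ℝ), Complex.exp (-((σ : ℂ) - Complex.I * κ) * t) * f t := by
    funext κ
    exact (h _ (by simp)).symm
  have h1 := (key g hg).ae_eq (hF ▸ key f hf)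
  rw [EventuallyEq, ae_restrict_iff' measurableSet_Ioi]
  filter_upwards [h1] with t ht htm
  simpa only [indicator_of_mem htm, mul_eq_mul_left_iff, Complex.exp_ne_zero, or_false] using ht

theorem IsLaplacePair.isInverseLaplace {f : ℝ → ℂ} {F : ℂ → ℂ} (hf : IsLaplacePair f F) :
    IsInverseLaplace F f := by
  refine ⟨hf, fun g hg => ?_⟩
  refine ae_eq_of_laplace_eq_on_line 1 (fun s hs => (hg s ?_).1) (fun s hs => (hf s ?_).1)
    fun s hs => ?_
  · simp [hs]
  · simp [hs]
  · rw [(hg s (by simp [hs])).2, (hf s (by simp [hs])).2]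

/-! ### Ray integrals and the `M`-Wright function -/

/-- Since ν < 1, the power is sublinear: with b^{ν-1} = ε, one has r^ν ≤ ε r for r ≥ b, and r^ν ≤
b^ν below. This lets exponential decay absorb a factor e^{B r^ν}. -/
theorem exists_mul_rpow_le {ν : ℝ} (hν0 : 0 < ν) (hν1 : ν < 1) {B c : ℝ} (hB : 0 ≤ B)
    (hc : 0 < c) : ∃ C : ℝ, ∀ r : ℝ, 0 < r → B * r ^ ν ≤ c * r + C := by
  set ε := c / (B + 1) with hε
  have hε0 : 0 < ε := by positivity
  set b := ε ^ (-(1 / (1 - ν))) with hb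
  have hb0 : 0 < b := by positivity
  have hbν : b ^ (ν - 1) = ε := by
    rw [hb, ← Real.rpow_mul hε0.le]
    have : 1 - ν ≠ 0 := by linarith
    rw [show -(1 / (1 - ν)) * (ν - 1) = 1 by field_simp; ring, Real.rpow_one]
  have hBε : B * ε ≤ c := by
    rw [hε, mul_div_assoc', div_le_iff₀ (by positivity)]
    nlinarith
  refine ⟨B * b ^ ν, fun r hr => ?_⟩
  rcases le_total r b with h | h
  · have : r ^ ν ≤ b ^ ν := Real.rpow_le_rpow hr.le h hν0.le
    have := mul_le_mul_of_nonneg_left this hB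
    nlinarith
  · have h1 : r ^ ν ≤ ε * r := by
      rw [show ν = (ν - 1) + 1 by ring, Real.rpow_add_one hr.ne', ← hbν]
      exact mul_le_mul_of_nonneg_right
        (Real.rpow_le_rpow_of_nonpos hb0 h (by linarith)) hr.le
    have h2 := mul_le_mul_of_nonneg_left h1 hB
    have h3 := mul_le_mul_of_nonneg_right hBε hr.le
    have : 0 ≤ B * b ^ ν := by positivity
    nlinarith

theorem integrableOn_rpow_mul_exp_mul_exp_rpow {ν p B c : ℝ} (hν0 : 0 < ν) (hν1 : ν < 1)
    (hp : 0 < p) (hB : 0 ≤ B) (hc : 0 < c) :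
    IntegrableOn (fun r : ℝ => r ^ (p - 1) * Real.exp (-c * r) * Real.exp (B * r ^ ν))
      (Ioi 0) := by
  obtain ⟨C, hC⟩ := exists_mul_rpow_le hν0 hν1 hB (half_pos hc)
  refine ((integrableOn_rpow_mul_exp_neg hp (half_pos hc)).mul_const (Real.exp C)).mono' ?_ ?_
  · exact Measurable.aestronglyMeasurable (by fun_prop)
  · filter_upwards [ae_restrict_mem measurableSet_Ioi] with r hr
    have hr : 0 < r := hr
    rw [Real.norm_of_nonneg (by positivity), mul_assoc, mul_assoc, ← Real.exp_add, ← Real.exp_add]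
    exact mul_le_mul_of_nonneg_left (Real.exp_le_exp.2 (by linarith [hC r hr])) (by positivity)

/-- Integrand of the Hankel-type representation of the Wright function along the ray of
argument `θ`. -/
noncomputable def rayKernel (ν θ p x t r : ℝ) : ℂ :=
  ((r ^ (p - 1) : ℝ) : ℂ) * Complex.exp (Complex.I * (θ * p) + t * (r * Complex.exp (Complex.I * θ))
    - x * (((r ^ ν : ℝ) : ℂ) * Complex.exp (Complex.I * (θ * ν))))

theorem re_ofReal_mul_cexp (r θ : ℝ) : (r * Complex.exp (Complex.I * θ)).re = r * Real.cos θ := by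
  rw [Complex.re_ofReal_mul, mul_comm Complex.I, Complex.exp_ofReal_mul_I_re]

theorem norm_rayKernel {ν θ p x t r : ℝ} (hr : 0 < r) :
    ‖rayKernel ν θ p x t r‖ = r ^ (p - 1) *
      Real.exp (t * (r * Real.cos θ) - x * (r ^ ν * Real.cos (θ * ν))) := by
  rw [rayKernel, norm_rpow_mul_cexp hr]
  congr 2
  rw [Complex.sub_re, Complex.add_re, Complex.re_ofReal_mul t, Complex.re_ofReal_mul x,
    re_ofReal_mul_cexp, ← Complex.ofReal_mul, ← Complex.ofReal_mul, re_ofReal_mul_cexp]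
  simp

/-- Here `η` stands for π or -π, so that the upper and the lower ray are treated together. -/
theorem cos_neg_of_cexp_eq {θ η : ℝ} (hη : Complex.exp (Complex.I * η) = -1)
    (hθ : |θ - η| < Real.pi / 2) : Real.cos θ < 0 := by
  have h1 : Real.cos η = -1 := by
    have := congrArg Complex.re hη
    rwa [mul_comm, Complex.exp_ofReal_mul_I_re] at this
  have h2 : Real.sin η = 0 := by
    have := Real.sin_sq_add_cos_sq η
    rw [h1] at this
    nlinarith
  have h3 : Real.cos (θ - η) = - Real.cos θ := by
    rw [Real.cos_sub, h1, h2]; ring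
  have h4 := Real.cos_pos_of_mem_Ioo (abs_lt.1 hθ)
  linarith

theorem cpow_mul_cexp {t α q : ℝ} (ht : 0 < t) (hα : |α| < Real.pi / 2) :
    ((t : ℂ) * Complex.exp (Complex.I * α)) ^ (-(q : ℂ)) =
      ((t ^ (-q) : ℝ) : ℂ) * Complex.exp (-(Complex.I * (α * q))) := by
  have hα' := abs_lt.1 hα
  have hπ := Real.pi_pos
  have h1 : (t : ℂ) * Complex.exp (Complex.I * α) =
      Complex.exp (((Real.log t : ℝ) : ℂ) + Complex.I * α) := by
    rw [Complex.exp_add, ← Complex.ofReal_exp, Real.exp_log ht]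
  rw [h1, Complex.cpow_def_of_ne_zero (Complex.exp_ne_zero _), Complex.log_exp (by simp; linarith)
    (by simp; linarith), Real.rpow_def_of_pos ht, Complex.ofReal_exp, ← Complex.exp_add]
  congr 1
  push_cast
  ring

/-- Expand e^{-x z^ν} and integrate termwise: the n-th term is a Gamma integral with exponent q = νn
+ p and rate -t e^{iθ} = t e^{i(θ-η)}. Its power contributes the phase e^{-i(θ-η)q}, and the ray
contributes e^{iθq}; the product e^{iηq} no longer depends on θ. -/
theorem hasSum_integral_rayKernel {ν θ η p t : ℝ} (hν0 : 0 < ν) (hν1 : ν < 1)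
    (hη : Complex.exp (Complex.I * η) = -1) (hθ : |θ - η| < Real.pi / 2) (hp : 0 < p) (ht : 0 < t)
    (x : ℝ) :
    HasSum (fun n : ℕ => (((-x) ^ n / n.factorial * Real.Gamma (ν * n + p) *
        t ^ (-(ν * n + p)) : ℝ) : ℂ) * Complex.exp (Complex.I * (η * (ν * n + p))))
      (∫ r in Ioi (0 : ℝ), rayKernel ν θ p x t r) := by
  have hcos := cos_neg_of_cexp_eq hη hθ
  set c : ℂ := Complex.exp (Complex.I * (θ * ν)) with hcdef
  have hc : ‖c‖ = 1 := by
    rw [hcdef, mul_comm, ← Complex.ofReal_mul, Complex.norm_exp_ofReal_mul_I]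
  let E : ℝ → ℂ := fun r => Complex.exp (Complex.I * (θ * p) + t * (r * Complex.exp (Complex.I * θ)))
  have hE : ∀ r, ‖E r‖ = Real.exp (-(-(t * Real.cos θ)) * r) := by
    intro r
    rw [Complex.norm_exp, Complex.add_re, Complex.re_ofReal_mul, re_ofReal_mul_cexp]
    congr 1
    simp only [Complex.mul_re, Complex.I_re, Complex.I_im, ← Complex.ofReal_mul, Complex.ofReal_im]
    ring
  have hterm : ∀ n : ℕ, ∫ r in Ioi (0 : ℝ), ((r ^ (p - 1) : ℝ) : ℂ) * E r *
      ((-(x * (((r ^ ν : ℝ) : ℂ) * c))) ^ n / (n.factorial : ℂ)) =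
      (((-x) ^ n / n.factorial * Real.Gamma (ν * n + p) *
        t ^ (-(ν * n + p)) : ℝ) : ℂ) * Complex.exp (Complex.I * (η * (ν * n + p))) := by
    intro n
    set q : ℝ := ν * n + p with hq
    have hq0 : 0 < q := by positivity
    -- The argument θ - η lies in (-π/2, π/2), so the rate has positive real part and its principal
    -- power can be read off.
    set s : ℂ := t * Complex.exp (Complex.I * ((θ - η : ℝ) : ℂ)) with hs
    have hsθ : s = -(t * Complex.exp (Complex.I * θ)) := by
      have : Complex.exp (Complex.I * θ) = Complex.exp (Complex.I * ((θ - η : ℝ) : ℂ)) *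
          Complex.exp (Complex.I * η) := by
        rw [← Complex.exp_add]; push_cast; ring_nf
      rw [this, hη, hs]; ring
    have hsre : 0 < s.re := by
      rw [hs, re_ofReal_mul_cexp]
      exact mul_pos ht (Real.cos_pos_of_mem_Ioo (abs_lt.1 hθ))
    have hG := (integral_rpow_mul_cexp_neg_mul hq0 hsre).2
    have : ∀ r ∈ Ioi (0 : ℝ), ((r ^ (p - 1) : ℝ) : ℂ) * E r *
      ((-(x * (((r ^ ν : ℝ) : ℂ) * c))) ^ n / (n.factorial : ℂ)) =
        (((-x) ^ n / n.factorial : ℝ) : ℂ) * Complex.exp (Complex.I * (θ * q)) *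
          (((r ^ (q - 1) : ℝ) : ℂ) * Complex.exp (-s * r)) := by
      intro r hr
      have hr : 0 < r := hr
      have e1 : r ^ (q - 1) = r ^ (p - 1) * (r ^ ν) ^ n := by
        rw [← Real.rpow_natCast (r ^ ν), ← Real.rpow_mul hr.le, ← Real.rpow_add hr]
        congr 1; rw [hq]; ring
      have e2 : Complex.exp (Complex.I * (θ * q)) = Complex.exp (Complex.I * (θ * p)) * c ^ n := by
        rw [hcdef, ← Complex.exp_nat_mul, ← Complex.exp_add, hq]
        push_cast; ring_nf
      have e3 : E r = Complex.exp (Complex.I * (θ * p)) * Complex.exp (-s * r) := by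
        simp only [E]
        rw [hsθ, Complex.exp_add]; ring_nf
      rw [e1, e2, e3]
      push_cast
      rw [neg_pow, neg_pow (x : ℂ), mul_pow, mul_pow]
      ring
    rw [setIntegral_congr_fun measurableSet_Ioi this, integral_const_mul, hG, hs,
      cpow_mul_cexp ht hθ, Complex.Gamma_ofReal]
    have e4 : Complex.exp (Complex.I * (η * q)) = Complex.exp (Complex.I * (θ * q)) *
        Complex.exp (-(Complex.I * (((θ - η : ℝ) : ℂ) * q))) := by
      rw [← Complex.exp_add]; push_cast; ring_nf
    have e5 : (ν * n + p : ℂ) = (q : ℂ) := by rw [hq]; push_cast; rfl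
    rw [e5, e4]
    push_cast
    ring
  simp_rw [← hterm]
  have hexp : ∀ y : ℝ, HasSum (fun n : ℕ => y ^ n / (n.factorial : ℝ)) (Real.exp y) := fun y => by
    rw [Real.exp_eq_exp_ℝ]; exact NormedSpace.expSeries_div_hasSum_exp y
  have hcexp : ∀ y : ℂ, HasSum (fun n : ℕ => y ^ n / (n.factorial : ℂ)) (Complex.exp y) :=
    fun y => by rw [Complex.exp_eq_exp_ℂ]; exact NormedSpace.expSeries_div_hasSum_exp y
  -- The majorants sum to r^{p-1} e^{t r cos θ} e^{|x| r^ν}, which is integrable because cos θ < 0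
  -- and ν < 1.
  refine hasSum_integral_of_dominated_convergence (fun n r => r ^ (p - 1) *
    Real.exp (-(-(t * Real.cos θ)) * r) * ((|x| * r ^ ν) ^ n / n.factorial)) ?_ ?_ ?_ ?_ ?_
  · intro n
    exact Measurable.aestronglyMeasurable (by fun_prop)
  · intro n
    filter_upwards [ae_restrict_mem measurableSet_Ioi] with r hr
    have hr : 0 < r := hr
    rw [norm_mul, norm_mul, hE, Complex.norm_real, Real.norm_of_nonneg (by positivity)]
    rw [norm_div, norm_pow, norm_neg, norm_mul, norm_mul, hc, mul_one, Complex.norm_real,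
      Complex.norm_real, Complex.norm_natCast, Real.norm_of_nonneg (r := r ^ ν) (by positivity),
      Real.norm_eq_abs]
  · exact Eventually.of_forall fun r => ((hexp _).summable.mul_left _)
  · refine (integrableOn_rpow_mul_exp_mul_exp_rpow hν0 hν1 hp (abs_nonneg x)
      (neg_pos.2 (mul_neg_of_pos_of_neg ht hcos))).congr ?_
    refine Eventually.of_forall fun r => ?_
    simp only
    rw [tsum_mul_left, (hexp _).tsum_eq]
  · filter_upwards with r
    have := (hcexp (-(x * (((r ^ ν : ℝ) : ℂ) * c)))).mul_left (((r ^ (p - 1) : ℝ) : ℂ) * E r)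
    have h2 : rayKernel ν θ p x t r =
        ((r ^ (p - 1) : ℝ) : ℂ) * E r * Complex.exp (-(x * (((r ^ ν : ℝ) : ℂ) * c))) := by
      unfold rayKernel
      rw [mul_assoc, ← Complex.exp_add, ← sub_eq_add_neg]
    rwa [h2]

theorem hasSum_of_eq {E : Type*} [AddCommMonoid E] [TopologicalSpace E] {f g : ℕ → E} {a : E}
    (h : ∀ n, f n = g n) (hg : HasSum g a) : HasSum f a := by
  rwa [funext h]

/-- The argument of the rays used in the Hankel-type representation of `M_ν`. -/
noncomputable def rayAngle (ν : ℝ) : ℝ := Real.pi * (1 - ν / 2)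

/-- Difference of the integrals along the rays of arguments `± rayAngle ν`, divided by `2πi`. -/
noncomputable def hankelIntegral (ν p x t : ℝ) : ℂ :=
  ((∫ r in Ioi (0 : ℝ), rayKernel ν (rayAngle ν) p x t r) -
    ∫ r in Ioi (0 : ℝ), rayKernel ν (-rayAngle ν) p x t r) / (2 * Real.pi * Complex.I)

theorem abs_rayAngle_sub_pi {ν : ℝ} (hν0 : 0 < ν) (hν1 : ν < 1) :
    |rayAngle ν - Real.pi| < Real.pi / 2 := by
  have := Real.pi_pos
  rw [rayAngle, abs_lt]
  constructor <;> nlinarith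

theorem abs_neg_rayAngle_sub_neg_pi {ν : ℝ} (hν0 : 0 < ν) (hν1 : ν < 1) :
    |-rayAngle ν - -Real.pi| < Real.pi / 2 := by
  rw [← abs_neg]
  convert abs_rayAngle_sub_pi hν0 hν1 using 2
  ring

theorem cos_rayAngle_neg {ν : ℝ} (hν0 : 0 < ν) (hν1 : ν < 1) : Real.cos (rayAngle ν) < 0 :=
  cos_neg_of_cexp_eq (by rw [mul_comm, Complex.exp_pi_mul_I]) (abs_rayAngle_sub_pi hν0 hν1)

/-- The bound ν(1 - ν/2) < 1/2 is (1 - ν)² > 0. Thus the rays lie in the left half-plane while their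
images under z ↦ z^ν stay in the right one: e^{tz} decays, and e^{-x z^ν} is bounded for x ≥ 0. -/
theorem rayAngle_mul_mem {ν : ℝ} (hν0 : 0 < ν) (hν1 : ν < 1) :
    rayAngle ν * ν ∈ Ioo 0 (Real.pi / 2) := by
  have := Real.pi_pos
  rw [rayAngle]
  constructor
  · have : 0 < 1 - ν / 2 := by linarith
    positivity
  · nlinarith [mul_pos this (mul_pos (sub_pos.2 hν1) (sub_pos.2 hν1))]

theorem cos_rayAngle_mul_pos {ν : ℝ} (hν0 : 0 < ν) (hν1 : ν < 1) :
    0 < Real.cos (rayAngle ν * ν) := by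
  have h := rayAngle_mul_mem hν0 hν1
  exact Real.cos_pos_of_mem_Ioo ⟨by linarith [h.1, Real.pi_pos], h.2⟩

/-- The phases e^{±iπ(νn+p)} of the two rays differ by 2i times a sine. -/
theorem hasSum_hankelIntegral {ν p t : ℝ} (hν0 : 0 < ν) (hν1 : ν < 1) (hp : 0 < p) (ht : 0 < t)
    (x : ℝ) :
    HasSum (fun n : ℕ => (((-x) ^ n / n.factorial * t ^ (-(ν * n + p)) *
      (Real.Gamma (ν * n + p) * Real.sin (Real.pi * (ν * n + p)) / Real.pi) : ℝ) : ℂ))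
      (hankelIntegral ν p x t) := by
  have h1 := hasSum_integral_rayKernel (η := Real.pi) hν0 hν1
    (by rw [mul_comm, Complex.exp_pi_mul_I]) (abs_rayAngle_sub_pi hν0 hν1) hp ht x
  have h2 := hasSum_integral_rayKernel (η := -Real.pi) hν0 hν1
    (by rw [Complex.ofReal_neg, mul_neg, Complex.exp_neg, mul_comm, Complex.exp_pi_mul_I]; norm_num)
    (abs_neg_rayAngle_sub_neg_pi hν0 hν1) hp ht x
  have hπ : (Real.pi : ℂ) ≠ 0 := by exact_mod_cast Real.pi_ne_zero
  refine hasSum_of_eq (fun n => ?_) ((h1.sub h2).div_const (2 * Real.pi * Complex.I))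
  have hs : ((Real.sin (Real.pi * (ν * n + p)) : ℝ) : ℂ) =
      (Complex.exp (Complex.I * (Real.pi * (ν * n + p))) -
        Complex.exp (Complex.I * (((-Real.pi : ℝ) : ℂ) * (ν * n + p)))) / (2 * Complex.I) := by
    rw [Complex.ofReal_sin, Complex.sin]
    push_cast
    field_simp
    ring_nf
    rw [Complex.I_sq]
    ring
  rw [← mul_sub]
  simp only [Complex.ofReal_mul, Complex.ofReal_div, hs]
  field_simp [Complex.I_ne_zero]

/-- This is the reflection formula. It persists at positive integers q, where the sine vanishes,
`Real.Gamma` is 0 at its pole, and 0⁻¹ = 0. -/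
theorem inv_Gamma_one_sub {q : ℝ} (hq : 0 < q) :
    (Real.Gamma (1 - q))⁻¹ = Real.Gamma q * Real.sin (Real.pi * q) / Real.pi := by
  have h := Real.Gamma_mul_Gamma_one_sub q
  have hG := (Real.Gamma_pos_of_pos hq).ne'
  have h2 : Real.Gamma (1 - q) = Real.pi / Real.sin (Real.pi * q) / Real.Gamma q := by
    rw [← h]; field_simp
  rw [h2]
  simp only [inv_div]
  field_simp

/-- Summability is inherited from the ray integrals: the series is the one of `hankelIntegral` with
p = ν and t = 1. -/
theorem hasSum_mWright {ν : ℝ} (hν0 : 0 < ν) (hν1 : ν < 1) (y : ℝ) :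
    HasSum (fun n : ℕ => (-y) ^ n / ((n.factorial : ℝ) * Real.Gamma (-ν * n + (1 - ν))))
      (mWright ν y) := by
  rw [mWright, wrightFunction]
  apply Summable.hasSum
  rw [← Complex.summable_ofReal]
  refine (summable_congr fun n => congrArg Complex.ofReal ?_).2
    (hasSum_hankelIntegral hν0 hν1 hν0 one_pos y).summable
  rw [← inv_Gamma_one_sub (by positivity), Real.one_rpow, mul_one,
    show 1 - (ν * n + ν) = -ν * n + (1 - ν) by ring]
  rw [div_mul_eq_div_div, div_eq_mul_inv (_ / _)]

theorem mWright_scaled_eq {ν t : ℝ} (hν0 : 0 < ν) (hν1 : ν < 1) (ht : 0 < t) (x : ℝ) :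
    ((t ^ (-ν) * mWright ν (x * t ^ (-ν)) : ℝ) : ℂ) = hankelIntegral ν ν x t := by
  have h := ((hasSum_mWright hν0 hν1 (x * t ^ (-ν))).mul_left (t ^ (-ν)))
  refine (Complex.hasSum_ofReal.2 h).unique ?_
  refine hasSum_of_eq (fun n => congrArg Complex.ofReal ?_) (hasSum_hankelIntegral hν0 hν1 hν0 ht x)
  rw [← inv_Gamma_one_sub (by positivity),
    show 1 - (ν * n + ν) = -ν * n + (1 - ν) by ring, ← neg_mul, mul_pow, ← Real.rpow_natCast (t ^ (-ν)),
    ← Real.rpow_mul ht.le, show -(ν * n + ν) = -ν + -ν * n by ring, Real.rpow_add ht]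
  rw [div_mul_eq_div_div, div_eq_mul_inv (_ / _)]
  ring

/-- For p = 1 the term n = 0 of the series vanishes, as sin π = 0, and the shifted series is that of
ν x M_ν(x). Analytically this is an integration by parts along the contour; it supplies the decay at
infinity. -/
theorem mul_mWright_eq {ν : ℝ} (hν0 : 0 < ν) (hν1 : ν < 1) (x : ℝ) :
    ((ν * x * mWright ν x : ℝ) : ℂ) = hankelIntegral ν 1 x 1 := by
  have h := (hasSum_mWright hν0 hν1 x).mul_left (ν * x)
  refine (Complex.hasSum_ofReal.2 h).unique ?_
  have h2 := hasSum_hankelIntegral hν0 hν1 one_pos one_pos x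
  rw [← hasSum_nat_add_iff' 1] at h2
  simp only [Finset.range_one, Finset.sum_singleton, CharP.cast_eq_zero, mul_zero, zero_add,
    mul_one, Real.sin_pi, zero_div, Complex.ofReal_zero, sub_zero] at h2
  refine hasSum_of_eq (fun n => congrArg Complex.ofReal ?_) h2
  have hq : 0 < ν * n + ν := by positivity
  have hsin : Real.sin (Real.pi * (ν * ((n + 1 : ℕ) : ℝ) + 1)) =
      - Real.sin (Real.pi * (ν * n + ν)) := by
    rw [← Real.sin_add_pi]; congr 1; push_cast; ring
  have hG : Real.Gamma (ν * ((n + 1 : ℕ) : ℝ) + 1) = (ν * n + ν) * Real.Gamma (ν * n + ν) := by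
    rw [← Real.Gamma_add_one hq.ne']; congr 1; push_cast; ring
  rw [Real.one_rpow, mul_one, hsin, hG, Nat.factorial_succ, pow_succ,
    show -ν * n + (1 - ν) = 1 - (ν * n + ν) by ring, div_mul_eq_div_div, div_eq_mul_inv (_ / _),
    inv_Gamma_one_sub hq]
  have : (n.factorial : ℝ) ≠ 0 := by positivity
  push_cast
  field_simp

/-! ### Measurability, bounds and integrability of the M-Wright function on the half-line -/

theorem measurable_mWright {ν : ℝ} (hν0 : 0 < ν) (hν1 : ν < 1) : Measurable (mWright ν) := by
  refine measurable_of_tendsto_metrizable (f := fun (N : ℕ) (y : ℝ) => ∑ n ∈ Finset.range N,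
    (-y) ^ n / ((n.factorial : ℝ) * Real.Gamma (-ν * n + (1 - ν)))) (fun N => by fun_prop) ?_
  exact tendsto_pi_nhds.2 fun y => (hasSum_mWright hν0 hν1 y).tendsto_sum_nat

/-- The cosine is even, so the kernels on the two rays have the same modulus; the factor 2 cancels
against 2πi. -/
theorem norm_hankelIntegral_le (ν p x t : ℝ) :
    ‖hankelIntegral ν p x t‖ ≤ 1 / Real.pi * ∫ r in Ioi (0 : ℝ), r ^ (p - 1) *
      Real.exp (t * (r * Real.cos (rayAngle ν)) - x * (r ^ ν * Real.cos (rayAngle ν * ν))) := by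
  have key : ∀ θ : ℝ, Real.cos θ = Real.cos (rayAngle ν) →
      Real.cos (θ * ν) = Real.cos (rayAngle ν * ν) →
      ‖∫ r in Ioi (0 : ℝ), rayKernel ν θ p x t r‖ ≤ ∫ r in Ioi (0 : ℝ), r ^ (p - 1) *
      Real.exp (t * (r * Real.cos (rayAngle ν)) - x * (r ^ ν * Real.cos (rayAngle ν * ν))) := by
    intro θ h1 h2
    refine (norm_integral_le_integral_norm _).trans_eq ?_
    refine setIntegral_congr_fun measurableSet_Ioi fun r hr => ?_
    simp only [norm_rayKernel (mem_Ioi.1 hr), h1, h2]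
  have h1 := key _ rfl rfl
  have h2 := key (-rayAngle ν) (Real.cos_neg _) (by rw [neg_mul, Real.cos_neg])
  have hπ := Real.pi_pos
  have h3 : ‖(2 * Real.pi * Complex.I : ℂ)‖ = 2 * Real.pi := by
    simp [abs_of_pos hπ]
  rw [hankelIntegral, norm_div, h3, div_le_iff₀ (by positivity)]
  refine (norm_sub_le _ _).trans ((add_le_add h1 h2).trans_eq ?_)
  generalize (∫ r in Ioi (0 : ℝ), (_ : ℝ)) = J
  field_simp
  ring

/-- For x ≥ 0 the factor e^{-x z^ν} has modulus at most 1 on the rays, and the decay of e^z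
suffices. -/
theorem exists_abs_mWright_le {ν : ℝ} (hν0 : 0 < ν) (hν1 : ν < 1) :
    ∃ C : ℝ, ∀ x, 0 ≤ x → |mWright ν x| ≤ C := by
  refine ⟨1 / Real.pi * ∫ r in Ioi (0 : ℝ), r ^ (ν - 1) *
      Real.exp (-(-Real.cos (rayAngle ν)) * r), fun x hx => ?_⟩
  have h := mWright_scaled_eq hν0 hν1 one_pos x
  rw [Real.one_rpow, one_mul, mul_one] at h
  rw [← Real.norm_eq_abs, ← Complex.norm_real, h]
  refine (norm_hankelIntegral_le _ _ _ _).trans ?_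
  refine mul_le_mul_of_nonneg_left (integral_mono_of_nonneg ?_
    (integrableOn_rpow_mul_exp_neg hν0 (neg_pos.2 (cos_rayAngle_neg hν0 hν1))) ?_)
    (by have := Real.pi_pos; positivity)
  · filter_upwards [ae_restrict_mem measurableSet_Ioi] with r hr
    have hr : 0 < r := hr
    simp only [Pi.zero_apply]
    positivity
  · filter_upwards [ae_restrict_mem measurableSet_Ioi] with r hr
    have hr : 0 < r := hr
    refine mul_le_mul_of_nonneg_left (Real.exp_le_exp.2 ?_) (by positivity)
    have := cos_rayAngle_mul_pos hν0 hν1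
    have : 0 ≤ x * (r ^ ν * Real.cos (rayAngle ν * ν)) := by positivity
    linarith

/-- Here e^z is the factor bounded by 1, and ∫ e^{-xc r^ν} dr is a multiple of x^{-1/ν}; dividing by
ν x makes the exponent smaller than -1. -/
theorem exists_abs_mWright_le_rpow {ν : ℝ} (hν0 : 0 < ν) (hν1 : ν < 1) :
    ∃ C : ℝ, ∀ x, 0 < x → |mWright ν x| ≤ C * x ^ (-1 - 1 / ν) := by
  set c := Real.cos (rayAngle ν * ν) with hc
  have hc0 : 0 < c := cos_rayAngle_mul_pos hν0 hν1
  have hG : 0 < Real.Gamma (1 / ν + 1) := Real.Gamma_pos_of_pos (by positivity)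
  have hπ := Real.pi_pos
  refine ⟨1 / Real.pi * (c ^ (-1 / ν) * Real.Gamma (1 / ν + 1)) / ν, fun x hx => ?_⟩
  have h := mul_mWright_eq hν0 hν1 x
  have h1 : ν * x * |mWright ν x| = ‖hankelIntegral ν 1 x 1‖ := by
    rw [← h, Complex.norm_real, Real.norm_eq_abs, abs_mul, abs_of_pos (by positivity : 0 < ν * x)]
  have hint := integral_exp_neg_mul_rpow hν0 (b := x * c) (by positivity)
  have h2 : ‖hankelIntegral ν 1 x 1‖ ≤
      1 / Real.pi * ((x * c) ^ (-1 / ν) * Real.Gamma (1 / ν + 1)) := by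
    refine (norm_hankelIntegral_le _ _ _ _).trans ?_
    rw [← hint]
    refine mul_le_mul_of_nonneg_left (integral_mono_of_nonneg ?_ ?_ ?_) (by positivity)
    · filter_upwards [ae_restrict_mem measurableSet_Ioi] with r hr
      have hr : 0 < r := hr
      simp only [Pi.zero_apply]
      positivity
    -- A non-integrable function has integral 0 by convention, so the nonzero value `hint` proves
    -- integrability.
    · refine not_imp_comm.1 integral_undef ?_
      rw [hint]
      positivity
    · filter_upwards [ae_restrict_mem measurableSet_Ioi] with r hr
      have hr : 0 < r := hr
      rw [sub_self, Real.rpow_zero, one_mul, ← hc]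
      refine Real.exp_le_exp.2 ?_
      have := mul_neg_of_pos_of_neg hr (cos_rayAngle_neg hν0 hν1)
      nlinarith
  rw [← h1, Real.mul_rpow hx.le hc0.le] at h2
  rw [show -1 - 1 / ν = -1 / ν - 1 by ring, Real.rpow_sub_one hx.ne']
  have : |mWright ν x| = ν * x * |mWright ν x| / (ν * x) := by field_simp
  rw [this, div_le_iff₀ (by positivity)]
  refine h2.trans_eq ?_
  field_simp

theorem integrableOn_mWright {ν : ℝ} (hν0 : 0 < ν) (hν1 : ν < 1) :
    IntegrableOn (mWright ν) (Ioi 0) := by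
  obtain ⟨C, hC⟩ := exists_abs_mWright_le hν0 hν1
  obtain ⟨D, hD⟩ := exists_abs_mWright_le_rpow hν0 hν1
  rw [← Ioc_union_Ioi_eq_Ioi (zero_le_one (α := ℝ))]
  refine IntegrableOn.union ?_ ?_
  · refine Measure.integrableOn_of_bounded (M := C) (by simp)
      (measurable_mWright hν0 hν1).aestronglyMeasurable ?_
    filter_upwards [ae_restrict_mem measurableSet_Ioc] with x hx using hC x hx.1.le
  · refine Integrable.mono' ((integrableOn_Ioi_rpow_of_lt (a := -1 - 1 / ν) ?_ one_pos).const_mul D)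
      (measurable_mWright hν0 hν1).aestronglyMeasurable ?_
    · have : 0 < 1 / ν := by positivity
      linarith
    · filter_upwards [ae_restrict_mem measurableSet_Ioi] with x hx
        using hD x (one_pos.trans hx)

/-! ### Laplace transform of the `M`-Wright function -/

/-- Cauchy's theorem for an infinite horizontal strip. -/
theorem integral_strip_boundary_eq {H : ℂ → ℂ} {φ : ℝ}
    (hd : ∀ w : ℂ, |w.im| ≤ |φ| → DifferentiableAt ℂ H w)
    (h1 : Integrable fun u : ℝ => H (u + φ * Complex.I))
    (h2 : Integrable fun u : ℝ => H (u + (-φ : ℝ) * Complex.I))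
    {b : ℝ → ℝ} (hb : Tendsto b atTop (𝓝 0))
    (hHb : ∀ᶠ U : ℝ in atTop, ∀ y : ℝ, |y| ≤ |φ| →
      ‖H (U + y * Complex.I)‖ ≤ b U ∧ ‖H ((-U : ℝ) + y * Complex.I)‖ ≤ b U) :
    ∫ u : ℝ, H (u + φ * Complex.I) = ∫ u : ℝ, H (u + (-φ : ℝ) * Complex.I) := by
  have hrect : ∀ U : ℝ,
      (∫ u in (-U)..U, H (u + φ * Complex.I)) - (∫ u in (-U)..U, H (u + (-φ : ℝ) * Complex.I)) =
      Complex.I * (∫ y in (-φ)..φ, H (U + y * Complex.I)) -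
        Complex.I * ∫ y in (-φ)..φ, H ((-U : ℝ) + y * Complex.I) := by
    intro U
    have h := Complex.integral_boundary_rect_eq_zero_of_differentiableOn H
      (⟨-U, -φ⟩ : ℂ) (⟨U, φ⟩ : ℂ) (fun w hw => (hd w ?_).differentiableWithinAt)
    · simp only [smul_eq_mul] at h
      linear_combination -h
    · have hw2 : w.im ∈ uIcc (-φ) φ := hw.2
      rw [mem_uIcc] at hw2
      rcases hw2 with h | h <;> · rw [abs_le]; constructor <;> grind
  have hside : ∀ (g : ℝ → ℝ), (∀ᶠ U in atTop, ∀ y : ℝ, |y| ≤ |φ| →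
      ‖H (g U + y * Complex.I)‖ ≤ b U) →
      Tendsto (fun U : ℝ => Complex.I * ∫ y in (-φ)..φ, H (g U + y * Complex.I)) atTop (𝓝 0) := by
    intro g hg
    refine squeeze_zero_norm' (a := fun U => b U * |φ - -φ|) ?_ (by simpa using hb.mul_const _)
    filter_upwards [hg] with U hU
    rw [norm_mul, Complex.norm_I, one_mul]
    refine intervalIntegral.norm_integral_le_of_norm_le_const fun y hy => hU y ?_
    rw [mem_uIoc] at hy
    rcases hy with h | h <;> · rw [abs_le]; constructor <;> grind
  have hlim := (intervalIntegral_tendsto_integral h1 tendsto_neg_atTop_atBot tendsto_id).sub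
    (intervalIntegral_tendsto_integral h2 tendsto_neg_atTop_atBot tendsto_id)
  have hlim2 := (hside (fun U => U) (hHb.mono fun U h y hy => (h y hy).1)).sub
    (hside (fun U => -U) (hHb.mono fun U h y hy => (h y hy).2))
  rw [sub_zero] at hlim2
  exact sub_eq_zero.1 (tendsto_nhds_unique (hlim.congr hrect) hlim2)

/-- The substitution r = e^u turns a ray of argument θ in the z-plane into the line Im w = θ, where
z = e^w. -/
theorem integral_comp_exp_mul (f : ℝ → ℂ) :
    ∫ u : ℝ, (Real.exp u : ℂ) * f (Real.exp u) = ∫ r in Ioi (0 : ℝ), f r := by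
  have h := integral_image_eq_integral_abs_deriv_smul (s := univ) (f := Real.exp) (f' := Real.exp)
    MeasurableSet.univ (fun x _ => (Real.hasDerivAt_exp x).hasDerivWithinAt)
    Real.exp_injective.injOn f
  rw [image_univ, Real.range_exp] at h
  rw [h, setIntegral_univ]
  simp [abs_of_pos (Real.exp_pos _)]

theorem integrable_comp_exp_mul_iff (f : ℝ → ℂ) :
    Integrable (fun u : ℝ => (Real.exp u : ℂ) * f (Real.exp u)) ↔ IntegrableOn f (Ioi 0) := by
  have h := integrableOn_image_iff_integrableOn_abs_deriv_smul (s := univ) (f := Real.exp)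
    (f' := Real.exp) MeasurableSet.univ (fun x _ => (Real.hasDerivAt_exp x).hasDerivWithinAt)
    Real.exp_injective.injOn f
  rw [image_univ, Real.range_exp] at h
  rw [h, integrableOn_univ]
  simp [abs_of_pos (Real.exp_pos _)]

/-- Laplace transform in `t` of `rayKernel ν θ ν x t r`. -/
noncomputable def rayLaplace (ν θ : ℝ) (s : ℂ) (x r : ℝ) : ℂ :=
  ((r ^ (ν - 1) : ℝ) : ℂ) * Complex.exp (Complex.I * (θ * ν) -
    x * (((r ^ ν : ℝ) : ℂ) * Complex.exp (Complex.I * (θ * ν)))) /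
      (s - r * Complex.exp (Complex.I * θ))

theorem le_norm_sub_ray {s : ℂ} {r θ : ℝ} :
    s.re + r * (-Real.cos θ) ≤ ‖s - r * Complex.exp (Complex.I * θ)‖ := by
  refine le_trans (le_of_eq ?_) (Complex.re_le_norm _)
  rw [Complex.sub_re, re_ofReal_mul_cexp]
  ring

/-- The function is O(r^{ν-1}) at the origin and O(r^{ν-2}) at infinity, so 0 < ν < 1 is what is
needed. -/
theorem integrableOn_rpow_div {ν σ c : ℝ} (hν0 : 0 < ν) (hν1 : ν < 1) (hσ : 0 < σ) (hc : 0 < c) :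
    IntegrableOn (fun r : ℝ => r ^ (ν - 1) / (σ + r * c)) (Ioi 0) := by
  have hm : Measurable (fun r : ℝ => r ^ (ν - 1) / (σ + r * c)) := by fun_prop
  rw [← Ioc_union_Ioi_eq_Ioi (zero_le_one (α := ℝ))]
  refine IntegrableOn.union ?_ ?_
  · have h := (intervalIntegral.intervalIntegrable_rpow' (a := 0) (b := 1) (r := ν - 1)
      (by linarith))
    rw [intervalIntegrable_iff_integrableOn_Ioc_of_le zero_le_one] at h
    refine Integrable.mono' (h.div_const σ) hm.aestronglyMeasurable ?_
    filter_upwards [ae_restrict_mem measurableSet_Ioc] with r hr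
    have hr : 0 < r := hr.1
    rw [Real.norm_of_nonneg (by positivity)]
    gcongr
    nlinarith
  · refine Integrable.mono' ((integrableOn_Ioi_rpow_of_lt (a := ν - 2) (by linarith)
      one_pos).div_const c) hm.aestronglyMeasurable ?_
    filter_upwards [ae_restrict_mem measurableSet_Ioi] with r hr
    have hr1 : 1 < r := hr
    have hr : 0 < r := one_pos.trans hr1
    have e : r ^ (ν - 2) = r ^ (ν - 1) / r := by
      rw [← Real.rpow_sub_one hr.ne']; ring_nf
    rw [Real.norm_of_nonneg (by positivity), e, div_div]
    gcongr
    linarith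

theorem norm_rayLaplace_le {ν θ x r : ℝ} {s : ℂ} (hs : 0 < s.re) (hθ : Real.cos θ < 0)
    (hθν : 0 ≤ Real.cos (θ * ν)) (hx : 0 ≤ x) (hr : 0 < r) :
    ‖rayLaplace ν θ s x r‖ ≤ r ^ (ν - 1) / (s.re + r * (-Real.cos θ)) := by
  rw [rayLaplace, norm_div, norm_rpow_mul_cexp hr]
  have h1 : 0 < s.re + r * (-Real.cos θ) := by nlinarith
  refine div_le_div₀ (by positivity) ?_ h1 le_norm_sub_ray
  rw [Complex.sub_re, Complex.re_ofReal_mul, ← Complex.ofReal_mul, re_ofReal_mul_cexp]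
  refine mul_le_of_le_one_right (by positivity) (Real.exp_le_one_iff.2 ?_)
  have : 0 ≤ x * (r ^ ν * Real.cos (θ * ν)) := by positivity
  simp
  linarith

theorem integrableOn_rayLaplace {ν θ x : ℝ} {s : ℂ} (hν0 : 0 < ν) (hν1 : ν < 1) (hs : 0 < s.re)
    (hθ : Real.cos θ < 0) (hθν : 0 ≤ Real.cos (θ * ν)) (hx : 0 ≤ x) :
    IntegrableOn (rayLaplace ν θ s x) (Ioi 0) := by
  refine Integrable.mono' (integrableOn_rpow_div hν0 hν1 hs (neg_pos.2 hθ)) ?_ ?_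
  · apply Measurable.aestronglyMeasurable
    unfold rayLaplace
    fun_prop
  · filter_upwards [ae_restrict_mem measurableSet_Ioi] with r hr
      using norm_rayLaplace_le hs hθ hθν hx hr

/-- Fubini: for z on the ray, Re(s - z) > 0 and ∫ e^{-(s-z)t} dt = 1/(s - z). The t-integral of the
modulus is dominated by the function of `integrableOn_rpow_div`. -/
theorem laplace_integral_rayKernel {ν θ x : ℝ} {s : ℂ} (hν0 : 0 < ν) (hν1 : ν < 1) (hs : 0 < s.re)
    (hθ : Real.cos θ < 0) (hθν : 0 ≤ Real.cos (θ * ν)) (hx : 0 ≤ x) :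
    IntegrableOn (fun t : ℝ => Complex.exp (-s * t) *
      ∫ r in Ioi (0 : ℝ), rayKernel ν θ ν x t r) (Ioi 0) ∧
    ∫ t in Ioi (0 : ℝ), Complex.exp (-s * t) * ∫ r in Ioi (0 : ℝ), rayKernel ν θ ν x t r =
      ∫ r in Ioi (0 : ℝ), rayLaplace ν θ s x r := by
  let μ := volume.restrict (Ioi (0 : ℝ))
  let f : ℝ → ℝ → ℂ := fun t r => Complex.exp (-s * t) * rayKernel ν θ ν x t r
  have hre : ∀ r : ℝ, 0 < r → 0 < (s - r * Complex.exp (Complex.I * θ)).re := by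
    intro r hr
    rw [Complex.sub_re, re_ofReal_mul_cexp]
    nlinarith
  have hf : ∀ t r : ℝ, f t r = ((r ^ (ν - 1) : ℝ) : ℂ) * Complex.exp (Complex.I * (θ * ν) -
    x * (((r ^ ν : ℝ) : ℂ) * Complex.exp (Complex.I * (θ * ν)))) *
      Complex.exp (-(s - r * Complex.exp (Complex.I * θ)) * t) := by
    intro t r
    simp only [f, rayKernel]
    rw [mul_left_comm, mul_assoc, ← Complex.exp_add, ← Complex.exp_add]
    ring_nf
  have hsec : ∀ r : ℝ, 0 < r → Integrable (fun t => f t r) μ ∧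
      ∫ t, f t r ∂μ = rayLaplace ν θ s x r := by
    intro r hr
    have h := integral_rpow_mul_cexp_neg_mul one_pos (hre r hr)
    simp only [sub_self, Real.rpow_zero, Complex.ofReal_one, one_mul, Complex.Gamma_one,
      Complex.cpow_neg_one] at h
    simp only [hf]
    refine ⟨h.1.const_mul _, ?_⟩
    rw [integral_const_mul, h.2, rayLaplace, div_eq_mul_inv]
  have hsecn : ∀ r : ℝ, 0 < r → ∫ t, ‖f t r‖ ∂μ ≤ r ^ (ν - 1) / (s.re + r * (-Real.cos θ)) := by
    intro r hr
    have h := integral_rpow_mul_cexp_neg_mul one_pos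
      (s := ((s - r * Complex.exp (Complex.I * θ)).re : ℂ)) (by simpa using hre r hr)
    have h2 := norm_rayLaplace_le (ν := ν) (x := x) (s := (s.re : ℂ)) (by simpa) hθ hθν hx hr
    have hreal : ∫ t, Real.exp (-(s - r * Complex.exp (Complex.I * θ)).re * t) ∂μ =
        ((s - r * Complex.exp (Complex.I * θ)).re)⁻¹ := by
      have := Real.integral_rpow_mul_exp_neg_mul_Ioi one_pos (hre r hr)
      simp only [sub_self, Real.rpow_zero, one_mul, Real.Gamma_one, mul_one, Real.rpow_one,
        one_div] at this
      simpa only [neg_mul] using this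
    have hn : ∀ t : ℝ, ‖f t r‖ = r ^ (ν - 1) * Real.exp (-(x * (r ^ ν * Real.cos (θ * ν)))) *
        Real.exp (-(s - r * Complex.exp (Complex.I * θ)).re * t) := by
      intro t
      rw [hf, norm_mul, norm_rpow_mul_cexp hr, Complex.norm_exp]
      congr 2
      · rw [Complex.sub_re, Complex.re_ofReal_mul x, ← Complex.ofReal_mul, re_ofReal_mul_cexp]
        simp
      · simp
    simp only [hn]
    rw [integral_const_mul, hreal, ← div_eq_mul_inv, Complex.sub_re, re_ofReal_mul_cexp]
    have h1 : 0 < s.re + r * (-Real.cos θ) := by nlinarith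
    rw [show s.re - r * Real.cos θ = s.re + r * (-Real.cos θ) by ring]
    gcongr
    refine mul_le_of_le_one_right (by positivity) (Real.exp_le_one_iff.2 ?_)
    have : 0 ≤ x * (r ^ ν * Real.cos (θ * ν)) := by positivity
    linarith
  have hint : Integrable (Function.uncurry f) (μ.prod μ) := by
    have hm : Measurable (Function.uncurry f) := by
      simp only [Function.uncurry_def, f, rayKernel]
      fun_prop
    rw [integrable_prod_iff' hm.aestronglyMeasurable]
    constructor
    · filter_upwards [ae_restrict_mem measurableSet_Ioi] with r hr using (hsec r hr).1
    · refine Integrable.mono' (integrableOn_rpow_div hν0 hν1 hs (neg_pos.2 hθ)) ?_ ?_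
      · exact hm.norm.stronglyMeasurable.integral_prod_left'.aestronglyMeasurable
      · filter_upwards [ae_restrict_mem measurableSet_Ioi] with r hr
        rw [Real.norm_of_nonneg (integral_nonneg fun _ => norm_nonneg _)]
        exact hsecn r hr
  have heq : ∀ t : ℝ, Complex.exp (-s * t) * ∫ r in Ioi (0 : ℝ), rayKernel ν θ ν x t r =
      ∫ r, f t r ∂μ := fun t => (integral_const_mul _ _).symm
  simp only [heq]
  refine ⟨hint.integral_prod_left, ?_⟩
  rw [integral_integral_swap hint]
  exact setIntegral_congr_fun measurableSet_Ioi fun r hr => (hsec r hr).2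

theorem abs_arg_lt_of_re_pos {s : ℂ} (hs : 0 < s.re) : |s.arg| < Real.pi / 2 :=
  Complex.abs_arg_lt_pi_div_two_iff.2 (Or.inl hs)

theorem cpow_eq_exp_log {s : ℂ} (hs : 0 < s.re) (a : ℂ) :
    s ^ a = Complex.exp (a * Complex.log s) := by
  rw [Complex.cpow_def_of_ne_zero (by rintro rfl; simp at hs), mul_comm]

theorem re_cpow_pos {ν : ℝ} (hν0 : 0 < ν) (hν1 : ν ≤ 1) {s : ℂ} (hs : 0 < s.re) :
    0 < (s ^ (ν : ℂ)).re := by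
  rw [cpow_eq_exp_log hs, Complex.exp_re]
  refine mul_pos (Real.exp_pos _) (Real.cos_pos_of_mem_Ioo ?_)
  have h := abs_lt.1 (abs_arg_lt_of_re_pos hs)
  rw [Complex.im_ofReal_mul, Complex.log_im]
  constructor <;> nlinarith

theorem norm_cexp_neg_mul_le_one {x : ℝ} {z : ℂ} (hx : 0 ≤ x) (hz : 0 ≤ z.re) :
    ‖Complex.exp (-(x * z))‖ ≤ 1 := by
  rw [Complex.norm_exp, Real.exp_le_one_iff, Complex.neg_re, Complex.re_ofReal_mul]
  exact neg_nonpos.2 (mul_nonneg hx hz)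

theorem rayAngle_mem {ν : ℝ} (hν0 : 0 < ν) (hν1 : ν < 1) :
    rayAngle ν ∈ Ioo (Real.pi / 2) Real.pi := by
  have := Real.pi_pos
  rw [rayAngle]
  constructor <;> nlinarith

theorem cos_mul_nonneg_of_abs_le_rayAngle {ν y : ℝ} (hν0 : 0 < ν) (hν1 : ν < 1)
    (hy : |y| ≤ |rayAngle ν|) : 0 ≤ Real.cos (ν * y) := by
  have h := rayAngle_mul_mem hν0 hν1
  have h1 := rayAngle_mem hν0 hν1
  rw [abs_of_pos (a := rayAngle ν) (by linarith [h1.1, Real.pi_pos])] at hy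
  rw [← Real.cos_abs, abs_mul, abs_of_pos hν0]
  have : ν * |y| ≤ rayAngle ν * ν := by nlinarith
  exact Real.cos_nonneg_of_neg_pi_div_two_le_of_le
    (by have := mul_nonneg hν0.le (abs_nonneg y); linarith [Real.pi_pos]) (this.trans h.2.le)

/-- The function z^{ν-1}(e^{-x z^ν} - e^{-x s^ν})/(s - z) has a removable singularity at z = s, so
its integrals along the two rays agree by Cauchy's theorem in the sector between them. No residue is
computed: the pole term is e^{-x s^ν} times the same integral at x = 0. In the coordinate w = log z
the sector is a strip. -/
theorem integral_rayLaplace_sub_eq {ν x : ℝ} {s : ℂ} (hν0 : 0 < ν) (hν1 : ν < 1) (hs : 0 < s.re)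
    (hx : 0 ≤ x) :
    (∫ r in Ioi (0 : ℝ), rayLaplace ν (rayAngle ν) s x r) - Complex.exp (-(x * s ^ (ν : ℂ))) *
      (∫ r in Ioi (0 : ℝ), rayLaplace ν (rayAngle ν) s 0 r) =
    (∫ r in Ioi (0 : ℝ), rayLaplace ν (-rayAngle ν) s x r) - Complex.exp (-(x * s ^ (ν : ℂ))) *
      ∫ r in Ioi (0 : ℝ), rayLaplace ν (-rayAngle ν) s 0 r := by
  set φ := rayAngle ν with hφ
  have hφm := rayAngle_mem hν0 hν1
  rw [← hφ] at hφm
  have hπ := Real.pi_pos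
  have hφ0 : 0 < φ := by linarith [hφm.1]
  have harg := abs_lt.1 (abs_arg_lt_of_re_pos hs)
  have hs0 : s ≠ 0 := by rintro rfl; simp at hs
  have hsn : 0 < ‖s‖ := norm_pos_iff.2 hs0
  set w₀ := Complex.log s with hw₀
  have hw₀e : Complex.exp w₀ = s := Complex.exp_log hs0
  set E := Complex.exp (-(x * s ^ (ν : ℂ))) with hE
  have hEn : ‖E‖ ≤ 1 := norm_cexp_neg_mul_le_one hx (re_cpow_pos hν0 hν1.le hs).le
  let G : ℂ → ℂ := fun w => Complex.exp (ν * w) * (Complex.exp (-(x * Complex.exp (ν * w))) - E)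
  let D : ℂ → ℂ := fun w => s - Complex.exp w
  -- Numerator and denominator both vanish at log s. The quotient of their divided differences
  -- equals G / D elsewhere and is the holomorphic extension across that point.
  let H : ℂ → ℂ := fun w => dslope G w₀ w / dslope D w₀ w
  have hG0 : G w₀ = 0 := by
    simp only [G]
    rw [hE, cpow_eq_exp_log hs, sub_self, mul_zero]
  have hD0 : D w₀ = 0 := by simp only [D]; rw [hw₀e, sub_self]
  have hGd : Differentiable ℂ G := by fun_prop
  have hDd : Differentiable ℂ D := by fun_prop
  have hH : ∀ w, w ≠ w₀ → H w = G w / D w := by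
    intro w hw
    have : w - w₀ ≠ 0 := sub_ne_zero.2 hw
    simp only [H]
    rw [dslope_of_ne _ hw, dslope_of_ne _ hw, slope_def_field, slope_def_field, hG0, hD0, sub_zero,
      sub_zero, div_div_div_cancel_right₀ this]
  have hds : ∀ F : ℂ → ℂ, Differentiable ℂ F → Differentiable ℂ (dslope F w₀) := fun F hF =>
    differentiableOn_univ.1 ((Complex.differentiableOn_dslope univ_mem).2 hF.differentiableOn)
  have hDne : ∀ w : ℂ, |w.im| ≤ |φ| → dslope D w₀ w ≠ 0 := by
    intro w hw
    rw [abs_of_pos hφ0] at hw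
    by_cases h : w = w₀
    · rw [h, dslope_same]
      have : HasDerivAt D (-Complex.exp w₀) w₀ := by
        simpa using (Complex.hasDerivAt_exp w₀).const_sub s
      rw [this.deriv, hw₀e]
      exact neg_ne_zero.2 hs0
    · rw [dslope_of_ne _ h, slope_def_field, hD0, sub_zero]
      refine div_ne_zero (fun h0 => ?_) (sub_ne_zero.2 h)
      have h1 : Complex.exp w = Complex.exp w₀ := by rw [hw₀e]; exact (sub_eq_zero.1 h0).symm
      obtain ⟨n, hn⟩ := Complex.exp_eq_exp_iff_exists_int.1 h1
      -- In the strip |Im w| ≤ φ < π, while |arg s| < π/2, so the two imaginary parts differ by less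
      -- than 2π and n = 0.
      have him : w.im = w₀.im + n * (2 * Real.pi) := by
        rw [hn]; simp
      rw [hw₀, Complex.log_im] at him
      have hw' := abs_le.1 hw
      have hn0 : n = 0 := by
        have h2 : ((n : ℤ) : ℝ) < 1 := by
          by_contra hc
          push Not at hc
          nlinarith [hφm.2]
        have h3 : (-1 : ℝ) < ((n : ℤ) : ℝ) := by
          by_contra hc
          push Not at hc
          nlinarith [hφm.2]
        have h2' : n < 1 := by exact_mod_cast h2
        have h3' : -1 < n := by exact_mod_cast h3
        omega
      rw [hn0] at hn
      exact h (by simpa using hn)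
  have hre : ∀ u y : ℝ, (Complex.exp (ν * (u + y * Complex.I))) =
      ((Real.exp (ν * u) : ℝ) : ℂ) * Complex.exp (Complex.I * ((y * ν : ℝ) : ℂ)) := by
    intro u y
    rw [Complex.ofReal_exp, ← Complex.exp_add]
    push_cast
    ring_nf
  have hGb : ∀ u y : ℝ, |y| ≤ |φ| → ‖G (u + y * Complex.I)‖ ≤ 2 * Real.exp (ν * u) := by
    intro u y hy
    simp only [G]
    rw [norm_mul, mul_comm]
    refine mul_le_mul ((norm_sub_le _ _).trans ?_) ?_ (norm_nonneg _) zero_le_two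
    · have : ‖Complex.exp (-(x * Complex.exp (ν * (u + y * Complex.I))))‖ ≤ 1 := by
        refine norm_cexp_neg_mul_le_one hx ?_
        rw [hre, re_ofReal_mul_cexp, mul_comm y]
        exact mul_nonneg (Real.exp_pos _).le (cos_mul_nonneg_of_abs_le_rayAngle hν0 hν1 hy)
      linarith
    · rw [Complex.norm_exp]
      simp
  have hline : ∀ θ : ℝ, |θ| = φ → ∀ u : ℝ, H (u + θ * Complex.I) = (Real.exp u : ℂ) *
      (rayLaplace ν θ s x (Real.exp u) - E * rayLaplace ν θ s 0 (Real.exp u)) := by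
    intro θ hθ u
    have hne : (u + θ * Complex.I : ℂ) ≠ w₀ := by
      intro h
      have := congrArg Complex.im h
      simp [hw₀, Complex.log_im] at this
      rw [this] at hθ
      linarith [abs_arg_lt_of_re_pos hs, hφm.1]
    rw [hH _ hne]
    simp only [G, D, rayLaplace]
    have e1 : (Real.exp u) ^ ν = Real.exp (ν * u) := by rw [← Real.exp_mul, mul_comm]
    have e2 : (Real.exp u) ^ (ν - 1) = Real.exp (ν * u) / Real.exp u := by
      rw [Real.rpow_sub_one (Real.exp_ne_zero _), e1]
    have e3 : Complex.exp (u + θ * Complex.I) =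
        (Real.exp u : ℂ) * Complex.exp (Complex.I * θ) := by
      rw [Complex.ofReal_exp, ← Complex.exp_add, mul_comm Complex.I]
    have hu0 : (Real.exp u : ℂ) ≠ 0 := by exact_mod_cast Real.exp_ne_zero u
    rw [hre, e1, e2, e3, sub_eq_add_neg (Complex.I * (θ * ν)), Complex.exp_add, Complex.ofReal_zero,
      zero_mul, sub_zero]
    push_cast
    push_cast at hu0
    field_simp
  have hcos1 : Real.cos φ < 0 := cos_rayAngle_neg hν0 hν1
  have hcos2 : 0 < Real.cos (φ * ν) := cos_rayAngle_mul_pos hν0 hν1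
  have hintθ : ∀ θ : ℝ, |θ| = φ → IntegrableOn (rayLaplace ν θ s x) (Ioi 0) ∧
      IntegrableOn (rayLaplace ν θ s 0) (Ioi 0) := by
    intro θ hθ
    have h1 : Real.cos θ < 0 := by rw [← Real.cos_abs, hθ]; exact hcos1
    have h2 : 0 ≤ Real.cos (θ * ν) := by
      rw [← Real.cos_abs, abs_mul, hθ, abs_of_pos hν0]; exact hcos2.le
    exact ⟨integrableOn_rayLaplace hν0 hν1 hs h1 h2 hx,
      integrableOn_rayLaplace hν0 hν1 hs h1 h2 le_rfl⟩
  have hint : ∀ θ : ℝ, |θ| = φ → Integrable fun u : ℝ => H (u + θ * Complex.I) := by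
    intro θ hθ
    simp only [hline θ hθ]
    exact (integrable_comp_exp_mul_iff fun r => rayLaplace ν θ s x r - E * rayLaplace ν θ s 0 r).2
      ((hintθ θ hθ).1.sub ((hintθ θ hθ).2.const_mul E))
  have hval : ∀ θ : ℝ, |θ| = φ → ∫ u : ℝ, H (u + θ * Complex.I) =
      (∫ r in Ioi (0 : ℝ), rayLaplace ν θ s x r) -
        E * ∫ r in Ioi (0 : ℝ), rayLaplace ν θ s 0 r := by
    intro θ hθ
    simp only [hline θ hθ]
    rw [integral_comp_exp_mul fun r => rayLaplace ν θ s x r - E * rayLaplace ν θ s 0 r,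
      integral_sub (hintθ θ hθ).1 ((hintθ θ hθ).2.const_mul E), integral_const_mul]
  have ha : |φ| = φ := abs_of_pos hφ0
  have hb : |-φ| = φ := by rw [abs_neg, ha]
  rw [← hval φ ha, ← hval (-φ) hb]
  refine integral_strip_boundary_eq
    -- On the strip |G| ≤ 2 e^{ν Re w}. On the right side |D| ≥ e^U / 2, on the left side |D| ≥ |s|
    -- / 2 for large U; the two summands are the resulting quotients.
    (b := fun U => 4 * Real.exp (-((1 - ν) * U)) + 4 / ‖s‖ * Real.exp (-(ν * U)))
    (fun w hw => ((hds G hGd) w).div ((hds D hDd) w) (hDne w hw)) (hint φ ha) (hint (-φ) hb) ?_ ?_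
  · have h1 : ∀ c : ℝ, 0 < c → Tendsto (fun U : ℝ => Real.exp (-(c * U))) atTop (𝓝 0) :=
      fun c hc => Real.tendsto_exp_neg_atTop_nhds_zero.comp (tendsto_id.const_mul_atTop hc)
    simpa using ((h1 (1 - ν) (by linarith)).const_mul 4).add ((h1 ν hν0).const_mul (4 / ‖s‖))
  · have hexp : Tendsto Real.exp atTop atTop := Real.tendsto_exp_atTop
    filter_upwards [hexp.eventually_ge_atTop (2 * ‖s‖), hexp.eventually_ge_atTop (2 / ‖s‖),
      eventually_gt_atTop |w₀.re|] with U hU1 hU2 hU3 y hy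
    have hne : ∀ u : ℝ, |u| = |U| → (u + y * Complex.I : ℂ) ≠ w₀ := by
      intro u hu h
      have h2 := congrArg Complex.re h
      simp at h2
      rw [← h2, hu] at hU3
      exact absurd hU3 (not_lt.2 (le_abs_self U))
    have hnexp : ∀ u : ℝ, ‖Complex.exp (u + y * Complex.I)‖ = Real.exp u := by
      intro u; rw [Complex.norm_exp]; simp
    have hp1 : 0 ≤ 4 * Real.exp (-((1 - ν) * U)) := by positivity
    have hp2 : 0 ≤ 4 / ‖s‖ * Real.exp (-(ν * U)) := by positivity
    constructor
    · rw [hH _ (hne U rfl), norm_div]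
      have hD : Real.exp U / 2 ≤ ‖D (U + y * Complex.I)‖ := by
        have := norm_sub_norm_le (Complex.exp (U + y * Complex.I)) s
        rw [hnexp, norm_sub_rev] at this
        exact le_trans (by linarith) this
      have h3 := div_le_div₀ (by positivity) (hGb U y hy) (by positivity) hD
      refine h3.trans (le_trans (le_of_eq ?_) (le_add_of_nonneg_right hp2))
      rw [show -((1 - ν) * U) = ν * U - U by ring, Real.exp_sub]
      field_simp
      norm_num
    · rw [hH _ (hne (-U) (abs_neg U)), norm_div]
      have hD : ‖s‖ / 2 ≤ ‖D ((-U : ℝ) + y * Complex.I)‖ := by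
        have := norm_sub_norm_le s (Complex.exp ((-U : ℝ) + y * Complex.I))
        rw [hnexp] at this
        have h4 : Real.exp (-U) ≤ ‖s‖ / 2 := by
          rw [Real.exp_neg, inv_le_comm₀ (Real.exp_pos _) (by positivity), inv_div]
          exact hU2
        exact le_trans (by linarith) this
      have h3 := div_le_div₀ (by positivity) (hGb (-U) y hy) (by positivity) hD
      refine h3.trans (le_trans (le_of_eq ?_) (le_add_of_nonneg_left hp1))
      rw [mul_neg]
      field_simp
      norm_num

theorem mWright_zero (ν : ℝ) : mWright ν 0 = (Real.Gamma (1 - ν))⁻¹ := by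
  rw [mWright, wrightFunction, tsum_eq_single 0]
  · simp
  · intro n hn
    simp [hn]

/-- The Laplace transform is the difference of two integrals of `rayLaplace`; by
`integral_rayLaplace_sub_eq` it is e^{-x s^ν} times its value at x = 0. -/
theorem laplace_mWright {ν x : ℝ} (hν0 : 0 < ν) (hν1 : ν < 1) (hx : 0 ≤ x) {s : ℂ}
    (hs : 0 < s.re) :
    IntegrableOn (fun t : ℝ => Complex.exp (-s * t) *
      ((t ^ (-ν) * mWright ν (x * t ^ (-ν)) : ℝ) : ℂ)) (Ioi 0) ∧
    ∫ t in Ioi (0 : ℝ), Complex.exp (-s * t) *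
      ((t ^ (-ν) * mWright ν (x * t ^ (-ν)) : ℝ) : ℂ) =
      s ^ ((ν : ℂ) - 1) * Complex.exp (-(x * s ^ (ν : ℂ))) := by
  set φ := rayAngle ν
  have hcos1 : Real.cos φ < 0 := cos_rayAngle_neg hν0 hν1
  have hcos2 : 0 < Real.cos (φ * ν) := cos_rayAngle_mul_pos hν0 hν1
  have hcos1' : Real.cos (-φ) < 0 := by rwa [Real.cos_neg]
  have hcos2' : 0 < Real.cos (-φ * ν) := by rwa [neg_mul, Real.cos_neg]
  have key : ∀ y : ℝ, 0 ≤ y → IntegrableOn (fun t : ℝ => Complex.exp (-s * t) *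
      ((t ^ (-ν) * mWright ν (y * t ^ (-ν)) : ℝ) : ℂ)) (Ioi 0) ∧
      ∫ t in Ioi (0 : ℝ), Complex.exp (-s * t) *
      ((t ^ (-ν) * mWright ν (y * t ^ (-ν)) : ℝ) : ℂ) =
      ((∫ r in Ioi (0 : ℝ), rayLaplace ν φ s y r) - ∫ r in Ioi (0 : ℝ), rayLaplace ν (-φ) s y r) /
        (2 * Real.pi * Complex.I) := by
    intro y hy
    have h1 := laplace_integral_rayKernel hν0 hν1 hs hcos1 hcos2.le hy
    have h2 := laplace_integral_rayKernel hν0 hν1 hs hcos1' hcos2'.le hy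
    have h3 : EqOn (fun t : ℝ => Complex.exp (-s * t) *
        ((t ^ (-ν) * mWright ν (y * t ^ (-ν)) : ℝ) : ℂ)) (fun t : ℝ =>
        (Complex.exp (-s * t) * (∫ r in Ioi (0 : ℝ), rayKernel ν φ ν y t r) -
        Complex.exp (-s * t) * ∫ r in Ioi (0 : ℝ), rayKernel ν (-φ) ν y t r) /
        (2 * Real.pi * Complex.I)) (Ioi 0) := by
      intro t ht
      simp only
      rw [mWright_scaled_eq hν0 hν1 ht, hankelIntegral]
      ring
    rw [integrableOn_congr_fun h3 measurableSet_Ioi, setIntegral_congr_fun measurableSet_Ioi h3,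
      integral_div, integral_sub h1.1 h2.1, h1.2, h2.2]
    exact ⟨(h1.1.sub h2.1).div_const _, rfl⟩
  refine ⟨(key x hx).1, ?_⟩
  -- At x = 0 the function is t^{-ν} / Γ(1 - ν), whose transform is a plain Gamma integral.
  have h0 : ∫ t in Ioi (0 : ℝ), Complex.exp (-s * t) *
      ((t ^ (-ν) * mWright ν (0 * t ^ (-ν)) : ℝ) : ℂ) = s ^ ((ν : ℂ) - 1) := by
    have hG := (Real.Gamma_pos_of_pos (sub_pos.2 hν1)).ne'
    have h := (integral_rpow_mul_cexp_neg_mul (sub_pos.2 hν1) hs).2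
    have h3 : EqOn (fun t : ℝ => Complex.exp (-s * t) *
        ((t ^ (-ν) * mWright ν (0 * t ^ (-ν)) : ℝ) : ℂ)) (fun t : ℝ =>
        (((t ^ (1 - ν - 1) : ℝ) : ℂ) * Complex.exp (-s * t)) * ((Real.Gamma (1 - ν))⁻¹ : ℝ))
        (Ioi 0) := by
      intro t _
      simp only [zero_mul, mWright_zero]
      rw [show 1 - ν - 1 = -ν by ring]
      push_cast
      ring
    rw [setIntegral_congr_fun measurableSet_Ioi h3, integral_mul_const, h, Complex.Gamma_ofReal]
    have hG' : ((Real.Gamma (1 - ν) : ℝ) : ℂ) ≠ 0 := by exact_mod_cast hG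
    rw [Complex.ofReal_inv, mul_right_comm, mul_inv_cancel₀ hG', one_mul]
    congr 1
    push_cast
    ring
  rw [(key 0 le_rfl).2] at h0
  rw [(key x hx).2, ← h0]
  have hC := integral_rayLaplace_sub_eq (x := x) hν0 hν1 hs hx
  rw [div_mul_eq_mul_div]
  congr 1
  linear_combination hC

/-! ### The Mittag-Leffler function -/

/-- Keep only t > A in the Gamma integral, where t^x ≥ A^x. Since A is free, Γ(αn + 1) outgrows
every geometric sequence. -/
theorem rpow_mul_exp_neg_le_Gamma {A x : ℝ} (hA : 0 ≤ A) (hx : 0 ≤ x) :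
    A ^ x * Real.exp (-A) ≤ Real.Gamma (x + 1) := by
  rw [Real.Gamma_eq_integral (by linarith), ← integral_exp_neg_Ioi A, ← integral_const_mul]
  have hconv := Real.GammaIntegral_convergent (s := x + 1) (by linarith)
  have hsub : Ioi A ⊆ Ioi 0 := Ioi_subset_Ioi hA
  refine le_trans ?_ (setIntegral_mono_set hconv ?_ (LE.le.eventuallyLE hsub))
  · refine setIntegral_mono_on ((integrableOn_exp_neg_Ioi A).const_mul _) (hconv.mono_set hsub)
      measurableSet_Ioi fun t ht => ?_
    have ht : A < t := ht
    rw [mul_comm, add_sub_cancel_right]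
    exact mul_le_mul_of_nonneg_left (Real.rpow_le_rpow hA ht.le hx) (Real.exp_pos _).le
  · filter_upwards [ae_restrict_mem measurableSet_Ioi] with t ht
    have ht : 0 < t := ht
    simp only [Pi.zero_apply]
    positivity

theorem exists_norm_mittagLeffler_term_le {α : ℝ} (hα : 0 < α) {R : ℝ} (hR : 0 ≤ R) :
    ∃ C : ℝ, ∀ z : ℂ, ‖z‖ ≤ R → ∀ n : ℕ,
      ‖z ^ n / Complex.Gamma ((α : ℂ) * n + 1)‖ ≤ C * (1 / 2) ^ n := by
  -- Chosen so that A^α = 2R + 1, which makes the ratio R / A^α at most 1/2.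
  set A := (2 * R + 1) ^ (1 / α) with hA
  have hA0 : 0 < A := by positivity
  have hAα : A ^ α = 2 * R + 1 := by
    rw [hA, ← Real.rpow_mul (by positivity), one_div_mul_cancel hα.ne', Real.rpow_one]
  refine ⟨Real.exp A, fun z hz n => ?_⟩
  have hG : (α : ℂ) * n + 1 = ((α * n + 1 : ℝ) : ℂ) := by push_cast; rfl
  have hGp : 0 < Real.Gamma (α * n + 1) := Real.Gamma_pos_of_pos (by positivity)
  rw [hG, Complex.Gamma_ofReal, norm_div, norm_pow, Complex.norm_real, Real.norm_of_nonneg hGp.le]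
  have h1 := rpow_mul_exp_neg_le_Gamma hA0.le (by positivity : 0 ≤ α * n)
  rw [Real.rpow_mul hA0.le, Real.rpow_natCast, hAα] at h1
  calc ‖z‖ ^ n / Real.Gamma (α * n + 1) ≤ R ^ n / ((2 * R + 1) ^ n * Real.exp (-A)) := by
        gcongr
    _ = Real.exp A * (R / (2 * R + 1)) ^ n := by
        rw [Real.exp_neg, div_pow]; field_simp
    _ ≤ Real.exp A * (1 / 2) ^ n := by
        refine mul_le_mul_of_nonneg_left (pow_le_pow_left₀ (by positivity) ?_ n) (Real.exp_pos _).le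
        rw [div_le_div_iff₀ (by positivity) two_pos]
        linarith

theorem summable_mittagLeffler {α : ℝ} (hα : 0 < α) (z : ℂ) :
    Summable fun n : ℕ => z ^ n / Complex.Gamma ((α : ℂ) * n + 1) := by
  obtain ⟨C, hC⟩ := exists_norm_mittagLeffler_term_le hα (norm_nonneg z)
  exact Summable.of_norm_bounded (summable_geometric_two.mul_left C) (hC z le_rfl)

theorem hasSum_mittagLeffler {α : ℝ} (hα : 0 < α) (z : ℂ) :
    HasSum (fun n : ℕ => z ^ n / Complex.Gamma ((α : ℂ) * n + 1)) (mittagLeffler α z) :=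
  (summable_mittagLeffler hα z).hasSum

theorem continuous_mittagLeffler {α : ℝ} (hα : 0 < α) : Continuous (mittagLeffler α) := by
  rw [continuous_iff_continuousAt]
  intro z
  obtain ⟨C, hC⟩ := exists_norm_mittagLeffler_term_le hα (R := ‖z‖ + 1) (by positivity)
  have hon : ContinuousOn (mittagLeffler α) (Metric.closedBall 0 (‖z‖ + 1)) :=
    continuousOn_tsum (fun n => by fun_prop) (summable_geometric_two.mul_left C)
      fun n w hw => hC w (by simpa using hw) n
  refine hon.continuousAt (Metric.closedBall_mem_nhds_of_mem ?_)
  simp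

theorem mittagLeffler_zero (α : ℝ) : mittagLeffler α 0 = 1 := by
  rw [mittagLeffler, tsum_eq_single 0]
  · simp
  · intro n hn
    simp [hn]

/-- Fourier transform of `M_ν` on the positive half-line. -/
noncomputable def mWrightFourier (ν κ : ℝ) : ℂ :=
  ∫ y in Ioi (0 : ℝ), Complex.exp (Complex.I * κ * y) * (mWright ν y : ℂ)

theorem norm_cexp_I_mul (κ x : ℝ) : ‖Complex.exp (Complex.I * κ * x)‖ = 1 := by
  rw [mul_assoc, ← Complex.ofReal_mul, mul_comm Complex.I, Complex.norm_exp_ofReal_mul_I]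

theorem integrable_cexp_mul {f : ℝ → ℂ} {μ : Measure ℝ} (hf : Integrable f μ) (κ : ℝ) :
    Integrable (fun x : ℝ => Complex.exp (Complex.I * κ * x) * f x) μ :=
  hf.bdd_mul (c := 1) (Measurable.aestronglyMeasurable (by fun_prop))
    (Eventually.of_forall fun x => (norm_cexp_I_mul κ x).le)

theorem integrableOn_mWright_scaled {ν t : ℝ} (hν0 : 0 < ν) (hν1 : ν < 1) (ht : 0 < t) :
    IntegrableOn (fun x : ℝ => t ^ (-ν) * mWright ν (x * t ^ (-ν))) (Ioi 0) := by
  have h := (integrableOn_Ioi_comp_mul_right_iff (mWright ν) 0 (Real.rpow_pos_of_pos ht (-ν))).2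
    (by rw [zero_mul]; exact integrableOn_mWright hν0 hν1)
  exact h.const_mul _

theorem integral_abs_mWright_scaled {ν t : ℝ} (ht : 0 < t) :
    ∫ x in Ioi (0 : ℝ), |t ^ (-ν) * mWright ν (x * t ^ (-ν))| =
      ∫ x in Ioi (0 : ℝ), |mWright ν x| := by
  have hp := Real.rpow_pos_of_pos ht (-ν)
  have h := integral_comp_mul_right_Ioi (fun x => |mWright ν x|) 0 hp
  simp only [abs_mul, abs_of_pos hp]
  rw [integral_const_mul, h, zero_mul, smul_eq_mul, mul_inv_cancel_left₀ hp.ne']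

theorem integral_cexp_mWright_scaled {ν t : ℝ} (ht : 0 < t) (κ : ℝ) :
    ∫ x in Ioi (0 : ℝ), Complex.exp (Complex.I * κ * x) *
      ((t ^ (-ν) * mWright ν (x * t ^ (-ν)) : ℝ) : ℂ) = mWrightFourier ν (κ * t ^ ν) := by
  have hp := Real.rpow_pos_of_pos ht (-ν)
  have h := integral_comp_mul_right_Ioi (fun y : ℝ => Complex.exp (Complex.I * (κ * t ^ ν : ℝ) * y) *
    (mWright ν y : ℂ)) 0 hp
  rw [zero_mul, eq_inv_smul_iff₀ hp.ne', ← integral_smul] at h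
  rw [mWrightFourier, ← h]
  refine integral_congr_ae (Eventually.of_forall fun x => ?_)
  have e : t ^ ν * t ^ (-ν) = 1 := by rw [← Real.rpow_add ht, add_neg_cancel, Real.rpow_zero]
  have e2 : Complex.I * (κ * t ^ ν : ℝ) * ((x * t ^ (-ν) : ℝ) : ℂ) = Complex.I * κ * x := by
    rw [mul_assoc, mul_assoc, ← Complex.ofReal_mul, ← Complex.ofReal_mul]
    congr 2
    linear_combination κ * x * e
  simp only [e2, Complex.real_smul]
  push_cast
  ring

theorem continuous_mWrightFourier {ν : ℝ} (hν0 : 0 < ν) (hν1 : ν < 1) :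
    Continuous (mWrightFourier ν) := by
  unfold mWrightFourier
  refine continuous_of_dominated (bound := fun y => |mWright ν y|) (fun κ => ?_) (fun κ => ?_)
    (integrableOn_mWright hν0 hν1).abs ?_
  · have := measurable_mWright hν0 hν1
    exact Measurable.aestronglyMeasurable (by fun_prop)
  · exact Eventually.of_forall fun y => by
      rw [norm_mul, norm_cexp_I_mul, one_mul, Complex.norm_real, Real.norm_eq_abs]
  · exact Eventually.of_forall fun y => by fun_prop

/-- Fubini applies because the L¹ norm in x of t^{-ν} M_ν(x t^{-ν}) does not depend on t. After
`laplace_mWright` the x-integral is that of e^{-(s^ν - iκ)x}, which converges since Re s^ν > 0. -/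
theorem laplace_mWrightFourier {ν : ℝ} (hν0 : 0 < ν) (hν1 : ν < 1) (κ : ℝ) {s : ℂ}
    (hs : 0 < s.re) :
    IntegrableOn (fun t : ℝ => Complex.exp (-s * t) * mWrightFourier ν (κ * t ^ ν)) (Ioi 0) ∧
    ∫ t in Ioi (0 : ℝ), Complex.exp (-s * t) * mWrightFourier ν (κ * t ^ ν) =
      s ^ ((ν : ℂ) - 1) / (s ^ (ν : ℂ) - Complex.I * κ) := by
  let μ := volume.restrict (Ioi (0 : ℝ))
  let f : ℝ → ℝ → ℂ := fun t x => Complex.exp (-s * t) * (Complex.exp (Complex.I * κ * x) *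
    ((t ^ (-ν) * mWright ν (x * t ^ (-ν)) : ℝ) : ℂ))
  have hMm := measurable_mWright hν0 hν1
  have hm : Measurable (Function.uncurry f) := by
    simp only [Function.uncurry_def, f]
    fun_prop
  have hint : Integrable (Function.uncurry f) (μ.prod μ) := by
    rw [integrable_prod_iff hm.aestronglyMeasurable]
    constructor
    · filter_upwards [ae_restrict_mem measurableSet_Ioi] with t ht
      simp only [Function.uncurry_apply_pair, f]
      exact (integrable_cexp_mul (integrableOn_mWright_scaled hν0 hν1 ht).ofReal κ).const_mul _
    · have h1 : IntegrableOn (fun t => Real.exp (-s.re * t) * ∫ x in Ioi (0 : ℝ), |mWright ν x|)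
          (Ioi 0) := (integrableOn_exp_mul_Ioi (neg_lt_zero.2 hs) 0).mul_const _
      refine (integrableOn_congr_fun (fun t ht => ?_) measurableSet_Ioi).1 h1
      have hn : ∀ x, ‖f t x‖ =
          Real.exp (-s.re * t) * |t ^ (-ν) * mWright ν (x * t ^ (-ν))| := by
        intro x
        rw [norm_mul, norm_mul, norm_cexp_I_mul, one_mul, Complex.norm_real, Complex.norm_exp,
          Real.norm_eq_abs]
        simp
      simp only [Function.uncurry_apply_pair, hn]
      rw [integral_const_mul, integral_abs_mWright_scaled ht]
  have heq : ∀ t ∈ Ioi (0 : ℝ), Complex.exp (-s * t) * mWrightFourier ν (κ * t ^ ν) =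
      ∫ x, f t x ∂μ := by
    intro t ht
    simp only [f]
    rw [integral_const_mul, integral_cexp_mWright_scaled ht]
  rw [integrableOn_congr_fun heq measurableSet_Ioi, setIntegral_congr_fun measurableSet_Ioi heq]
  refine ⟨hint.integral_prod_left, ?_⟩
  rw [integral_integral_swap hint]
  have hre : 0 < (s ^ (ν : ℂ) - Complex.I * κ).re := by simpa using re_cpow_pos hν0 hν1.le hs
  have hsec : ∀ x ∈ Ioi (0 : ℝ), ∫ t, f t x ∂μ = s ^ ((ν : ℂ) - 1) *
      Complex.exp (-(s ^ (ν : ℂ) - Complex.I * κ) * x) := by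
    intro x hx
    have hx : 0 < x := hx
    have e : ∀ t, f t x = Complex.exp (Complex.I * κ * x) * (Complex.exp (-s * t) *
      ((t ^ (-ν) * mWright ν (x * t ^ (-ν)) : ℝ) : ℂ)) := fun t => mul_left_comm _ _ _
    simp only [e]
    rw [integral_const_mul, (laplace_mWright hν0 hν1 hx.le hs).2, mul_left_comm, ← Complex.exp_add]
    ring_nf
  have h := (integral_rpow_mul_cexp_neg_mul one_pos hre).2
  simp only [sub_self, Real.rpow_zero, Complex.ofReal_one, one_mul, Complex.Gamma_one,
    Complex.cpow_neg_one] at h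
  rw [setIntegral_congr_fun measurableSet_Ioi hsec, integral_const_mul, h, div_eq_mul_inv]

theorem integrable_of_hasSum_of_summable_integral_norm {α : Type*} [MeasurableSpace α]
    {μ : Measure α} {F : ℕ → α → ℂ} {g : α → ℂ} (hF : ∀ n, Integrable (F n) μ)
    (hsum : Summable fun n => ∫ a, ‖F n a‖ ∂μ) (hg : AEStronglyMeasurable g μ)
    (h : ∀ᵐ a ∂μ, HasSum (fun n => F n a) (g a)) : Integrable g μ := by
  refine ⟨hg, ?_⟩
  have h1 : ∫⁻ a, ‖g a‖ₑ ∂μ ≤ ∫⁻ a, ∑' n, ‖F n a‖ₑ ∂μ := by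
    refine lintegral_mono_ae (h.mono fun a ha => ?_)
    rw [← ha.tsum_eq]
    exact enorm_tsum_le_tsum_enorm
  refine h1.trans_lt ?_
  rw [lintegral_tsum fun n => (hF n).1.enorm]
  simp only [← ofReal_integral_norm_eq_lintegral_enorm (hF _)]
  exact hsum.tsum_ofReal_lt_top

/-- Termwise integration gives a geometric series in iκ s^{-ν}, absolutely convergent under `hκ`.
The restriction on s disappears in `isLaplacePair_mittagLeffler`. -/
theorem laplace_mittagLeffler_of_lt {ν : ℝ} (hν0 : 0 < ν) (κ : ℝ) {s : ℂ}
    (hs : 0 < s.re) (hκ : |κ| < s.re ^ ν) :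
    IntegrableOn (fun t : ℝ => Complex.exp (-s * t) *
      mittagLeffler ν (Complex.I * ((κ * t ^ ν : ℝ) : ℂ))) (Ioi 0) ∧
    ∫ t in Ioi (0 : ℝ), Complex.exp (-s * t) * mittagLeffler ν (Complex.I * ((κ * t ^ ν : ℝ) : ℂ)) =
      s ^ ((ν : ℂ) - 1) / (s ^ (ν : ℂ) - Complex.I * κ) := by
  have hs0 : s ≠ 0 := by rintro rfl; simp at hs
  have hq : ∀ n : ℕ, 0 < ν * n + 1 := fun n => by positivity
  have hG : ∀ n : ℕ, (ν : ℂ) * n + 1 = ((ν * n + 1 : ℝ) : ℂ) := fun n => by push_cast; rfl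
  let F : ℕ → ℝ → ℂ := fun n t => ((Complex.I * κ) ^ n / Complex.Gamma ((ν : ℂ) * n + 1)) *
    (((t ^ ((ν * n + 1) - 1) : ℝ) : ℂ) * Complex.exp (-s * t))
  have hGne : ∀ n : ℕ, Complex.Gamma ((ν * n + 1 : ℝ) : ℂ) ≠ 0 := fun n => by
    rw [Complex.Gamma_ofReal]
    exact_mod_cast (Real.Gamma_pos_of_pos (hq n)).ne'
  have hF : ∀ t ∈ Ioi (0 : ℝ), HasSum (fun n => F n t) (Complex.exp (-s * t) *
      mittagLeffler ν (Complex.I * ((κ * t ^ ν : ℝ) : ℂ))) := by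
    intro t ht
    have ht : 0 < t := ht
    refine hasSum_of_eq (fun n => ?_) ((hasSum_mittagLeffler hν0 _).mul_left _)
    simp only [F]
    rw [add_sub_cancel_right, Real.rpow_mul ht.le, Real.rpow_natCast]
    push_cast
    ring
  have hFint : ∀ n, IntegrableOn (F n) (Ioi 0) := fun n =>
    (integral_rpow_mul_cexp_neg_mul (hq n) hs).1.const_mul _
  have hFval : ∀ n, ∫ t in Ioi (0 : ℝ), F n t = s⁻¹ * (Complex.I * κ * (s ^ (ν : ℂ))⁻¹) ^ n := by
    intro n
    simp only [F]
    rw [integral_const_mul, (integral_rpow_mul_cexp_neg_mul (hq n) hs).2, hG, ← mul_assoc,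
      div_mul_cancel₀ _ (hGne n), mul_pow, Complex.cpow_neg]
    push_cast
    rw [Complex.cpow_add _ _ hs0, Complex.cpow_one, Complex.cpow_mul_nat, mul_inv]
    ring
  have hFn : ∀ n, ∫ t in Ioi (0 : ℝ), ‖F n t‖ = (s.re)⁻¹ * (|κ| / s.re ^ ν) ^ n := by
    intro n
    have hGp := Real.Gamma_pos_of_pos (hq n)
    have e : EqOn (fun t => ‖F n t‖) (fun t => (|κ| ^ n / Real.Gamma (ν * n + 1)) *
        (t ^ ((ν * n + 1) - 1) * Real.exp (-(s.re * t)))) (Ioi 0) := by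
      intro t ht
      simp only [F]
      rw [norm_mul, norm_rpow_mul_cexp (mem_Ioi.1 ht), hG, Complex.Gamma_ofReal, norm_div, norm_pow,
        norm_mul, Complex.norm_I, one_mul, Complex.norm_real, Complex.norm_real, Real.norm_eq_abs,
        Real.norm_of_nonneg hGp.le]
      simp
    rw [setIntegral_congr_fun measurableSet_Ioi e, integral_const_mul,
      Real.integral_rpow_mul_exp_neg_mul_Ioi (hq n) hs, one_div, Real.inv_rpow hs.le,
      Real.rpow_add_one hs.ne', Real.rpow_mul hs.le, Real.rpow_natCast, div_pow]
    field_simp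
  have hsumn : Summable fun n => ∫ t in Ioi (0 : ℝ), ‖F n t‖ := by
    simp only [hFn]
    refine (summable_geometric_of_lt_one (by positivity) ?_).mul_left _
    rwa [div_lt_one (by positivity)]
  have hcont := continuous_mittagLeffler hν0
  have hae : ∀ᵐ t ∂(volume.restrict (Ioi (0 : ℝ))), HasSum (fun n => F n t)
      (Complex.exp (-s * t) * mittagLeffler ν (Complex.I * ((κ * t ^ ν : ℝ) : ℂ))) := by
    filter_upwards [ae_restrict_mem measurableSet_Ioi] with t ht using hF t ht
  refine ⟨integrable_of_hasSum_of_summable_integral_norm hFint hsumn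
    (Measurable.aestronglyMeasurable (by have := hcont.measurable; fun_prop)) hae, ?_⟩
  have h1 := hasSum_integral_of_summable_integral_norm hFint hsumn
  rw [integral_congr_ae (hae.mono fun t ht => ht.tsum_eq)] at h1
  refine h1.unique ?_
  simp only [hFval]
  have hnorm : ‖Complex.I * κ * (s ^ (ν : ℂ))⁻¹‖ < 1 := by
    rw [norm_mul, norm_mul, Complex.norm_I, one_mul, norm_inv, Complex.norm_real, Real.norm_eq_abs,
      Complex.norm_cpow_real, ← div_eq_mul_inv, div_lt_one (by positivity)]
    exact hκ.trans_le (Real.rpow_le_rpow hs.le (Complex.re_le_norm s) hν0.le)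
  have h2 := (hasSum_geometric_of_norm_lt_one hnorm).mul_left s⁻¹
  have hsν : s ^ (ν : ℂ) ≠ 0 := by rw [Complex.cpow_ne_zero_iff]; exact Or.inl hs0
  have e3 : s⁻¹ * (1 - Complex.I * κ * (s ^ (ν : ℂ))⁻¹)⁻¹ =
      s ^ ((ν : ℂ) - 1) / (s ^ (ν : ℂ) - Complex.I * κ) := by
    rw [Complex.cpow_sub _ _ hs0, Complex.cpow_one, ← div_eq_mul_inv _ (s ^ (ν : ℂ)),
      one_sub_div hsν, inv_div]
    ring
  rwa [e3] at h2

/-- The Fourier transform of `M_ν` is the Mittag-Leffler function on the imaginary axis. -/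
theorem mWrightFourier_eq_mittagLeffler {ν : ℝ} (hν0 : 0 < ν) (hν1 : ν < 1) (κ : ℝ) :
    mWrightFourier ν κ = mittagLeffler ν (Complex.I * (κ : ℂ)) := by
  -- On the line Re s = σ one has (Re s)^ν = |κ| + 1 > |κ|, so both Laplace transforms are available
  -- there.
  set σ : ℝ := (|κ| + 1) ^ (1 / ν) with hσ
  have hσ0 : 0 < σ := by positivity
  have hσν : σ ^ ν = |κ| + 1 := by
    rw [hσ, ← Real.rpow_mul (by positivity), one_div_mul_cancel hν0.ne', Real.rpow_one]
  have hpos : ∀ s : ℂ, s.re = σ → 0 < s.re := fun s hs => hs ▸ hσ0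
  have hlt : ∀ s : ℂ, s.re = σ → |κ| < s.re ^ ν := fun s hs => by rw [hs, hσν]; linarith
  have hae := ae_eq_of_laplace_eq_on_line (f := fun t => mWrightFourier ν (κ * t ^ ν))
    (g := fun t => mittagLeffler ν (Complex.I * ((κ * t ^ ν : ℝ) : ℂ))) σ
    (fun s hs => (laplace_mWrightFourier hν0 hν1 κ (hpos s hs)).1)
    (fun s hs => (laplace_mittagLeffler_of_lt hν0 κ (hpos s hs) (hlt s hs)).1)
    (fun s hs => by rw [(laplace_mWrightFourier hν0 hν1 κ (hpos s hs)).2,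
      (laplace_mittagLeffler_of_lt hν0 κ (hpos s hs) (hlt s hs)).2])
  have hc1 := continuous_mWrightFourier hν0 hν1
  have hc2 := continuous_mittagLeffler hν0
  have hrp : Continuous fun t : ℝ => t ^ ν := Real.continuous_rpow_const hν0.le
  -- Continuity upgrades equality almost everywhere to equality for every t > 0; t = 1 is the claim.
  have hEq : EqOn (fun t => mWrightFourier ν (κ * t ^ ν))
      (fun t => mittagLeffler ν (Complex.I * ((κ * t ^ ν : ℝ) : ℂ))) (Ioi 0) :=
    Measure.eqOn_open_of_ae_eq hae isOpen_Ioi (by fun_prop) (by fun_prop)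
  simpa using hEq (mem_Ioi.2 one_pos)

/-! ### Fourier and Laplace transforms of the Green functions -/

theorem isFourierPair_halfLine {f : ℝ → ℂ} {P : ℝ → ℂ} (hf : IntegrableOn f (Ioi 0))
    (hP : ∀ κ : ℝ, ∫ x in Ioi (0 : ℝ), Complex.exp (Complex.I * κ * x) * f x = P κ) :
    IsFourierPair (fun x => if 0 < x then f x else 0) P := by
  have e : (fun x => if 0 < x then f x else 0) = (Ioi (0 : ℝ)).indicator f := by
    funext x; simp [indicator, mem_Ioi]
  rw [e]
  refine ⟨(integrable_indicator_iff measurableSet_Ioi).2 hf, fun κ => ?_⟩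
  rw [← hP, ← integral_indicator measurableSet_Ioi]
  refine integral_congr_ae (Eventually.of_forall fun x => ?_)
  by_cases hx : x ∈ Ioi (0 : ℝ)
  · simp only [indicator_of_mem hx]
  · simp only [indicator_of_notMem hx, mul_zero]

theorem isFourierPair_even {f : ℝ → ℂ} {P : ℝ → ℂ} (hf : IntegrableOn f (Ioi 0))
    (hP : ∀ κ : ℝ, ∫ x in Ioi (0 : ℝ), Complex.exp (Complex.I * κ * x) * f x = P κ) :
    IsFourierPair (fun x => f |x|) (fun κ => P κ + P (-κ)) := by
  have h1 : IntegrableOn (fun x => f |x|) (Ioi 0) :=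
    hf.congr_fun (fun x hx => by rw [abs_of_pos hx]) measurableSet_Ioi
  have h2 : IntegrableOn (fun x => f |x|) (Iic 0) := by
    rw [← Measure.map_neg_eq_self (volume : Measure ℝ)]
    let m : MeasurableEmbedding fun x : ℝ => -x := (Homeomorph.neg ℝ).measurableEmbedding
    rw [m.integrableOn_map_iff]
    simp_rw [Function.comp_def, abs_neg, neg_preimage, neg_Iic, neg_zero]
    exact Iff.mpr integrableOn_Ici_iff_integrableOn_Ioi h1
  have hint : Integrable fun x => f |x| := by
    rw [← integrableOn_univ, ← Iic_union_Ioi (a := (0 : ℝ))]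
    exact h2.union h1
  refine ⟨hint, fun κ => ?_⟩
  beta_reduce
  have hint' := integrable_cexp_mul hint κ
  rw [← intervalIntegral.integral_Iic_add_Ioi (b := 0) hint'.integrableOn hint'.integrableOn,
    add_comm, ← hP κ, ← hP (-κ)]
  congr 1
  · refine setIntegral_congr_fun measurableSet_Ioi fun x hx => ?_
    simp only [abs_of_pos (mem_Ioi.1 hx)]
  · have h := integral_comp_neg_Iic (0 : ℝ) fun x =>
      Complex.exp (Complex.I * ((-κ : ℝ) : ℂ) * x) * f |x|
    rw [neg_zero] at h
    have e : ∫ x in Ioi (0 : ℝ), Complex.exp (Complex.I * ((-κ : ℝ) : ℂ) * x) * f |x| =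
        ∫ x in Ioi (0 : ℝ), Complex.exp (Complex.I * ((-κ : ℝ) : ℂ) * x) * f x :=
      setIntegral_congr_fun measurableSet_Ioi fun x hx => by
        simp only [abs_of_pos (mem_Ioi.1 hx)]
    rw [← e, ← h]
    refine setIntegral_congr_fun measurableSet_Iic fun x _ => ?_
    simp only [abs_neg]
    push_cast
    ring_nf

theorem integral_cexp_mul_cexp_neg {A a : ℂ} (ha : 0 < a.re) :
    IntegrableOn (fun x : ℝ => A * Complex.exp (-(x : ℂ) * a)) (Ioi 0) ∧
    ∀ κ : ℝ, ∫ x in Ioi (0 : ℝ), Complex.exp (Complex.I * κ * x) *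
      (A * Complex.exp (-(x : ℂ) * a)) = A / (a - Complex.I * κ) := by
  have key : ∀ b : ℂ, 0 < b.re → IntegrableOn (fun x : ℝ => Complex.exp (-b * x)) (Ioi 0) ∧
      ∫ x in Ioi (0 : ℝ), Complex.exp (-b * x) = b⁻¹ := by
    intro b hb
    have h := integral_rpow_mul_cexp_neg_mul one_pos hb
    simpa only [sub_self, Real.rpow_zero, Complex.ofReal_one, one_mul, Complex.Gamma_one,
      Complex.cpow_neg_one] using h
  constructor
  · refine ((key a ha).1.const_mul A).congr (Eventually.of_forall fun x => ?_)
    simp only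
    ring_nf
  · intro κ
    rw [div_eq_mul_inv, ← (key (a - Complex.I * κ) (by simpa)).2, ← integral_const_mul]
    refine integral_congr_ae (Eventually.of_forall fun x => ?_)
    simp only
    rw [mul_left_comm, ← Complex.exp_add]
    ring_nf

/-- Any scale a > 0 is some t^{-ν}, so the formulas for the time-scaled profile hold at an arbitrary
scale, in particular one that contains √K. -/
theorem exists_rpow_eq {ν a : ℝ} (hν0 : 0 < ν) (ha : 0 < a) :
    ∃ t : ℝ, 0 < t ∧ t ^ (-ν) = a ∧ t ^ ν = a⁻¹ := by
  refine ⟨a ^ (-1 / ν), by positivity, ?_, ?_⟩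
  · rw [← Real.rpow_mul ha.le]
    rw [show -1 / ν * -ν = 1 by field_simp, Real.rpow_one]
  · rw [← Real.rpow_mul ha.le]
    rw [show -1 / ν * ν = -1 by field_simp, Real.rpow_neg_one]

/-- The odd terms of E_ν(±iκ) cancel; in the even ones (iκ)^{2m} = (-κ²)^m and Γ(ν·2m + 1) = Γ(2ν·m
+ 1). -/
theorem mWrightFourier_even {ν : ℝ} (hν0 : 0 < ν) (hν1 : ν < 1) (κ : ℝ) :
    (mWrightFourier ν κ + mWrightFourier ν (-κ)) / 2 = mittagLeffler (2 * ν) (-(κ : ℂ) ^ 2) := by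
  rw [mWrightFourier_eq_mittagLeffler hν0 hν1, mWrightFourier_eq_mittagLeffler hν0 hν1]
  have h := ((hasSum_mittagLeffler hν0 (Complex.I * κ)).add
    (hasSum_mittagLeffler hν0 (Complex.I * ((-κ : ℝ) : ℂ)))).div_const 2
  have hinj : Function.Injective fun m : ℕ => 2 * m := fun a b h => by simpa using h
  rw [← hinj.hasSum_iff] at h
  · refine h.unique (hasSum_of_eq (fun m => ?_) (hasSum_mittagLeffler (by positivity) _))
    simp only [Function.comp_apply]
    have e1 : (Complex.I * (κ : ℂ)) ^ (2 * m) = (-(κ : ℂ) ^ 2) ^ m := by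
      rw [pow_mul, mul_pow, Complex.I_sq, neg_one_mul]
    have e2 : (Complex.I * ((-κ : ℝ) : ℂ)) ^ (2 * m) = (-(κ : ℂ) ^ 2) ^ m := by
      rw [pow_mul, mul_pow, Complex.I_sq, neg_one_mul, Complex.ofReal_neg, neg_sq]
    rw [e1, e2]
    push_cast
    ring_nf
  · intro n hn
    have hodd : Odd n := by
      by_contra hne
      rw [Nat.not_odd_iff_even] at hne
      obtain ⟨m, hm⟩ := hne
      exact hn ⟨m, by simp only; omega⟩
    have e : (Complex.I * ((-κ : ℝ) : ℂ)) ^ n = -(Complex.I * (κ : ℂ)) ^ n := by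
      rw [Complex.ofReal_neg, mul_neg, hodd.neg_pow]
    rw [e]
    ring

theorem isFourierPair_mWright_halfLine {ν t : ℝ} (hν0 : 0 < ν) (hν1 : ν < 1) (ht : 0 < t) :
    IsFourierPair (fun x => (driftGreen ν x t : ℂ))
      (fun κ => mittagLeffler ν (Complex.I * κ * ((t ^ ν : ℝ) : ℂ))) := by
  have h := isFourierPair_halfLine (integrableOn_mWright_scaled hν0 hν1 ht).ofReal
    (fun κ => integral_cexp_mWright_scaled ht κ)
  convert h using 2 with x κ
  · rw [driftGreen, Real.rpow_neg ht.le, div_eq_mul_inv]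
    split_ifs <;> simp
  · rw [mWrightFourier_eq_mittagLeffler hν0 hν1]
    push_cast
    ring_nf

theorem isFourierPair_mWright_even {ν a : ℝ} (hν0 : 0 < ν) (hν1 : ν < 1) (ha : 0 < a) :
    IsFourierPair (fun x => ((1 / 2 * a * mWright ν (|x| * a) : ℝ) : ℂ))
      (fun κ => mittagLeffler (2 * ν) (-((κ * a⁻¹ : ℝ) : ℂ) ^ 2)) := by
  obtain ⟨t, ht, hta, hta'⟩ := exists_rpow_eq hν0 ha
  have h := isFourierPair_even (f := fun x => ((1 / 2 * (t ^ (-ν) * mWright ν (x * t ^ (-ν))) : ℝ) : ℂ))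
    (P := fun κ => 1 / 2 * mWrightFourier ν (κ * t ^ ν))
    ((integrableOn_mWright_scaled hν0 hν1 ht).const_mul _).ofReal (fun κ => by
      rw [← integral_cexp_mWright_scaled ht, ← integral_const_mul]
      refine integral_congr_ae (Eventually.of_forall fun x => ?_)
      simp only
      push_cast
      ring)
  convert h using 2 with x κ
  · rw [hta, mul_assoc]
  · rw [hta', ← mWrightFourier_even hν0 hν1]
    ring_nf

theorem diffusionGreen_eq {β K t : ℝ} (x : ℝ) :
    diffusionGreen β K x t = 1 / 2 * (√K * t ^ (β / 2))⁻¹ *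
      mWright (β / 2) (|x| * (√K * t ^ (β / 2))⁻¹) := by
  rw [diffusionGreen, one_div (√K * _), div_eq_mul_inv (|x|)]

theorem isFourierPair_diffusionGreen {β K t : ℝ} (hβ0 : 0 < β) (hβ1 : β < 1) (hK : 0 < K)
    (ht : 0 < t) :
    IsFourierPair (fun x => (diffusionGreen β K x t : ℂ))
      (fun κ => mittagLeffler β (-(K * (κ : ℂ) ^ 2) * ((t ^ β : ℝ) : ℂ))) := by
  have hc : 0 < (√K * t ^ (β / 2))⁻¹ := by positivity
  have h := isFourierPair_mWright_even (half_pos hβ0) (by linarith : β / 2 < 1) hc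
  simp only [diffusionGreen_eq]
  convert h using 2 with κ
  rw [inv_inv, mul_div_cancel₀ _ two_ne_zero]
  congr 1
  have e : (κ * (√K * t ^ (β / 2))) ^ 2 = K * κ ^ 2 * t ^ β := by
    rw [mul_pow, mul_pow, Real.sq_sqrt hK.le, ← Real.rpow_natCast (t ^ (β / 2)),
      ← Real.rpow_mul ht.le]
    push_cast
    rw [div_mul_cancel₀ _ two_ne_zero]
    ring
  rw [← Complex.ofReal_pow (κ * (√K * t ^ (β / 2))), e]
  push_cast
  ring

/-- Reading E_ν(iκ t^ν) as the Fourier transform of an integrable function gives the formula on the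
whole half-plane Re s > 0, beyond the reach of the termwise computation. -/
theorem isLaplacePair_mittagLeffler {ν : ℝ} (hν0 : 0 < ν) (hν1 : ν < 1) (κ : ℝ) :
    IsLaplacePair (fun t : ℝ => mittagLeffler ν (Complex.I * κ * ((t ^ ν : ℝ) : ℂ)))
      (fun s : ℂ => s ^ ((ν : ℂ) - 1) / (s ^ (ν : ℂ) - Complex.I * κ)) := by
  intro s hs
  have h := laplace_mWrightFourier hν0 hν1 κ hs
  simpa only [mWrightFourier_eq_mittagLeffler hν0 hν1, Complex.ofReal_mul, ← mul_assoc] using h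

theorem cpow_half_mul_self {s : ℂ} (hs : 0 < s.re) (β : ℝ) :
    s ^ ((β : ℂ) / 2) * s ^ ((β : ℂ) / 2) = s ^ (β : ℂ) := by
  have hs0 : s ≠ 0 := by rintro rfl; simp at hs
  rw [← Complex.cpow_add _ _ hs0, add_halves]

theorem re_cpow_half_pos {s : ℂ} (hs : 0 < s.re) {β : ℝ} (hβ0 : 0 < β) (hβ1 : β < 1) :
    0 < (s ^ ((β : ℂ) / 2)).re := by
  have := re_cpow_pos (half_pos hβ0) (by linarith) hs
  simpa using this

/-- Partial fractions for s^β + κ² = (s^{β/2} - iκ)(s^{β/2} + iκ); neither factor vanishes, because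
Re s^{β/2} > 0. -/
theorem half_mul_inv_add_inv {s : ℂ} (hs : 0 < s.re) {β : ℝ} (hβ0 : 0 < β) (hβ1 : β < 1) (κ : ℝ) :
    1 / 2 * s ^ ((β : ℂ) / 2 - 1) / (s ^ ((β : ℂ) / 2) - Complex.I * κ) +
      1 / 2 * s ^ ((β : ℂ) / 2 - 1) / (s ^ ((β : ℂ) / 2) - Complex.I * ((-κ : ℝ) : ℂ)) =
      s ^ ((β : ℂ) - 1) / (s ^ (β : ℂ) + (κ : ℂ) ^ 2) := by
  have hs0 : s ≠ 0 := by rintro rfl; simp at hs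
  have hre := re_cpow_half_pos hs hβ0 hβ1
  have h1 : s ^ ((β : ℂ) / 2) - Complex.I * κ ≠ 0 := by
    intro h
    have := congrArg Complex.re h
    simp at this
    linarith
  have h2 : s ^ ((β : ℂ) / 2) + Complex.I * κ ≠ 0 := by
    intro h
    have := congrArg Complex.re h
    simp at this
    linarith
  have e1 : s ^ (β : ℂ) + (κ : ℂ) ^ 2 =
      (s ^ ((β : ℂ) / 2) - Complex.I * κ) * (s ^ ((β : ℂ) / 2) + Complex.I * κ) := by
    rw [← cpow_half_mul_self hs]
    linear_combination (κ : ℂ) ^ 2 * Complex.I_sq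
  rw [e1, Complex.cpow_sub _ _ hs0, Complex.cpow_sub _ _ hs0, Complex.cpow_one,
    ← cpow_half_mul_self hs β, Complex.ofReal_neg, mul_neg, sub_neg_eq_add]
  field_simp
  ring

theorem isLaplacePair_mittagLeffler_neg_sq {β : ℝ} (hβ0 : 0 < β) (hβ1 : β < 1) (κ : ℝ) :
    IsLaplacePair (fun t : ℝ => mittagLeffler β (-(κ : ℂ) ^ 2 * ((t ^ β : ℝ) : ℂ)))
      (fun s : ℂ => s ^ ((β : ℂ) - 1) / (s ^ (β : ℂ) + (κ : ℂ) ^ 2)) := by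
  intro s hs
  have hν0 := half_pos hβ0
  have hν1 : β / 2 < 1 := by linarith
  have h1 := laplace_mWrightFourier hν0 hν1 κ hs
  have h2 := laplace_mWrightFourier hν0 hν1 (-κ) hs
  have e : EqOn (fun t : ℝ => Complex.exp (-s * t) *
      mittagLeffler β (-(κ : ℂ) ^ 2 * ((t ^ β : ℝ) : ℂ)))
      (fun t : ℝ => 1 / 2 * (Complex.exp (-s * t) * mWrightFourier (β / 2) (κ * t ^ (β / 2))) +
        1 / 2 * (Complex.exp (-s * t) * mWrightFourier (β / 2) (-κ * t ^ (β / 2)))) (Ioi 0) := by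
    intro t ht
    have ht : 0 < t := ht
    have h3 := mWrightFourier_even hν0 hν1 (κ * t ^ (β / 2))
    rw [mul_div_cancel₀ _ two_ne_zero] at h3
    have e2 : -((κ * t ^ (β / 2) : ℝ) : ℂ) ^ 2 = -(κ : ℂ) ^ 2 * ((t ^ β : ℝ) : ℂ) := by
      have : (t ^ (β / 2)) ^ 2 = t ^ β := by
        rw [← Real.rpow_natCast, ← Real.rpow_mul ht.le]
        push_cast
        rw [div_mul_cancel₀ _ two_ne_zero]
      rw [← this]
      push_cast
      ring
    simp only
    rw [← e2, ← h3, neg_mul]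
    ring_nf
  rw [integrableOn_congr_fun e measurableSet_Ioi, setIntegral_congr_fun measurableSet_Ioi e,
    show (fun s : ℂ => s ^ ((β : ℂ) - 1) / (s ^ (β : ℂ) + (κ : ℂ) ^ 2)) s =
      s ^ ((β : ℂ) - 1) / (s ^ (β : ℂ) + (κ : ℂ) ^ 2) from rfl,
    integral_add (h1.1.const_mul _) (h2.1.const_mul _), integral_const_mul, integral_const_mul,
    h1.2, h2.2, ← half_mul_inv_add_inv hs hβ0 hβ1 κ]
  refine ⟨(h1.1.const_mul _).add (h2.1.const_mul _), ?_⟩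
  push_cast
  ring

theorem isFourierPair_drift_symbol {β : ℝ} (hβ0 : 0 < β) (hβ1 : β < 1) {s : ℂ} (hs : 0 < s.re) :
    IsFourierPair (fun x : ℝ => if 0 < x then
        s ^ ((β : ℂ) - 1) * Complex.exp (-(x : ℂ) * s ^ (β : ℂ)) else 0)
      (fun κ : ℝ => s ^ ((β : ℂ) - 1) / (s ^ (β : ℂ) - Complex.I * κ)) := by
  have h := integral_cexp_mul_cexp_neg (A := s ^ ((β : ℂ) - 1)) (re_cpow_pos hβ0 hβ1.le hs)
  exact isFourierPair_halfLine h.1 h.2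

theorem isFourierPair_diffusion_symbol {β : ℝ} (hβ0 : 0 < β) (hβ1 : β < 1) {s : ℂ}
    (hs : 0 < s.re) :
    IsFourierPair (fun x : ℝ => 1 / 2 * s ^ ((β : ℂ) / 2 - 1) *
        Complex.exp (-((|x| : ℝ) : ℂ) * s ^ ((β : ℂ) / 2)))
      (fun κ : ℝ => s ^ ((β : ℂ) - 1) / (s ^ (β : ℂ) + (κ : ℂ) ^ 2)) := by
  have h := integral_cexp_mul_cexp_neg (A := 1 / 2 * s ^ ((β : ℂ) / 2 - 1))
    (re_cpow_half_pos hs hβ0 hβ1)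
  have h2 := isFourierPair_even h.1 h.2
  simp only [half_mul_inv_add_inv hs hβ0 hβ1] at h2
  exact h2

theorem diffusionGreen_one {β t : ℝ} (x : ℝ) (ht : 0 < t) :
    diffusionGreen β 1 x t =
      1 / 2 * t ^ (-(β / 2)) * mWright (β / 2) (|x| * t ^ (-(β / 2))) := by
  rw [diffusionGreen_eq, Real.sqrt_one, one_mul, Real.rpow_neg ht.le]

theorem isLaplacePair_diffusionGreen {β : ℝ} (hβ0 : 0 < β) (hβ1 : β < 1) (x : ℝ) :
    IsLaplacePair (fun t : ℝ => (diffusionGreen β 1 x t : ℂ))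
      (fun s : ℂ => 1 / 2 * s ^ ((β : ℂ) / 2 - 1) *
        Complex.exp (-((|x| : ℝ) : ℂ) * s ^ ((β : ℂ) / 2))) := by
  intro s hs
  have h := laplace_mWright (half_pos hβ0) (by linarith : β / 2 < 1) (abs_nonneg x) hs
  have e : EqOn (fun t : ℝ => Complex.exp (-s * t) * (diffusionGreen β 1 x t : ℂ))
      (fun t : ℝ => 1 / 2 * (Complex.exp (-s * t) *
        ((t ^ (-(β / 2)) * mWright (β / 2) (|x| * t ^ (-(β / 2))) : ℝ) : ℂ))) (Ioi 0) := by
    intro t ht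
    simp only
    rw [diffusionGreen_one x ht]
    push_cast
    ring
  rw [integrableOn_congr_fun e measurableSet_Ioi, setIntegral_congr_fun measurableSet_Ioi e,
    integral_const_mul, h.2]
  refine ⟨h.1.const_mul _, ?_⟩
  push_cast
  ring_nf

theorem isLaplacePair_driftGreen {β : ℝ} (hβ0 : 0 < β) (hβ1 : β < 1) (x : ℝ) :
    IsLaplacePair (fun t : ℝ => (driftGreen β x t : ℂ))
      (fun s : ℂ => if 0 < x then
        s ^ ((β : ℂ) - 1) * Complex.exp (-(x : ℂ) * s ^ (β : ℂ)) else 0) := by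
  intro s hs
  by_cases hx : 0 < x
  · have h := laplace_mWright hβ0 hβ1 hx.le hs
    have e : EqOn (fun t : ℝ => Complex.exp (-s * t) * (driftGreen β x t : ℂ))
        (fun t : ℝ => Complex.exp (-s * t) *
          ((t ^ (-β) * mWright β (x * t ^ (-β)) : ℝ) : ℂ)) (Ioi 0) := by
      intro t ht
      simp only
      rw [driftGreen, if_pos hx, Real.rpow_neg (le_of_lt ht), div_eq_mul_inv]
    rw [integrableOn_congr_fun e measurableSet_Ioi, setIntegral_congr_fun measurableSet_Ioi e]
    simpa only [if_pos hx, neg_mul] using h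
  · simp [driftGreen, if_neg hx]

/-! ### Fractional integrals -/

/-- The Euler Beta integral, rescaled to (0, t). -/
theorem integral_sub_rpow_mul_rpow {a b t : ℝ} (ha : 0 < a) (hb : 0 < b) (ht : 0 < t) :
    IntervalIntegrable (fun τ : ℝ => (t - τ) ^ (b - 1) * τ ^ (a - 1)) volume 0 t ∧
    ∫ τ in (0 : ℝ)..t, (t - τ) ^ (b - 1) * τ ^ (a - 1) =
      Real.Gamma a * Real.Gamma b / Real.Gamma (a + b) * t ^ (a + b - 1) := by
  have hc : ∫ τ in (0 : ℝ)..t, (t - τ) ^ (b - 1) * τ ^ (a - 1) =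
      Real.Gamma a * Real.Gamma b / Real.Gamma (a + b) * t ^ (a + b - 1) := by
    have h1 := Complex.betaIntegral_scaled a b ht
    have h2 := Complex.Gamma_mul_Gamma_eq_betaIntegral (s := a) (t := b) (by simpa) (by simpa)
    have hG : Complex.Gamma ((a : ℂ) + b) ≠ 0 := by
      rw [← Complex.ofReal_add, Complex.Gamma_ofReal]
      exact_mod_cast (Real.Gamma_pos_of_pos (add_pos ha hb)).ne'
    have h3 : Complex.betaIntegral a b =
        Complex.Gamma a * Complex.Gamma b / Complex.Gamma ((a : ℂ) + b) := by
      rw [h2]; field_simp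
    rw [h3] at h1
    apply Complex.ofReal_injective
    rw [← intervalIntegral.integral_ofReal]
    have e : ∫ τ in (0 : ℝ)..t, (((t - τ) ^ (b - 1) * τ ^ (a - 1) : ℝ) : ℂ) =
        ∫ x in (0 : ℝ)..t, (x : ℂ) ^ ((a : ℂ) - 1) * ((t : ℂ) - x) ^ ((b : ℂ) - 1) := by
      refine intervalIntegral.integral_congr fun τ hτ => ?_
      rw [uIcc_of_le ht.le] at hτ
      rw [Complex.ofReal_mul, Complex.ofReal_cpow hτ.1, Complex.ofReal_cpow (sub_nonneg.2 hτ.2)]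
      push_cast
      ring
    rw [e, h1]
    push_cast
    rw [Complex.ofReal_cpow ht.le, ← Complex.Gamma_ofReal, ← Complex.Gamma_ofReal,
      ← Complex.Gamma_ofReal]
    push_cast
    ring
  refine ⟨?_, hc⟩
  -- Integrability follows from the value: it is positive, whereas an undefined integral would be 0.
  refine not_imp_comm.1 intervalIntegral.integral_undef ?_
  rw [hc]
  have := Real.Gamma_pos_of_pos ha
  have := Real.Gamma_pos_of_pos hb
  have := Real.Gamma_pos_of_pos (add_pos ha hb)
  positivity

theorem integrableOn_sub_rpow_mul_rpow {a b t : ℝ} (ha : 0 < a) (hb : 0 < b) (ht : 0 < t) :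
    IntegrableOn (fun τ : ℝ => (t - τ) ^ (b - 1) * τ ^ (a - 1)) (Ioc 0 t) :=
  (intervalIntegrable_iff_integrableOn_Ioc_of_le ht.le).1 (integral_sub_rpow_mul_rpow ha hb ht).1

theorem integral_sub_rpow_mul_sub_rpow {β τ t : ℝ} (hβ0 : 0 < β) (hβ1 : β < 1) (h : τ < t) :
    IntegrableOn (fun ρ : ℝ => (t - ρ) ^ (β - 1) * (ρ - τ) ^ (1 - β - 1)) (Ioc τ t) ∧
    ∫ ρ in Ioc τ t, (t - ρ) ^ (β - 1) * (ρ - τ) ^ (1 - β - 1) =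
      Real.Gamma β * Real.Gamma (1 - β) := by
  have h1 := integral_sub_rpow_mul_rpow (sub_pos.2 hβ1) hβ0 (sub_pos.2 h)
  have h2 := h1.1.comp_sub_right τ
  have h3 := intervalIntegral.integral_comp_sub_right (a := τ) (b := t)
    (fun r : ℝ => (t - τ - r) ^ (β - 1) * r ^ (1 - β - 1)) τ
  rw [sub_self, h1.2] at h3
  simp only [zero_add, sub_add_cancel, sub_sub_sub_cancel_right] at h2 h3
  rw [intervalIntegrable_iff_integrableOn_Ioc_of_le h.le] at h2
  rw [intervalIntegral.integral_of_le h.le] at h3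
  refine ⟨h2, h3.trans ?_⟩
  rw [sub_self, Real.rpow_zero, Real.Gamma_one]
  ring

theorem norm_rlIntegral_integrand_le {μ a C T t : ℝ} {f : ℝ → ℝ} (ht : t ∈ Ioc 0 T)
    (hf : ∀ τ ∈ Ioc 0 T, |f τ| ≤ C * τ ^ (a - 1)) {τ : ℝ} (hτ : τ ∈ Ioc 0 t) :
    ‖(t - τ) ^ (μ - 1) * f τ‖ ≤ C * ((t - τ) ^ (μ - 1) * τ ^ (a - 1)) := by
  rw [norm_mul, Real.norm_eq_abs, Real.norm_eq_abs,
    abs_of_nonneg (Real.rpow_nonneg (sub_nonneg.2 hτ.2) _)]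
  have := mul_le_mul_of_nonneg_left (hf τ ⟨hτ.1, hτ.2.trans ht.2⟩)
    (Real.rpow_nonneg (sub_nonneg.2 hτ.2) (μ - 1))
  linarith

theorem abs_rlIntegral_le {μ a C T t : ℝ} {f : ℝ → ℝ} (hμ : 0 < μ) (ha : 0 < a) (ht : t ∈ Ioc 0 T)
    (hf : ∀ τ ∈ Ioc 0 T, |f τ| ≤ C * τ ^ (a - 1)) :
    |rlIntegral μ f t| ≤ C * Real.Gamma a / Real.Gamma (a + μ) * t ^ (a + μ - 1) := by
  have hG := Real.Gamma_pos_of_pos hμ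
  have h := integral_sub_rpow_mul_rpow ha hμ ht.1
  rw [rlIntegral, abs_mul, abs_of_pos (by positivity), intervalIntegral.integral_of_le ht.1.le,
    ← Real.norm_eq_abs]
  have h1 := norm_integral_le_of_norm_le
    ((integrableOn_sub_rpow_mul_rpow ha hμ ht.1).const_mul C)
    (f := fun τ => (t - τ) ^ (μ - 1) * f τ)
    ((ae_restrict_mem measurableSet_Ioc).mono fun τ hτ => norm_rlIntegral_integrand_le ht hf hτ)
  refine (mul_le_mul_of_nonneg_left h1 (by positivity)).trans_eq ?_
  rw [integral_const_mul, ← intervalIntegral.integral_of_le ht.1.le, h.2]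
  field_simp

theorem rlIntegrableAt_of_le {μ a C T t : ℝ} {f : ℝ → ℝ} (hμ : 0 < μ) (ha : 0 < a)
    (ht : t ∈ Ioc 0 T) (hfm : AEStronglyMeasurable f (volume.restrict (Ioc 0 t)))
    (hf : ∀ τ ∈ Ioc 0 T, |f τ| ≤ C * τ ^ (a - 1)) : RLIntegrableAt μ f t := by
  rw [RLIntegrableAt, intervalIntegrable_iff_integrableOn_Ioc_of_le ht.1.le]
  refine ((integrableOn_sub_rpow_mul_rpow ha hμ ht.1).const_mul C).mono' ?_ ?_
  · exact (Measurable.aestronglyMeasurable (by fun_prop)).mul hfm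
  · exact (ae_restrict_mem measurableSet_Ioc).mono fun τ hτ =>
      norm_rlIntegral_integrand_le ht hf hτ

theorem rlIntegral_eq_integral_Ioc_zero_one {μ t : ℝ} (f : ℝ → ℝ) (ht : 0 < t) :
    rlIntegral μ f t = 1 / Real.Gamma μ *
      (t ^ μ * ∫ r in Ioc (0 : ℝ) 1, (1 - r) ^ (μ - 1) * f (t * r)) := by
  rw [rlIntegral]
  congr 1
  have h := intervalIntegral.smul_integral_comp_mul_left (a := 0) (b := 1)
    (fun τ => (t - τ) ^ (μ - 1) * f τ) t
  rw [mul_zero, mul_one] at h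
  rw [← h, intervalIntegral.integral_of_le zero_le_one, smul_eq_mul, ← integral_const_mul,
    ← integral_const_mul]
  refine setIntegral_congr_fun measurableSet_Ioc fun r hr => ?_
  rw [show t - t * r = t * (1 - r) by ring, Real.mul_rpow ht.le (sub_nonneg.2 hr.2),
    Real.rpow_sub_one ht.ne']
  field_simp

/-- The substitution τ = t r moves t out of the limits and out of the singular weight; dominated
convergence applies with a Beta integrand as majorant. -/
theorem continuousOn_rlIntegral {μ a : ℝ} {f : ℝ → ℝ} (hμ : 0 < μ) (ha : 0 < a)
    (hfc : ContinuousOn f (Ioi 0))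
    (hf : ∀ T, ∃ C : ℝ, 0 ≤ C ∧ ∀ τ ∈ Ioc 0 T, |f τ| ≤ C * τ ^ (a - 1)) :
    ContinuousOn (rlIntegral μ f) (Ioi 0) := by
  have hcont : ContinuousOn (fun t : ℝ => ∫ r in Ioc (0 : ℝ) 1, (1 - r) ^ (μ - 1) * f (t * r))
      (Ioi 0) := by
    intro t₀ ht₀
    have ht₀ : 0 < t₀ := ht₀
    obtain ⟨C, hC0, hC⟩ := hf (2 * t₀)
    have hb : IntegrableOn (fun r : ℝ => C * ((t₀ / 2) ^ (a - 1) + (2 * t₀) ^ (a - 1)) *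
        ((1 - r) ^ (μ - 1) * r ^ (a - 1))) (Ioc 0 1) :=
      (integrableOn_sub_rpow_mul_rpow ha hμ one_pos).const_mul _
    refine ContinuousAt.continuousWithinAt (continuousAt_of_dominated ?_ ?_ hb ?_)
    · filter_upwards [Ioi_mem_nhds ht₀] with t ht
      refine (Measurable.aestronglyMeasurable (by fun_prop)).mul ?_
      refine ContinuousOn.aestronglyMeasurable ?_ measurableSet_Ioc
      exact hfc.comp (by fun_prop) fun r hr => mul_pos ht hr.1
    · filter_upwards [Ioo_mem_nhds (half_lt_self ht₀) (by linarith : t₀ < 2 * t₀)] with t ht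
      filter_upwards [ae_restrict_mem measurableSet_Ioc] with r hr
      have ht0 : 0 < t := lt_trans (by linarith) ht.1
      have h1r : 0 ≤ (1 - r) ^ (μ - 1) := Real.rpow_nonneg (sub_nonneg.2 hr.2) _
      have h1 : |f (t * r)| ≤ C * (t * r) ^ (a - 1) :=
        hC _ ⟨mul_pos ht0 hr.1, by nlinarith [ht.2, hr.2, hr.1]⟩
      have h2 : t ^ (a - 1) ≤ (t₀ / 2) ^ (a - 1) + (2 * t₀) ^ (a - 1) := by
        rcases le_total (a - 1) 0 with h | h
        · have := Real.rpow_le_rpow_of_nonpos (by linarith : 0 < t₀ / 2) ht.1.le h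
          have : 0 ≤ (2 * t₀) ^ (a - 1) := by positivity
          linarith
        · have := Real.rpow_le_rpow ht0.le ht.2.le h
          have : 0 ≤ (t₀ / 2) ^ (a - 1) := by positivity
          linarith
      rw [Real.mul_rpow ht0.le hr.1.le] at h1
      have h3 : 0 ≤ r ^ (a - 1) := Real.rpow_nonneg hr.1.le _
      rw [norm_mul, Real.norm_of_nonneg h1r, Real.norm_eq_abs]
      calc (1 - r) ^ (μ - 1) * |f (t * r)|
          ≤ (1 - r) ^ (μ - 1) * (C * (((t₀ / 2) ^ (a - 1) + (2 * t₀) ^ (a - 1)) * r ^ (a - 1))) := by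
            refine mul_le_mul_of_nonneg_left (h1.trans ?_) h1r
            gcongr
        _ = _ := by ring
    · filter_upwards [ae_restrict_mem measurableSet_Ioc] with r hr
      have hat : ContinuousAt f (t₀ * r) := hfc.continuousAt (Ioi_mem_nhds (mul_pos ht₀ hr.1))
      exact continuousAt_const.mul (ContinuousAt.comp (f := fun t => t * r) hat (by fun_prop))
  have h2 : ContinuousOn (fun t : ℝ => 1 / Real.Gamma μ *
      (t ^ μ * ∫ r in Ioc (0 : ℝ) 1, (1 - r) ^ (μ - 1) * f (t * r))) (Ioi 0) :=
    continuousOn_const.mul ((Real.continuous_rpow_const hμ.le).continuousOn.mul hcont)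
  exact h2.congr fun t ht => rlIntegral_eq_integral_Ioc_zero_one f ht

/-- `J^β J^{1-β} = J^1` on integrable functions. -/
theorem hasRLIntegralAt_rlIntegral_one_sub {β t : ℝ} {q : ℝ → ℝ} (hβ0 : 0 < β) (hβ1 : β < 1)
    (ht : 0 < t) (hq : IntegrableOn q (Ioc 0 t)) :
    HasRLIntegralAt β (rlIntegral (1 - β) q) (∫ τ in (0 : ℝ)..t, q τ) t := by
  have hG := Real.Gamma_pos_of_pos hβ0
  have hG1 := Real.Gamma_pos_of_pos (sub_pos.2 hβ1)
  let S := volume.restrict (Ioc 0 t)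
  -- The composed kernel is extended by zero outside τ < ρ, so that Fubini can be used on the
  -- square. Its ρ-integral is the constant Γ(β)Γ(1 - β).
  let k : ℝ → ℝ → ℝ := fun ρ τ => (Ioi τ).indicator
    (fun ρ => (t - ρ) ^ (β - 1) * (ρ - τ) ^ (1 - β - 1)) ρ
  have hkm : Measurable (Function.uncurry k) := by
    have e : Function.uncurry k = {p : ℝ × ℝ | p.2 < p.1}.indicator
        (fun p => (t - p.1) ^ (β - 1) * (p.1 - p.2) ^ (1 - β - 1)) := by
      funext p
      simp [k, indicator, Function.uncurry]
    rw [e]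
    exact Measurable.indicator (by fun_prop) (measurableSet_lt measurable_snd measurable_fst)
  have hksec : ∀ τ ∈ Ioo 0 t, Integrable (fun ρ => k ρ τ) S ∧
      ∫ ρ, k ρ τ ∂S = Real.Gamma β * Real.Gamma (1 - β) := by
    intro τ hτ
    have h := integral_sub_rpow_mul_sub_rpow hβ0 hβ1 hτ.2
    have hset : Ioc 0 t ∩ Ioi τ = Ioc τ t := by
      ext ρ
      simp only [mem_inter_iff, mem_Ioc, mem_Ioi]
      constructor
      · rintro ⟨⟨h1, h2⟩, h3⟩; exact ⟨h3, h2⟩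
      · rintro ⟨h1, h2⟩; exact ⟨⟨hτ.1.trans h1, h2⟩, h1⟩
    constructor
    · rw [integrable_indicator_iff measurableSet_Ioi, IntegrableOn,
        Measure.restrict_restrict measurableSet_Ioi, inter_comm, hset]
      exact h.1
    · simp only [k, S]
      rw [setIntegral_indicator measurableSet_Ioi, hset]
      exact h.2
  have hk0 : ∀ ρ ∈ Ioc 0 t, ∀ τ, 0 ≤ k ρ τ := by
    intro ρ hρ τ
    refine indicator_apply_nonneg fun h => ?_
    exact mul_nonneg (Real.rpow_nonneg (sub_nonneg.2 hρ.2) _)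
      (Real.rpow_nonneg (sub_nonneg.2 (le_of_lt h)) _)
  let f : ℝ → ℝ → ℝ := fun ρ τ => k ρ τ * q τ
  -- The endpoint τ = t, where the ρ-interval is empty, is negligible.
  have hIoo : ∀ᵐ τ ∂S, τ ∈ Ioo 0 t := by
    rw [show S = volume.restrict (Ioo 0 t) from Measure.restrict_congr_set Ioo_ae_eq_Ioc.symm]
    exact ae_restrict_mem measurableSet_Ioo
  have hfm : AEStronglyMeasurable (Function.uncurry f) (S.prod S) :=
    hkm.aestronglyMeasurable.mul hq.1.comp_snd
  have hint : Integrable (Function.uncurry f) (S.prod S) := by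
    rw [integrable_prod_iff' hfm]
    constructor
    · filter_upwards [hIoo] with τ hτ
      simp only [Function.uncurry_apply_pair, f]
      exact (hksec τ hτ).1.mul_const _
    · refine Integrable.congr (hq.norm.const_mul (Real.Gamma β * Real.Gamma (1 - β))) ?_
      filter_upwards [hIoo] with τ hτ
      rw [← (hksec τ hτ).2, ← integral_mul_const]
      refine setIntegral_congr_fun measurableSet_Ioc fun ρ hρ => ?_
      simp only [Function.uncurry_apply_pair, f]
      rw [norm_mul, Real.norm_of_nonneg (hk0 ρ hρ τ)]
  have hinner : ∀ ρ ∈ Ioc 0 t, (t - ρ) ^ (β - 1) * rlIntegral (1 - β) q ρ =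
      1 / Real.Gamma (1 - β) * ∫ τ, f ρ τ ∂S := by
    intro ρ hρ
    rw [rlIntegral, intervalIntegral.integral_of_le hρ.1.le, mul_left_comm]
    congr 1
    rw [← integral_const_mul, integral_Ioc_eq_integral_Ioo]
    have hset : Ioc 0 t ∩ Iio ρ = Ioo 0 ρ := by
      ext τ
      simp only [mem_inter_iff, mem_Ioc, mem_Iio, mem_Ioo]
      constructor
      · rintro ⟨⟨h1, h2⟩, h3⟩; exact ⟨h1, h3⟩
      · rintro ⟨h1, h2⟩; exact ⟨⟨h1, h2.le.trans hρ.2⟩, h2⟩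
    rw [← hset, ← setIntegral_indicator measurableSet_Iio]
    refine integral_congr_ae (Eventually.of_forall fun τ => ?_)
    by_cases h : τ < ρ
    · simp only [f, k, indicator_of_mem (show τ ∈ Iio ρ from h),
        indicator_of_mem (show ρ ∈ Ioi τ from h)]
      ring
    · simp only [f, k, indicator_of_notMem (show τ ∉ Iio ρ from h),
        indicator_of_notMem (show ρ ∉ Ioi τ from h), zero_mul]
  constructor
  · rw [RLIntegrableAt, intervalIntegrable_iff_integrableOn_Ioc_of_le ht.le,
      integrableOn_congr_fun hinner measurableSet_Ioc]
    exact hint.integral_prod_left.const_mul _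
  · rw [rlIntegral, intervalIntegral.integral_of_le ht.le,
      setIntegral_congr_fun measurableSet_Ioc hinner, integral_const_mul,
      integral_integral_swap hint]
    have : ∫ τ, ∫ ρ, f ρ τ ∂S ∂S = Real.Gamma β * Real.Gamma (1 - β) * ∫ τ, q τ ∂S := by
      rw [← integral_const_mul]
      refine integral_congr_ae ?_
      filter_upwards [hIoo] with τ hτ
      simp only [f]
      rw [integral_mul_const, (hksec τ hτ).2]
    rw [this, intervalIntegral.integral_of_le ht.le]
    field_simp
    rfl

theorem rlIntegral_congr {μ t : ℝ} {f g : ℝ → ℝ} (ht : 0 < t) (h : ∀ τ ∈ Ioc 0 t, f τ = g τ) :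
    rlIntegral μ f t = rlIntegral μ g t := by
  rw [rlIntegral, rlIntegral, intervalIntegral.integral_of_le ht.le,
    intervalIntegral.integral_of_le ht.le]
  congr 1
  exact setIntegral_congr_fun measurableSet_Ioc fun τ hτ => by simp only [h τ hτ]

theorem HasRLIntegralAt.congr {μ t v : ℝ} {f g : ℝ → ℝ} (ht : 0 < t)
    (hf : HasRLIntegralAt μ f v t) (h : ∀ τ ∈ Ioc 0 t, f τ = g τ) : HasRLIntegralAt μ g v t := by
  refine ⟨?_, (rlIntegral_congr ht h) ▸ hf.2⟩
  have := hf.1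
  rw [RLIntegrableAt, intervalIntegrable_iff_integrableOn_Ioc_of_le ht.le] at this ⊢
  exact this.congr_fun (fun τ hτ => by simp only [h τ hτ]) measurableSet_Ioc

/-- For μ < 1 the inverse weight (t - τ)^{1-μ} is continuous, so multiplying by it preserves
integrability. -/
theorem RLIntegrableAt.integrableOn {μ t : ℝ} {q : ℝ → ℝ} (hμ : μ < 1) (ht : 0 < t)
    (h : RLIntegrableAt μ q t) : IntegrableOn q (Ioc 0 t) := by
  have h1 : IntervalIntegrable (fun τ => (t - τ) ^ (1 - μ) * ((t - τ) ^ (μ - 1) * q τ)) volume 0 t := by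
    refine IntervalIntegrable.continuousOn_mul h (Continuous.continuousOn ?_)
    exact (Real.continuous_rpow_const (by linarith)).comp (by fun_prop)
  rw [intervalIntegrable_iff_integrableOn_Ioc_of_le ht.le,
    integrableOn_Ioc_iff_integrableOn_Ioo] at h1
  rw [integrableOn_Ioc_iff_integrableOn_Ioo]
  refine h1.congr_fun (fun τ hτ => ?_) measurableSet_Ioo
  simp only
  rw [← mul_assoc, ← Real.rpow_add (sub_pos.2 hτ.2), show 1 - μ + (μ - 1) = 0 by ring,
    Real.rpow_zero, one_mul]

/-- A function with a Caputo derivative `v` is the fractional integral of `v` plus its initial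
value. -/
theorem hasRLIntegralAt_of_hasCaputoDerivAt {β f₀ : ℝ} {f v : ℝ → ℝ} (hβ0 : 0 < β) (hβ1 : β < 1)
    (h : ∀ t, 0 < t → HasCaputoDerivAt β f (v t) t) (hf₀ : Tendsto f (𝓝[>] 0) (𝓝 f₀))
    {t : ℝ} (ht : 0 < t) : HasRLIntegralAt β v (f t - f₀) t := by
  -- A Caputo derivative at a time gives differentiability only strictly before it, hence the later
  -- time τ + 1.
  have hd : ∀ τ, 0 < τ → HasDerivAt f (deriv f τ) τ := fun τ hτ =>
    ((h (τ + 1) (by linarith)).1 τ ⟨hτ, by linarith⟩).hasDerivAt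
  have hq : IntegrableOn (deriv f) (Ioc 0 t) :=
    (h t ht).2.1.integrableOn (by linarith) ht
  have hFTC : ∫ τ in (0 : ℝ)..t, deriv f τ = f t - f₀ :=
    intervalIntegral.integral_eq_sub_of_hasDerivAt_of_tendsto ht (fun τ hτ => hd τ hτ.1)
      ((intervalIntegrable_iff_integrableOn_Ioc_of_le ht.le).2 hq) hf₀
      ((hd t ht).continuousAt.tendsto.mono_left nhdsWithin_le_nhds)
  rw [← hFTC]
  exact (hasRLIntegralAt_rlIntegral_one_sub hβ0 hβ1 ht hq).congr ht
    fun τ hτ => (h τ hτ.1).2.2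

theorem HasRLIntegralAt.sub {μ t v w : ℝ} {f g : ℝ → ℝ} (hf : HasRLIntegralAt μ f v t)
    (hg : HasRLIntegralAt μ g w t) : HasRLIntegralAt μ (fun τ => f τ - g τ) (v - w) t := by
  refine ⟨?_, ?_⟩
  · simp only [RLIntegrableAt, mul_sub]
    exact IntervalIntegrable.sub hf.1 hg.1
  · rw [← hf.2, ← hg.2, rlIntegral, rlIntegral, rlIntegral, ← mul_sub,
      ← intervalIntegral.integral_sub hf.1 hg.1]
    simp only [mul_sub]

theorem HasRLIntegralAt.const_mul {μ t v : ℝ} {f : ℝ → ℝ} (hf : HasRLIntegralAt μ f v t) (c : ℝ) :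
    HasRLIntegralAt μ (fun τ => c * f τ) (c * v) t := by
  have e : ∀ τ, (t - τ) ^ (μ - 1) * (c * f τ) = c * ((t - τ) ^ (μ - 1) * f τ) :=
    fun τ => mul_left_comm _ _ _
  refine ⟨?_, ?_⟩
  · simp only [RLIntegrableAt, e]
    exact IntervalIntegrable.const_mul hf.1 c
  · simp only [rlIntegral, e]
    rw [intervalIntegral.integral_const_mul, ← hf.2, rlIntegral]
    ring

/-- Put D = J^{1-β} f' - v. Then J^β D = 0, since J^β J^{1-β} f' = f - f₀; applying J^{1-β} gives
J^1 D = 0, and D, being continuous, vanishes. The hypotheses on f' serve the existence and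
continuity of J^{1-β} f'. -/
theorem hasCaputoDerivAt_of_hasRLIntegralAt {β f₀ : ℝ} {f v : ℝ → ℝ} (hβ0 : 0 < β) (hβ1 : β < 1)
    (hd : ∀ t, 0 < t → DifferentiableAt ℝ f t) (hqc : ContinuousOn (deriv f) (Ioi 0))
    (hq : ∀ T, ∃ C : ℝ, 0 ≤ C ∧ ∀ τ ∈ Ioc 0 T, |deriv f τ| ≤ C * τ ^ (β - 1))
    (hf₀ : Tendsto f (𝓝[>] 0) (𝓝 f₀)) (hvc : ContinuousOn v (Ioi 0))
    (h : ∀ t, 0 < t → HasRLIntegralAt β v (f t - f₀) t) {t : ℝ} (ht : 0 < t) :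
    HasCaputoDerivAt β f (v t) t := by
  set q := deriv f with hqdef
  have h1β : 0 < 1 - β := sub_pos.2 hβ1
  have hqI : ∀ t, 0 < t → RLIntegrableAt (1 - β) q t := by
    intro t ht
    obtain ⟨C, -, hC⟩ := hq t
    exact rlIntegrableAt_of_le h1β hβ0 ⟨ht, le_rfl⟩
      ((hqc.mono fun τ hτ => hτ.1).aestronglyMeasurable measurableSet_Ioc) hC
  have hFTC : ∀ t, 0 < t → ∫ τ in (0 : ℝ)..t, q τ = f t - f₀ := fun t ht =>
    intervalIntegral.integral_eq_sub_of_hasDerivAt_of_tendsto ht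
      (fun τ hτ => (hd τ hτ.1).hasDerivAt)
      ((intervalIntegrable_iff_integrableOn_Ioc_of_le ht.le).2
        ((hqI t ht).integrableOn (by linarith) ht)) hf₀
      ((hd t ht).continuousAt.tendsto.mono_left nhdsWithin_le_nhds)
  let D : ℝ → ℝ := fun τ => rlIntegral (1 - β) q τ - v τ
  have hD : ∀ t, 0 < t → HasRLIntegralAt β D 0 t := by
    intro t ht
    have h1 := hasRLIntegralAt_rlIntegral_one_sub hβ0 hβ1 ht
      ((hqI t ht).integrableOn (by linarith) ht)
    rw [hFTC t ht] at h1
    simpa using h1.sub (h t ht)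
  have hDI : ∀ t, 0 < t → IntegrableOn D (Ioc 0 t) := fun t ht =>
    (hD t ht).1.integrableOn hβ1 ht
  have hDc : ContinuousOn D (Ioi 0) := (continuousOn_rlIntegral h1β hβ0 hqc hq).sub hvc
  have hD0 : ∀ t, 0 < t → ∫ τ in (0 : ℝ)..t, D τ = 0 := by
    intro t ht
    -- The composition rule is used with 1 - β in the role of β, that is, J^{1-β} J^β = J^1.
    have h1 := (hasRLIntegralAt_rlIntegral_one_sub h1β (by linarith) ht (hDI t ht)).2
    rw [sub_sub_cancel] at h1
    rw [← h1, rlIntegral_congr (g := fun _ => 0) ht fun τ hτ => (hD τ hτ.1).2]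
    simp [rlIntegral]
  have hDt : D t = 0 := by
    have h1 := intervalIntegral.integral_hasDerivAt_right
      ((intervalIntegrable_iff_integrableOn_Ioc_of_le ht.le).2 (hDI t ht))
      (hDc.stronglyMeasurableAtFilter isOpen_Ioi t ht) (hDc.continuousAt (Ioi_mem_nhds ht))
    refine h1.unique ((hasDerivAt_const t (0 : ℝ)).congr_of_eventuallyEq ?_)
    filter_upwards [Ioi_mem_nhds ht] with τ hτ using hD0 τ hτ
  exact ⟨fun τ hτ => hd τ hτ.1, hqI t ht, sub_eq_zero.1 hDt⟩

theorem tendsto_rlIntegral_zero {μ C : ℝ} {f : ℝ → ℝ} (hμ : 0 < μ)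
    (hf : ∀ τ ∈ Ioc (0 : ℝ) 1, |f τ| ≤ C) : Tendsto (rlIntegral μ f) (𝓝[>] 0) (𝓝 0) := by
  have hb : ∀ t ∈ Ioc (0 : ℝ) 1, |rlIntegral μ f t| ≤
      C * Real.Gamma 1 / Real.Gamma (1 + μ) * t ^ μ := by
    intro t ht
    have := abs_rlIntegral_le hμ one_pos ht (C := C) (f := f) (fun τ hτ => by simpa using hf τ hτ)
    rwa [add_sub_cancel_left] at this
  have hlim : Tendsto (fun t : ℝ => C * Real.Gamma 1 / Real.Gamma (1 + μ) * t ^ μ) (𝓝[>] 0)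
      (𝓝 0) := by
    have : Continuous fun t : ℝ => C * Real.Gamma 1 / Real.Gamma (1 + μ) * t ^ μ :=
      continuous_const.mul (Real.continuous_rpow_const hμ.le)
    have h := this.tendsto 0
    rw [Real.zero_rpow hμ.ne', mul_zero] at h
    exact h.mono_left nhdsWithin_le_nhds
  refine squeeze_zero_norm' ?_ hlim
  filter_upwards [Ioc_mem_nhdsGT (zero_lt_one (α := ℝ))] with t ht using hb t ht

/-- If `f' = K D^{1-β} g` with `g` bounded near the origin, then `f = f(0⁺) + K J^β g`. -/
theorem hasRLIntegralAt_of_hasRLDerivAt {β K C f₀ : ℝ} {f g : ℝ → ℝ} (hβ0 : 0 < β)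
    (h : ∀ t, 0 < t → ∃ v, HasRLDerivAt (1 - β) g v t ∧ HasDerivAt f (K * v) t)
    (hf₀ : Tendsto f (𝓝[>] 0) (𝓝 f₀)) (hg : ∀ τ ∈ Ioc (0 : ℝ) 1, |g τ| ≤ C) {t : ℝ} (ht : 0 < t) :
    ∃ v, HasRLIntegralAt β g v t ∧ f t = f₀ + K * v := by
  simp only [HasRLDerivAt, sub_sub_cancel] at h
  obtain ⟨v, hv, -⟩ := h t ht
  refine ⟨rlIntegral β g t, ⟨hv.1.self_of_nhds, rfl⟩, ?_⟩
  -- F has zero derivative on the half-line, hence is constant; its limit at 0⁺ is f₀ because J^β of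
  -- a bounded function tends to 0.
  let F : ℝ → ℝ := fun t => f t - K * rlIntegral β g t
  have hF : ∀ t, 0 < t → HasDerivAt F 0 t := by
    intro t ht
    obtain ⟨v, hv, hv2⟩ := h t ht
    have h1 := hv2.sub (hv.2.const_mul K)
    rwa [sub_self] at h1
  have hconst : ∀ τ ∈ Ioi (0 : ℝ), F τ = F t := fun τ hτ =>
    isOpen_Ioi.is_const_of_deriv_eq_zero isPreconnected_Ioi
      (fun x hx => (hF x hx).differentiableAt.differentiableWithinAt) (fun x hx => (hF x hx).deriv)
      hτ ht
  have hlim : Tendsto F (𝓝[>] 0) (𝓝 f₀) := by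
    simpa using hf₀.sub ((tendsto_rlIntegral_zero hβ0 hg).const_mul K)
  have hFt : F t = f₀ := by
    refine tendsto_nhds_unique (tendsto_const_nhds.congr' ?_) hlim
    filter_upwards [self_mem_nhdsWithin] with τ hτ using (hconst τ hτ).symm
  simp only [F] at hFt
  linarith

/-! ### Uniqueness of mild solutions -/

/-- The spatial operator `a φ' + K φ''` applied to a test function. -/
noncomputable def testOperator (a K : ℝ) (φ : ℝ → ℝ) (x : ℝ) : ℝ :=
  a * deriv φ x + K * deriv (deriv φ) x

/-- `u = δ + J^β A u`, tested against `φ`, where `A` is dual to `testOperator a K`. -/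
def IsMildSolution (β a K : ℝ) (u : ℝ → ℝ → ℝ) : Prop :=
  ∀ φ, IsTestFunction φ → ∀ t, 0 < t →
    HasRLIntegralAt β (pairing u (testOperator a K φ)) (pairing u φ t - φ 0) t

/-- With r = t - τ, J^β e^{lτ} is e^{lt} times part of the integral ∫ r^{β-1} e^{-lr} dr / Γ(β) =
l^{-β}. In the norm weighted by e^{-lt} the operator J^β is therefore small for large l. -/
theorem abs_rlIntegral_le_exp {β B l t : ℝ} {h : ℝ → ℝ} (hβ : 0 < β) (hB : 0 ≤ B) (hl : 0 < l)
    (ht : 0 < t) (hh : ∀ τ ∈ Ioc 0 t, |h τ| ≤ B * Real.exp (l * τ)) :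
    |rlIntegral β h t| ≤ B * (l ^ (-β) * Real.exp (l * t)) := by
  have hG := Real.Gamma_pos_of_pos hβ
  have hfull := Real.integral_rpow_mul_exp_neg_mul_Ioi hβ hl
  have hfullI : IntegrableOn (fun r : ℝ => r ^ (β - 1) * Real.exp (-(l * r))) (Ioi 0) := by
    simpa only [neg_mul] using integrableOn_rpow_mul_exp_neg hβ hl
  have hI : IntervalIntegrable (fun r : ℝ => r ^ (β - 1) * Real.exp (-(l * r))) volume 0 t :=
    (intervalIntegrable_iff_integrableOn_Ioc_of_le ht.le).2 (hfullI.mono_set Ioc_subset_Ioi_self)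
  have e : ∀ τ : ℝ, (t - τ) ^ (β - 1) * (B * Real.exp (l * τ)) = B * Real.exp (l * t) *
      ((t - τ) ^ (β - 1) * Real.exp (-(l * (t - τ)))) := by
    intro τ
    rw [show l * τ = l * t + -(l * (t - τ)) by ring, Real.exp_add]
    ring
  have hI2 : IntegrableOn (fun τ : ℝ => (t - τ) ^ (β - 1) * (B * Real.exp (l * τ))) (Ioc 0 t) := by
    simp only [e]
    have := (hI.comp_sub_left t).symm
    rw [sub_zero, sub_self] at this
    exact ((intervalIntegrable_iff_integrableOn_Ioc_of_le ht.le).1 this).const_mul _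
  have hval : ∫ τ in Ioc 0 t, (t - τ) ^ (β - 1) * (B * Real.exp (l * τ)) ≤
      B * Real.exp (l * t) * (l ^ (-β) * Real.Gamma β) := by
    simp only [e]
    rw [integral_const_mul]
    refine mul_le_mul_of_nonneg_left ?_ (by positivity)
    rw [← intervalIntegral.integral_of_le ht.le, intervalIntegral.integral_comp_sub_left
      (fun r : ℝ => r ^ (β - 1) * Real.exp (-(l * r))) t, sub_self, sub_zero,
      intervalIntegral.integral_of_le ht.le, Real.rpow_neg hl.le, ← Real.inv_rpow hl.le, ← one_div,
      ← hfull]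
    refine setIntegral_mono_set hfullI ?_ (LE.le.eventuallyLE Ioc_subset_Ioi_self)
    filter_upwards [ae_restrict_mem measurableSet_Ioi] with r hr
    have hr : 0 < r := hr
    simp only [Pi.zero_apply]
    positivity
  rw [rlIntegral, abs_mul, abs_of_pos (by positivity), intervalIntegral.integral_of_le ht.le,
    ← Real.norm_eq_abs]
  have h1 := norm_integral_le_of_norm_le hI2 (f := fun τ => (t - τ) ^ (β - 1) * h τ)
    ((ae_restrict_mem measurableSet_Ioc).mono fun τ hτ => by
      rw [norm_mul, Real.norm_of_nonneg (Real.rpow_nonneg (sub_nonneg.2 hτ.2) _)]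
      exact mul_le_mul_of_nonneg_left (hh τ hτ) (Real.rpow_nonneg (sub_nonneg.2 hτ.2) _))
  refine (mul_le_mul_of_nonneg_left (h1.trans hval) (by positivity)).trans_eq ?_
  field_simp

/-- A Gronwall lemma for fractional integrals. -/
theorem eq_zero_of_eq_rlIntegral {β T L C : ℝ} {f g f₁ g₁ : ℝ → ℝ} (hβ : 0 < β) (hL : 0 ≤ L)
    (hC : 0 ≤ C) (hS : ∀ t ∈ Ioc 0 T, |f t| + |g t| ≤ C)
    (hf : ∀ t ∈ Ioc 0 T, f t = rlIntegral β f₁ t) (hg : ∀ t ∈ Ioc 0 T, g t = rlIntegral β g₁ t)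
    (hf₁ : ∀ t ∈ Ioc 0 T, |f₁ t| ≤ L * (|f t| + |g t|))
    (hg₁ : ∀ t ∈ Ioc 0 T, |g₁ t| ≤ L * (|f t| + |g t|)) {t : ℝ} (ht : t ∈ Ioc 0 T) :
    f t = 0 ∧ g t = 0 := by
  -- Then L l^{-β} ≤ 1/4, and the two equations together halve the bound at each iteration.
  set l := (4 * L + 1) ^ (1 / β) with hl
  have hl0 : 0 < l := by positivity
  have hlβ : L * l ^ (-β) ≤ 1 / 4 := by
    rw [hl, ← Real.rpow_mul (by positivity), show 1 / β * -β = -1 by field_simp,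
      Real.rpow_neg_one, ← div_eq_mul_inv, div_le_div_iff₀ (by positivity) (by norm_num)]
    linarith
  have key : ∀ n : ℕ, ∀ t ∈ Ioc 0 T, |f t| + |g t| ≤ C * (1 / 2) ^ n * Real.exp (l * t) := by
    intro n
    induction n with
    | zero =>
      intro t ht
      rw [pow_zero, mul_one]
      refine (hS t ht).trans (le_mul_of_one_le_right hC (Real.one_le_exp ?_))
      have := ht.1
      positivity
    | succ n ih =>
      intro t ht
      have hb : ∀ h : ℝ → ℝ, (∀ t ∈ Ioc 0 T, |h t| ≤ L * (|f t| + |g t|)) →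
          |rlIntegral β h t| ≤ C * (1 / 2) ^ n * Real.exp (l * t) * (1 / 4) := by
        intro h hh
        have h1 := abs_rlIntegral_le_exp (B := L * (C * (1 / 2) ^ n)) hβ (by positivity) hl0 ht.1
          (h := h) (fun τ hτ => by
            have hτT : τ ∈ Ioc 0 T := ⟨hτ.1, hτ.2.trans ht.2⟩
            rw [mul_assoc]
            exact (hh τ hτT).trans (mul_le_mul_of_nonneg_left (ih τ hτT) hL))
        refine h1.trans ?_
        have := mul_le_mul_of_nonneg_left hlβ
          (by positivity : 0 ≤ C * (1 / 2) ^ n * Real.exp (l * t))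
        linarith
      have h1 := hb f₁ hf₁
      have h2 := hb g₁ hg₁
      rw [← hf t ht] at h1
      rw [← hg t ht] at h2
      rw [pow_succ]
      linarith
  have hlim : Tendsto (fun n : ℕ => C * (1 / 2 : ℝ) ^ n * Real.exp (l * t)) atTop (𝓝 0) := by
    have := ((tendsto_pow_atTop_nhds_zero_of_lt_one (by norm_num : (0 : ℝ) ≤ 1 / 2)
      (by norm_num)).const_mul C).mul_const (Real.exp (l * t))
    simpa using this
  have h0 : |f t| + |g t| ≤ 0 := ge_of_tendsto' hlim fun n => key n t ht
  have := abs_nonneg (f t)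
  have := abs_nonneg (g t)
  exact ⟨abs_eq_zero.1 (by linarith), abs_eq_zero.1 (by linarith)⟩

/-! ### Pairings with bounded functions, and approximation by test functions -/

theorem abs_pairing_le {w : ℝ → ℝ → ℝ} {φ : ℝ → ℝ} {B t : ℝ} (hw : Integrable fun x => w x t)
    (hφ : ∀ x, |φ x| ≤ B) : |pairing w φ t| ≤ B * ∫ x, |w x t| := by
  rw [pairing, ← Real.norm_eq_abs, ← integral_const_mul]
  refine norm_integral_le_of_norm_le (hw.abs.const_mul B) (Eventually.of_forall fun x => ?_)
  rw [norm_mul, Real.norm_eq_abs, Real.norm_eq_abs, mul_comm]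
  exact mul_le_mul_of_nonneg_right (hφ x) (abs_nonneg _)

theorem integrable_mul_bounded {w φ : ℝ → ℝ} {B : ℝ} (hw : Integrable w) (hφc : Continuous φ)
    (hφ : ∀ x, |φ x| ≤ B) : Integrable fun x => w x * φ x :=
  hw.mul_bdd (c := B) hφc.aestronglyMeasurable (Eventually.of_forall hφ)

theorem tendsto_pairing {w : ℝ → ℝ → ℝ} {φ : ℕ → ℝ → ℝ} {ψ : ℝ → ℝ} {B t : ℝ}
    (hw : Integrable fun x => w x t) (hφc : ∀ n, Continuous (φ n)) (hφ : ∀ n x, |φ n x| ≤ B)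
    (hlim : ∀ x, ∀ᶠ n in atTop, φ n x = ψ x) :
    Tendsto (fun n => pairing w (φ n) t) atTop (𝓝 (pairing w ψ t)) := by
  refine tendsto_integral_of_dominated_convergence (fun x => |w x t| * B) (fun n => ?_)
    (hw.abs.mul_const B) (fun n => Eventually.of_forall fun x => ?_)
    (Eventually.of_forall fun x => ?_)
  · exact hw.1.mul (hφc n).aestronglyMeasurable
  · rw [norm_mul, Real.norm_eq_abs, Real.norm_eq_abs]
    exact mul_le_mul_of_nonneg_left (hφ n x) (abs_nonneg _)
  · exact tendsto_const_nhds.congr' ((hlim x).mono fun n hn => by simp only [hn])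

theorem exists_smooth_cutoff : ∃ χ χ₁ χ₂ : ℝ → ℝ, ∃ M : ℝ, 1 ≤ M ∧ ContDiff ℝ (⊤ : ℕ∞) χ ∧
    HasCompactSupport χ ∧ (∀ x, |x| ≤ 1 → χ x = 1) ∧ (∀ x, HasDerivAt χ (χ₁ x) x) ∧
    (∀ x, HasDerivAt χ₁ (χ₂ x) x) ∧ ∀ x, |χ x| ≤ M ∧ |χ₁ x| ≤ M ∧ |χ₂ x| ≤ M := by
  let b : ContDiffBump (0 : ℝ) := ⟨1, 2, one_pos, one_lt_two⟩
  have hb : ContDiff ℝ (⊤ : ℕ∞) b := b.contDiff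
  have hb1 : ContDiff ℝ (⊤ : ℕ∞) (deriv b) := (contDiff_infty_iff_deriv.1 hb).2
  have hb2 : ContDiff ℝ (⊤ : ℕ∞) (deriv (deriv b)) := (contDiff_infty_iff_deriv.1 hb1).2
  have hs : HasCompactSupport b := b.hasCompactSupport
  obtain ⟨M0, h0⟩ := hs.exists_bound_of_continuous hb.continuous
  obtain ⟨M1, h1⟩ := hs.deriv.exists_bound_of_continuous hb1.continuous
  obtain ⟨M2, h2⟩ := hs.deriv.deriv.exists_bound_of_continuous hb2.continuous
  refine ⟨b, deriv b, deriv (deriv b), max 1 (max M0 (max M1 M2)), le_max_left _ _, hb, hs,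
    fun x hx => b.one_of_mem_closedBall (by simpa using hx),
    fun x => (hb.differentiable (by simp) x).hasDerivAt,
    fun x => (hb1.differentiable (by simp) x).hasDerivAt, fun x => ⟨?_, ?_, ?_⟩⟩
  · exact (h0 x).trans (le_max_of_le_right (le_max_left _ _))
  · exact (h1 x).trans (le_max_of_le_right (le_max_of_le_right (le_max_left _ _)))
  · exact (h2 x).trans (le_max_of_le_right (le_max_of_le_right (le_max_right _ _)))

/-- A smooth function with bounded derivatives is a bounded limit of test functions. -/
theorem exists_seq_isTestFunction {ψ : ℝ → ℝ} {B : ℝ} (a K : ℝ) (hψ : ContDiff ℝ (⊤ : ℕ∞) ψ)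
    (hB0 : ∀ x, |ψ x| ≤ B) (hB1 : ∀ x, |deriv ψ x| ≤ B) (hB2 : ∀ x, |deriv (deriv ψ) x| ≤ B) :
    ∃ φ : ℕ → ℝ → ℝ, ∃ D : ℝ, (∀ n, IsTestFunction (φ n)) ∧ (∀ n x, |φ n x| ≤ D) ∧
      (∀ n x, |testOperator a K (φ n) x| ≤ D) ∧ (∀ x, ∀ᶠ n in atTop, φ n x = ψ x) ∧
      ∀ x, ∀ᶠ n in atTop, testOperator a K (φ n) x = testOperator a K ψ x := by
  obtain ⟨χ, χ₁, χ₂, M, hM, hχ, hχs, hχ1, hd1, hd2, hχb⟩ := exists_smooth_cutoff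
  have hB : 0 ≤ B := (abs_nonneg _).trans (hB0 0)
  have hψ1 : ContDiff ℝ (⊤ : ℕ∞) (deriv ψ) := (contDiff_infty_iff_deriv.1 hψ).2
  let c : ℕ → ℝ := fun n => 1 / ((n : ℝ) + 1)
  have hc0 : ∀ n, 0 < c n := fun n => by positivity
  have hc1 : ∀ n, c n ≤ 1 := fun n => by
    simp only [c]
    rw [div_le_one (by positivity)]
    linarith [(Nat.cast_nonneg n : (0 : ℝ) ≤ n)]
  let φ : ℕ → ℝ → ℝ := fun n x => ψ x * χ (c n * x)
  have hlin : ∀ n x, HasDerivAt (fun x => c n * x) (c n) x := fun n x => by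
    simpa using (hasDerivAt_id x).const_mul (c n)
  have hφ1 : ∀ n x, HasDerivAt (φ n) (deriv ψ x * χ (c n * x) + ψ x * (χ₁ (c n * x) * c n)) x :=
    fun n x => (hψ.differentiable (by simp) x).hasDerivAt.mul ((hd1 _).comp x (hlin n x))
  have hφ1' : ∀ n, deriv (φ n) = fun x => deriv ψ x * χ (c n * x) + ψ x * (χ₁ (c n * x) * c n) :=
    fun n => funext fun x => (hφ1 n x).deriv
  have hφ2 : ∀ n x, deriv (deriv (φ n)) x =
      deriv (deriv ψ) x * χ (c n * x) + deriv ψ x * (χ₁ (c n * x) * c n) +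
      (deriv ψ x * (χ₁ (c n * x) * c n) + ψ x * (χ₂ (c n * x) * c n * c n)) := by
    intro n x
    rw [hφ1' n]
    exact (((hψ1.differentiable (by simp) x).hasDerivAt.mul ((hd1 _).comp x (hlin n x))).add
      ((hψ.differentiable (by simp) x).hasDerivAt.mul
        (((hd2 _).comp x (hlin n x)).mul_const (c n)))).deriv
  have hbd : ∀ (p q r : ℝ), |p| ≤ B → |q| ≤ M → |r| ≤ 1 → |p * (q * r)| ≤ B * M := by
    intro p q r hp hq hr
    rw [abs_mul, abs_mul]
    have : |q| * |r| ≤ M * 1 := mul_le_mul hq hr (abs_nonneg _) (by linarith)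
    rw [mul_one] at this
    exact mul_le_mul hp this (by positivity) hB
  have habs : ∀ n, |c n| ≤ 1 := fun n => by rw [abs_of_pos (hc0 n)]; exact hc1 n
  have habs2 : ∀ n, |c n * c n| ≤ 1 := fun n => by
    rw [abs_mul]; exact mul_le_one₀ (habs n) (abs_nonneg _) (habs n)
  -- The cutoff equals 1 near x once |x| < n + 1. Equality on a neighbourhood, not just at x,
  -- carries over to the derivatives.
  have hev : ∀ x, ∀ᶠ n in atTop, ∀ᶠ y in 𝓝 x, φ n y = ψ y := by
    intro x
    have ht : Tendsto (fun n : ℕ => c n * x) atTop (𝓝 0) := by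
      have := (tendsto_one_div_add_atTop_nhds_zero_nat (𝕜 := ℝ)).mul_const x
      rwa [zero_mul] at this
    filter_upwards [ht.eventually (Metric.ball_mem_nhds 0 one_pos)] with n hn
    have hcont : ContinuousAt (fun y => c n * y) x := by fun_prop
    filter_upwards [hcont.eventually (Metric.isOpen_ball.mem_nhds hn)] with y hy
    have hy' : |c n * y| < 1 := by simpa using hy
    simp only [φ]
    rw [hχ1 _ hy'.le, mul_one]
  have hBM : 0 ≤ B * M := by positivity
  refine ⟨φ, B * M + (|a| * (B * M + B * M) + |K| * (B * M + B * M + (B * M + B * M))),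
    fun n => ⟨?_, ?_⟩, fun n x => ?_, fun n x => ?_, fun x => ?_, fun x => ?_⟩
  · exact hψ.mul (hχ.comp (contDiff_const.mul contDiff_id))
  · exact HasCompactSupport.mul_left (hχs.comp_homeomorph (Homeomorph.mulLeft₀ (c n) (hc0 n).ne'))
  · have h := hbd (ψ x) (χ (c n * x)) 1 (hB0 x) (hχb _).1 (by simp)
    rw [mul_one] at h
    have h2 : 0 ≤ |a| * (B * M + B * M) + |K| * (B * M + B * M + (B * M + B * M)) := by positivity
    simp only [φ]
    linarith
  · have hA : |deriv (φ n) x| ≤ B * M + B * M := by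
      rw [hφ1']
      have h := hbd (deriv ψ x) (χ (c n * x)) 1 (hB1 x) (hχb _).1 (by simp)
      rw [mul_one] at h
      exact (abs_add_le _ _).trans (add_le_add h (hbd _ _ _ (hB0 x) (hχb _).2.1 (habs n)))
    have hB : |deriv (deriv (φ n)) x| ≤ B * M + B * M + (B * M + B * M) := by
      rw [hφ2]
      have h := hbd (deriv (deriv ψ) x) (χ (c n * x)) 1 (hB2 x) (hχb _).1 (by simp)
      rw [mul_one] at h
      have h2 := hbd _ _ _ (hB1 x) (hχb (c n * x)).2.1 (habs n)
      have h3 := hbd _ _ _ (hB0 x) (hχb (c n * x)).2.2 (habs2 n)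
      rw [← mul_assoc (χ₂ _)] at h3
      exact (abs_add_le _ _).trans (add_le_add ((abs_add_le _ _).trans (add_le_add h h2))
        ((abs_add_le _ _).trans (add_le_add h2 h3)))
    rw [testOperator]
    refine (abs_add_le _ _).trans ?_
    rw [abs_mul, abs_mul]
    have h1 := mul_le_mul_of_nonneg_left hA (abs_nonneg a)
    have h2 := mul_le_mul_of_nonneg_left hB (abs_nonneg K)
    linarith
  · exact (hev x).mono fun n hn => hn.self_of_nhds
  · refine (hev x).mono fun n hn => ?_
    have h1 : deriv (φ n) =ᶠ[𝓝 x] deriv ψ := EventuallyEq.deriv hn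
    rw [testOperator, testOperator, h1.deriv_eq, h1.self_of_nhds]

theorem contDiff_testOperator {φ : ℝ → ℝ} (a K : ℝ) (hφ : ContDiff ℝ (⊤ : ℕ∞) φ) :
    ContDiff ℝ (⊤ : ℕ∞) (testOperator a K φ) := by
  have h1 : ContDiff ℝ (⊤ : ℕ∞) (deriv φ) := (contDiff_infty_iff_deriv.1 hφ).2
  have h2 : ContDiff ℝ (⊤ : ℕ∞) (deriv (deriv φ)) := (contDiff_infty_iff_deriv.1 h1).2
  exact (contDiff_const.mul h1).add (contDiff_const.mul h2)

/-- The mild formulation extends from test functions to smooth functions with bounded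
derivatives. -/
theorem pairing_eq_rlIntegral {β a K B C T : ℝ} {w : ℝ → ℝ → ℝ} {ψ : ℝ → ℝ} (hβ : 0 < β)
    (hw : ∀ t ∈ Ioc 0 T, Integrable fun x => w x t) (hwC : ∀ t ∈ Ioc 0 T, ∫ x, |w x t| ≤ C)
    (hsol : ∀ φ, IsTestFunction φ → ∀ t ∈ Ioc 0 T,
      HasRLIntegralAt β (pairing w (testOperator a K φ)) (pairing w φ t) t)
    (hψ : ContDiff ℝ (⊤ : ℕ∞) ψ) (hB0 : ∀ x, |ψ x| ≤ B) (hB1 : ∀ x, |deriv ψ x| ≤ B)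
    (hB2 : ∀ x, |deriv (deriv ψ) x| ≤ B) {t : ℝ} (ht : t ∈ Ioc 0 T) :
    pairing w ψ t = rlIntegral β (pairing w (testOperator a K ψ)) t := by
  obtain ⟨φ, D, hφ, hφD, hφD2, hl1, hl2⟩ := exists_seq_isTestFunction a K hψ hB0 hB1 hB2
  have hD : 0 ≤ D := (abs_nonneg _).trans (hφD 0 0)
  have h1 := tendsto_pairing (hw t ht) (fun n => (hφ n).1.continuous) hφD hl1
  have h2 : Tendsto (fun n => rlIntegral β (pairing w (testOperator a K (φ n))) t) atTop
      (𝓝 (rlIntegral β (pairing w (testOperator a K ψ)) t)) := by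
    simp only [rlIntegral, intervalIntegral.integral_of_le ht.1.le]
    refine Tendsto.const_mul _ (tendsto_integral_of_dominated_convergence
      -- The factor τ^{1-1} = 1 casts the constant bound in the form of the Beta estimates with a =
      -- 1.
      (fun τ => D * C * ((t - τ) ^ (β - 1) * τ ^ ((1 : ℝ) - 1))) (fun n => ?_)
      ((integrableOn_sub_rpow_mul_rpow one_pos hβ ht.1).const_mul _) (fun n => ?_) ?_)
    · exact ((intervalIntegrable_iff_integrableOn_Ioc_of_le ht.1.le).1 (hsol _ (hφ n) t ht).1).1
    · filter_upwards [ae_restrict_mem measurableSet_Ioc] with τ hτ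
      refine norm_rlIntegral_integrand_le ht (fun ρ hρ => ?_) hτ
      rw [sub_self, Real.rpow_zero, mul_one]
      exact (abs_pairing_le (hw ρ hρ) (hφD2 n)).trans
        (mul_le_mul_of_nonneg_left (hwC ρ hρ) hD)
    · filter_upwards [ae_restrict_mem measurableSet_Ioc] with τ hτ
      exact Tendsto.const_mul _ (tendsto_pairing (hw τ ⟨hτ.1, hτ.2.trans ht.2⟩)
        (fun n => (contDiff_testOperator a K (hφ n).1).continuous) hφD2 hl2)
  exact tendsto_nhds_unique h1 (h2.congr fun n => (hsol _ (hφ n) t ht).2)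

theorem pairing_sub {u₁ u₂ : ℝ → ℝ → ℝ} {φ : ℝ → ℝ} {B t : ℝ} (h₁ : Integrable fun x => u₁ x t)
    (h₂ : Integrable fun x => u₂ x t) (hφc : Continuous φ) (hφ : ∀ x, |φ x| ≤ B) :
    pairing (fun x t => u₁ x t - u₂ x t) φ t = pairing u₁ φ t - pairing u₂ φ t := by
  rw [pairing, pairing, pairing, ← integral_sub (integrable_mul_bounded h₁ hφc hφ)
    (integrable_mul_bounded h₂ hφc hφ)]
  simp only [sub_mul]

theorem IsTestFunction.testOperator {φ : ℝ → ℝ} (a K : ℝ) (hφ : IsTestFunction φ) :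
    IsTestFunction (testOperator a K φ) :=
  ⟨contDiff_testOperator a K hφ.1, HasCompactSupport.add (hφ.2.deriv.mul_left)
    (hφ.2.deriv.deriv.mul_left)⟩

theorem IsTestFunction.exists_bound {φ : ℝ → ℝ} (hφ : IsTestFunction φ) :
    ∃ B, ∀ x, |φ x| ≤ B :=
  hφ.2.exists_bound_of_continuous hφ.1.continuous

/-- For the difference w the initial terms cancel. Testing w against cos κx and sin κx, which
`testOperator` maps into their own span, gives a linear 2×2 system of fractional Volterra equations
with bounded solutions; the Gronwall lemma makes both zero. They are the real and imaginary parts of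
the Fourier transform of w. -/
theorem IsMildSolution.ae_eq {β a K : ℝ} {u₁ u₂ : ℝ → ℝ → ℝ} (hβ : 0 < β)
    (h₁ : StartsFromDelta u₁) (h₂ : StartsFromDelta u₂) (hs₁ : IsMildSolution β a K u₁)
    (hs₂ : IsMildSolution β a K u₂) {t : ℝ} (ht : 0 < t) :
    (fun x => u₁ x t) =ᵐ[volume] fun x => u₂ x t := by
  let w : ℝ → ℝ → ℝ := fun x t => u₁ x t - u₂ x t
  obtain ⟨C₁, hC₁⟩ := h₁.bounded t ht
  obtain ⟨C₂, hC₂⟩ := h₂.bounded t ht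
  have hw : ∀ τ ∈ Ioc 0 t, Integrable fun x => w x τ := fun τ hτ =>
    (h₁.integrable τ hτ.1).sub (h₂.integrable τ hτ.1)
  have hwC : ∀ τ ∈ Ioc 0 t, ∫ x, |w x τ| ≤ C₁ + C₂ := by
    intro τ hτ
    refine le_trans ?_ (add_le_add (hC₁ τ hτ) (hC₂ τ hτ))
    rw [← integral_add (h₁.integrable τ hτ.1).abs (h₂.integrable τ hτ.1).abs]
    exact integral_mono (hw τ hτ).abs ((h₁.integrable τ hτ.1).abs.add (h₂.integrable τ hτ.1).abs)
      fun x => abs_sub _ _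
  have hC0 : 0 ≤ C₁ + C₂ := (integral_nonneg fun _ => abs_nonneg _).trans (hwC t ⟨ht, le_rfl⟩)
  have hsol : ∀ φ, IsTestFunction φ → ∀ τ ∈ Ioc 0 t,
      HasRLIntegralAt β (pairing w (testOperator a K φ)) (pairing w φ τ) τ := by
    intro φ hφ τ hτ
    obtain ⟨B, hB⟩ := hφ.exists_bound
    obtain ⟨B', hB'⟩ := (hφ.testOperator a K).exists_bound
    have h := (hs₁ φ hφ τ hτ.1).sub (hs₂ φ hφ τ hτ.1)
    rw [sub_sub_sub_cancel_right, ← pairing_sub (h₁.integrable τ hτ.1) (h₂.integrable τ hτ.1)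
      hφ.1.continuous hB] at h
    exact h.congr hτ.1 fun ρ hρ => (pairing_sub (h₁.integrable ρ hρ.1) (h₂.integrable ρ hρ.1)
      (hφ.testOperator a K).1.continuous hB').symm
  have hzero : ∀ κ : ℝ, pairing w (fun x => Real.cos (κ * x)) t = 0 ∧
      pairing w (fun x => Real.sin (κ * x)) t = 0 := by
    intro κ
    have hlin : ∀ x : ℝ, HasDerivAt (fun x => κ * x) κ x := fun x => by
      simpa using (hasDerivAt_id x).const_mul κ
    have hdc : deriv (fun x => Real.cos (κ * x)) = fun x => -κ * Real.sin (κ * x) := by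
      funext x; rw [(hlin x).cos.deriv]; ring
    have hds : deriv (fun x => Real.sin (κ * x)) = fun x => κ * Real.cos (κ * x) := by
      funext x; rw [(hlin x).sin.deriv]; ring
    have hdc2 : deriv (deriv fun x => Real.cos (κ * x)) = fun x => -κ ^ 2 * Real.cos (κ * x) := by
      rw [hdc]; funext x; rw [((hlin x).sin.const_mul (-κ)).deriv]; ring
    have hds2 : deriv (deriv fun x => Real.sin (κ * x)) = fun x => -κ ^ 2 * Real.sin (κ * x) := by
      rw [hds]; funext x; rw [((hlin x).cos.const_mul κ).deriv]; ring
    have hcd : ContDiff ℝ (⊤ : ℕ∞) fun x => Real.cos (κ * x) :=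
      Real.contDiff_cos.comp (contDiff_const.mul contDiff_id)
    have hsd : ContDiff ℝ (⊤ : ℕ∞) fun x => Real.sin (κ * x) :=
      Real.contDiff_sin.comp (contDiff_const.mul contDiff_id)
    have hcb := fun x => Real.abs_cos_le_one (κ * x)
    have hsb := fun x => Real.abs_sin_le_one (κ * x)
    have hbd : ∀ c r : ℝ, |r| ≤ 1 → |c * r| ≤ |c| := fun c r hr => by
      rw [abs_mul]; exact mul_le_of_le_one_right (abs_nonneg _) hr
    have hκ := abs_nonneg κ
    have hκ2 : |-κ ^ 2| = κ ^ 2 := by rw [abs_neg, abs_of_nonneg (sq_nonneg κ)]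
    have hκ3 := sq_nonneg κ
    have hc := fun τ hτ => pairing_eq_rlIntegral (a := a) (K := K) (B := 1 + |κ| + κ ^ 2) (t := τ)
      hβ hw hwC hsol hcd (fun x => (hcb x).trans (by linarith))
      (fun x => by rw [hdc]; exact (hbd _ _ (hsb x)).trans (by rw [abs_neg]; linarith))
      (fun x => by rw [hdc2]; exact (hbd _ _ (hcb x)).trans (by rw [hκ2]; linarith)) hτ
    have hs := fun τ hτ => pairing_eq_rlIntegral (a := a) (K := K) (B := 1 + |κ| + κ ^ 2) (t := τ)
      hβ hw hwC hsol hsd (fun x => (hsb x).trans (by linarith))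
      (fun x => by rw [hds]; exact (hbd _ _ (hcb x)).trans (by linarith))
      (fun x => by rw [hds2]; exact (hbd _ _ (hsb x)).trans (by rw [hκ2]; linarith)) hτ
    have hci : ∀ τ ∈ Ioc 0 t, Integrable fun x => w x τ * Real.cos (κ * x) := fun τ hτ =>
      integrable_mul_bounded (hw τ hτ) hcd.continuous hcb
    have hsi : ∀ τ ∈ Ioc 0 t, Integrable fun x => w x τ * Real.sin (κ * x) := fun τ hτ =>
      integrable_mul_bounded (hw τ hτ) hsd.continuous hsb
    have habs : ∀ p q r s : ℝ, |p| ≤ |a| * |κ| → |q| ≤ |K| * κ ^ 2 →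
        |p * r + q * s| ≤ (|a| * |κ| + |K| * κ ^ 2) * (|r| + |s|) := by
      intro p q r s hp hq
      refine (abs_add_le _ _).trans ?_
      rw [abs_mul, abs_mul]
      have h1 := mul_le_mul_of_nonneg_right hp (abs_nonneg r)
      have h2 := mul_le_mul_of_nonneg_right hq (abs_nonneg s)
      have h3 : 0 ≤ |a| * |κ| * |s| := by positivity
      have h4 : 0 ≤ |K| * κ ^ 2 * |r| := by positivity
      linarith
    refine eq_zero_of_eq_rlIntegral (C := 1 * (C₁ + C₂) + 1 * (C₁ + C₂))
      (L := |a| * |κ| + |K| * κ ^ 2) hβ (by positivity) (by linarith) (fun τ hτ => ?_) hc hs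
      (fun τ hτ => ?_) (fun τ hτ => ?_) ⟨ht, le_rfl⟩
    · exact add_le_add ((abs_pairing_le (hw τ hτ) hcb).trans (by linarith [hwC τ hτ]))
        ((abs_pairing_le (hw τ hτ) hsb).trans (by linarith [hwC τ hτ]))
    · have e : pairing w (testOperator a K fun x => Real.cos (κ * x)) τ =
          (-a * κ) * pairing w (fun x => Real.sin (κ * x)) τ +
          (-K * κ ^ 2) * pairing w (fun x => Real.cos (κ * x)) τ := by
        simp only [pairing]
        rw [← integral_const_mul, ← integral_const_mul,
          ← integral_add ((hsi τ hτ).const_mul _) ((hci τ hτ).const_mul _)]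
        refine integral_congr_ae (Eventually.of_forall fun x => ?_)
        simp only [_root_.testOperator, hdc2]
        rw [hdc]
        ring
      rw [e, add_comm |pairing w (fun x => Real.cos (κ * x)) τ|]
      refine habs _ _ _ _ ?_ ?_
      · rw [abs_mul, abs_neg]
      · rw [abs_mul, abs_neg, abs_of_nonneg hκ3]
    · have e : pairing w (testOperator a K fun x => Real.sin (κ * x)) τ =
          (a * κ) * pairing w (fun x => Real.cos (κ * x)) τ +
          (-K * κ ^ 2) * pairing w (fun x => Real.sin (κ * x)) τ := by
        simp only [pairing]
        rw [← integral_const_mul, ← integral_const_mul,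
          ← integral_add ((hci τ hτ).const_mul _) ((hsi τ hτ).const_mul _)]
        refine integral_congr_ae (Eventually.of_forall fun x => ?_)
        simp only [_root_.testOperator, hds2]
        rw [hds]
        ring
      rw [e]
      refine habs _ _ _ _ ?_ ?_
      · rw [abs_mul]
      · rw [abs_mul, abs_neg, abs_of_nonneg hκ3]
  have hwt := hw t ⟨ht, le_rfl⟩
  have hF : (fun x => (w x t : ℂ)) =ᵐ[volume] 0 := by
    refine ae_eq_zero_of_fourier_eq_zero hwt.ofReal fun ξ => ?_
    rw [fourier_eq_integral_cexp]
    set κ : ℝ := -2 * Real.pi * ξ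
    have e : ∀ x : ℝ, Complex.exp (Complex.I * κ * x) * (w x t : ℂ) =
        ((w x t * Real.cos (κ * x) : ℝ) : ℂ) + ((w x t * Real.sin (κ * x) : ℝ) : ℂ) * Complex.I := by
      intro x
      rw [mul_assoc, mul_comm Complex.I, ← Complex.ofReal_mul, Complex.exp_mul_I]
      push_cast
      ring
    have hci := integrable_mul_bounded hwt (φ := fun x => Real.cos (κ * x)) (by fun_prop)
      (fun x => Real.abs_cos_le_one _)
    have hsi := integrable_mul_bounded hwt (φ := fun x => Real.sin (κ * x)) (by fun_prop)
      (fun x => Real.abs_sin_le_one _)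
    simp only [e]
    have h1 : ∫ x, ((w x t * Real.cos (κ * x) : ℝ) : ℂ) = 0 := by
      rw [integral_complex_ofReal, show ∫ x, w x t * Real.cos (κ * x) = 0 from (hzero κ).1,
        Complex.ofReal_zero]
    have h2 : ∫ x, ((w x t * Real.sin (κ * x) : ℝ) : ℂ) = 0 := by
      rw [integral_complex_ofReal, show ∫ x, w x t * Real.sin (κ * x) = 0 from (hzero κ).2,
        Complex.ofReal_zero]
    refine (integral_add hci.ofReal (hsi.ofReal.mul_const _)).trans ?_
    rw [integral_mul_const]
    rw [h1, h2, zero_mul, add_zero]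
  filter_upwards [hF] with x hx
  have : w x t = 0 := by simpa using hx
  exact sub_eq_zero.1 this

/-! ### Existence: self-similar kernels with Mittag-Leffler symbol -/

/-- The integral equation satisfied by `t ↦ E_β(z t^β)`. -/
theorem mittagLeffler_eq_one_add {β t : ℝ} (hβ : 0 < β) (ht : 0 < t) (z : ℂ) :
    mittagLeffler β (z * ((t ^ β : ℝ) : ℂ)) - 1 = z * ((1 / Real.Gamma β : ℝ) : ℂ) *
      ∫ τ in Ioc 0 t, (((t - τ) ^ (β - 1) : ℝ) : ℂ) * mittagLeffler β (z * ((τ ^ β : ℝ) : ℂ)) := by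
  -- The case z = 0 is set apart because the termwise formulas below divide by z.
  by_cases hz : z = 0
  · simp [hz, mittagLeffler_zero]
  have hG := Real.Gamma_pos_of_pos hβ
  have hz' : ‖z‖ ≠ 0 := norm_ne_zero_iff.2 hz
  let c : ℕ → ℂ := fun n => z ^ n / Complex.Gamma ((β : ℂ) * n + 1)
  let T : ℕ → ℂ := fun n => (z * ((t ^ β : ℝ) : ℂ)) ^ n / Complex.Gamma ((β : ℂ) * n + 1)
  -- By the Beta integral, fractional integration takes the n-th term of the series to the (n+1)-st,
  -- up to the factor Γ(β)/z; the missing term n = 0 is the 1 on the left.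
  let F : ℕ → ℝ → ℂ := fun n τ => (((t - τ) ^ (β - 1) * τ ^ (β * n + 1 - 1) : ℝ) : ℂ) * c n
  have hn1 : ∀ n : ℕ, 0 < β * n + 1 := fun n => by positivity
  have hb := fun n : ℕ => integral_sub_rpow_mul_rpow (hn1 n) hβ ht
  have hbI := fun n : ℕ => integrableOn_sub_rpow_mul_rpow (hn1 n) hβ ht
  have hbv : ∀ n : ℕ, ∫ τ in Ioc 0 t, (t - τ) ^ (β - 1) * τ ^ (β * n + 1 - 1) =
      Real.Gamma (β * n + 1) * Real.Gamma β / Real.Gamma (β * (n + 1 : ℕ) + 1) *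
        (t ^ β) ^ (n + 1) := by
    intro n
    rw [← intervalIntegral.integral_of_le ht.le, (hb n).2, ← Real.rpow_natCast (t ^ β),
      ← Real.rpow_mul ht.le]
    push_cast
    ring_nf
  have hΓ : ∀ n : ℕ, Complex.Gamma ((β : ℂ) * n + 1) = (Real.Gamma (β * n + 1) : ℂ) := fun n => by
    rw [← Complex.Gamma_ofReal]; push_cast; rfl
  have hcn : ∀ n : ℕ, ‖c n‖ = ‖z‖ ^ n / Real.Gamma (β * n + 1) := fun n => by
    simp only [c]
    rw [hΓ, norm_div, norm_pow, Complex.norm_real,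
      Real.norm_of_nonneg (Real.Gamma_pos_of_pos (hn1 n)).le]
  have hTn : ∀ n : ℕ, ‖T n‖ = (‖z‖ * t ^ β) ^ n / Real.Gamma (β * n + 1) := fun n => by
    simp only [T]
    rw [hΓ, norm_div, norm_pow, norm_mul, Complex.norm_real, Complex.norm_real,
      Real.norm_of_nonneg (Real.Gamma_pos_of_pos (hn1 n)).le,
      Real.norm_of_nonneg (Real.rpow_nonneg ht.le β)]
  have hFI : ∀ n, Integrable (F n) (volume.restrict (Ioc 0 t)) := fun n =>
    (hbI n).ofReal.mul_const _
  have hFn : ∀ n, ∫ τ in Ioc 0 t, ‖F n τ‖ = Real.Gamma β / ‖z‖ * ‖T (n + 1)‖ := by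
    intro n
    have e : ∀ τ ∈ Ioc 0 t, ‖F n τ‖ = (t - τ) ^ (β - 1) * τ ^ (β * n + 1 - 1) * ‖c n‖ := by
      intro τ hτ
      simp only [F]
      rw [norm_mul, Complex.norm_real, Real.norm_of_nonneg (mul_nonneg
        (Real.rpow_nonneg (sub_nonneg.2 hτ.2) _) (Real.rpow_nonneg hτ.1.le _))]
    rw [setIntegral_congr_fun measurableSet_Ioc e, integral_mul_const, hbv, hcn, hTn]
    have := (Real.Gamma_pos_of_pos (hn1 n)).ne'
    have := (Real.Gamma_pos_of_pos (hn1 (n + 1))).ne'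
    field_simp
    ring
  have hFv : ∀ n, ∫ τ in Ioc 0 t, F n τ = (Real.Gamma β : ℂ) / z * T (n + 1) := by
    intro n
    simp only [F]
    rw [integral_mul_const, integral_complex_ofReal, hbv]
    simp only [c, T]
    rw [hΓ, hΓ]
    have h1 : (Real.Gamma (β * n + 1) : ℂ) ≠ 0 := by
      exact_mod_cast (Real.Gamma_pos_of_pos (hn1 n)).ne'
    have h2 : (Real.Gamma (β * (n + 1 : ℕ) + 1) : ℂ) ≠ 0 := by
      exact_mod_cast (Real.Gamma_pos_of_pos (hn1 (n + 1))).ne'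
    push_cast at h1 h2 ⊢
    field_simp
    ring
  have hT : HasSum T (mittagLeffler β (z * ((t ^ β : ℝ) : ℂ))) := hasSum_mittagLeffler hβ _
  have hTs : Summable fun n => ‖T (n + 1)‖ := (summable_nat_add_iff 1).2 hT.summable.norm
  have hS := hasSum_integral_of_summable_integral_norm hFI
    (by simp only [hFn]; exact hTs.mul_left _)
  have hpt : ∀ τ ∈ Ioc 0 t, ∑' n, F n τ =
      (((t - τ) ^ (β - 1) : ℝ) : ℂ) * mittagLeffler β (z * ((τ ^ β : ℝ) : ℂ)) := by
    intro τ hτ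
    rw [mittagLeffler, ← tsum_mul_left]
    congr 1
    funext n
    simp only [F, c]
    rw [add_sub_cancel_right, Real.rpow_mul hτ.1.le, Real.rpow_natCast]
    push_cast
    ring
  rw [setIntegral_congr_fun measurableSet_Ioc hpt] at hS
  simp only [hFv] at hS
  have h1 := (hasSum_nat_add_iff' 1).2 hT
  have h2 := (h1.mul_left ((Real.Gamma β : ℂ) / z)).unique hS
  rw [← h2]
  have hGc : (Real.Gamma β : ℂ) ≠ 0 := by exact_mod_cast hG.ne'
  simp only [Finset.range_one, Finset.sum_singleton, T, pow_zero, Nat.cast_zero, mul_zero, zero_add,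
    Complex.Gamma_one]
  push_cast
  field_simp

/-- `G` is the self-similar family `t^{-ν} m(x t^{-ν})` with an integrable profile `m` of mass
one. -/
structure IsSelfSimilarKernel (ν : ℝ) (m : ℝ → ℝ) (G : ℝ → ℝ → ℝ) : Prop where
  integrable_profile : Integrable m
  mass : ∫ y, m y = 1
  eq : ∀ x t, 0 < t → G x t = t ^ (-ν) * m (x * t ^ (-ν))

namespace IsSelfSimilarKernel

variable {ν : ℝ} {m : ℝ → ℝ} {G : ℝ → ℝ → ℝ}

theorem integrable (h : IsSelfSimilarKernel ν m G) {t : ℝ} (ht : 0 < t) :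
    Integrable fun x => G x t := by
  simp only [h.eq _ t ht]
  exact (h.integrable_profile.comp_mul_right' (Real.rpow_pos_of_pos ht _).ne').const_mul _

/-- The substitution y = x t^{-ν} moves all time dependence from the kernel onto the test function.
Limits, continuity and derivatives in t then need only the integrability of the profile. -/
theorem pairing_eq (h : IsSelfSimilarKernel ν m G) (φ : ℝ → ℝ) {t : ℝ} (ht : 0 < t) :
    pairing G φ t = ∫ y, m y * φ (t ^ ν * y) := by
  have hp := Real.rpow_pos_of_pos ht (-ν)
  have e : t ^ ν * t ^ (-ν) = 1 := by rw [← Real.rpow_add ht, add_neg_cancel, Real.rpow_zero]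
  have h1 := Measure.integral_comp_mul_right (fun y => m y * φ (t ^ ν * y)) (t ^ (-ν))
  rw [abs_of_pos (inv_pos.2 hp), eq_inv_smul_iff₀ hp.ne', ← integral_smul] at h1
  rw [← h1, pairing]
  refine integral_congr_ae (Eventually.of_forall fun x => ?_)
  simp only [smul_eq_mul]
  rw [h.eq x t ht, show t ^ ν * (x * t ^ (-ν)) = x by linear_combination x * e]
  ring

theorem integral_abs (h : IsSelfSimilarKernel ν m G) {t : ℝ} (ht : 0 < t) :
    ∫ x, |G x t| = ∫ y, |m y| := by
  have hp := Real.rpow_pos_of_pos ht (-ν)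
  have h1 := Measure.integral_comp_mul_right (fun y => |m y|) (t ^ (-ν))
  rw [abs_of_pos (inv_pos.2 hp), eq_inv_smul_iff₀ hp.ne', ← integral_smul] at h1
  rw [← h1]
  simp only [h.eq _ t ht, abs_mul, abs_of_pos hp, smul_eq_mul]

theorem startsFromDelta (h : IsSelfSimilarKernel ν m G) (hν : 0 < ν) : StartsFromDelta G where
  integrable t ht := h.integrable ht
  bounded T _ := ⟨∫ y, |m y|, fun t ht => (h.integral_abs ht.1).le⟩
  initial φ hφ := by
    obtain ⟨B, hB⟩ := hφ.exists_bound
    have hlim : Tendsto (fun t : ℝ => t ^ ν) (𝓝[>] 0) (𝓝 0) := by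
      have := (Real.continuousAt_rpow_const 0 ν (Or.inr hν.le)).tendsto
      rw [Real.zero_rpow hν.ne'] at this
      exact this.mono_left nhdsWithin_le_nhds
    have h1 : Tendsto (fun t : ℝ => ∫ y, m y * φ (t ^ ν * y)) (𝓝[>] 0) (𝓝 (∫ y, m y * φ 0)) := by
      refine tendsto_integral_filter_of_dominated_convergence (fun y => |m y| * B)
        (Eventually.of_forall fun t => ?_) (Eventually.of_forall fun t =>
        Eventually.of_forall fun y => ?_) (h.integrable_profile.abs.mul_const B)
        (Eventually.of_forall fun y => ?_)
      · exact h.integrable_profile.1.mul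
          (hφ.1.continuous.comp (continuous_const.mul continuous_id)).aestronglyMeasurable
      · rw [norm_mul, Real.norm_eq_abs, Real.norm_eq_abs]
        exact mul_le_mul_of_nonneg_left (hB _) (abs_nonneg _)
      · refine Tendsto.const_mul _ ((hφ.1.continuous.tendsto 0).comp ?_)
        simpa using hlim.mul_const y
    rw [integral_mul_const, h.mass, one_mul] at h1
    refine h1.congr' ?_
    filter_upwards [self_mem_nhdsWithin] with t ht using (h.pairing_eq φ ht).symm

theorem continuousOn_pairing (h : IsSelfSimilarKernel ν m G) {φ : ℝ → ℝ} (hφ : IsTestFunction φ) :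
    ContinuousOn (pairing G φ) (Ioi 0) := by
  obtain ⟨B, hB⟩ := hφ.exists_bound
  have hφc := hφ.1.continuous
  have h1 : ContinuousOn (fun t : ℝ => ∫ y, m y * φ (t ^ ν * y)) (Ioi 0) := by
    refine continuousOn_of_dominated (bound := fun y => |m y| * B) (fun t _ => ?_) (fun t _ =>
      Eventually.of_forall fun y => ?_) (h.integrable_profile.abs.mul_const B)
      (Eventually.of_forall fun y => ?_)
    · exact h.integrable_profile.1.mul
        (hφc.comp (continuous_const.mul continuous_id)).aestronglyMeasurable
    · rw [norm_mul, Real.norm_eq_abs, Real.norm_eq_abs]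
      exact mul_le_mul_of_nonneg_left (hB _) (abs_nonneg _)
    · exact continuousOn_const.mul (hφc.comp_continuousOn
        ((continuousOn_id.rpow_const fun t ht => Or.inl (ne_of_gt ht)).mul continuousOn_const))
  exact h1.congr fun t ht => h.pairing_eq φ ht

theorem abs_pairing_le (h : IsSelfSimilarKernel ν m G) {φ : ℝ → ℝ} {B : ℝ} (hφ : ∀ x, |φ x| ≤ B)
    {t : ℝ} (ht : 0 < t) : |pairing G φ t| ≤ B * ∫ y, |m y| :=
  h.integral_abs ht ▸ _root_.abs_pairing_le (h.integrable ht) hφ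

/-- Differentiate φ(t^ν y) under the integral. The factor t^ν y φ'(t^ν y) is again a test function
evaluated at t^ν y, hence bounded uniformly in y. -/
theorem hasDerivAt_pairing (h : IsSelfSimilarKernel ν m G) {φ : ℝ → ℝ} (hφ : IsTestFunction φ)
    {t : ℝ} (ht : 0 < t) :
    HasDerivAt (pairing G φ) (ν / t * pairing G (fun x => x * deriv φ x) t) t := by
  have hd1 : ContDiff ℝ (⊤ : ℕ∞) (deriv φ) := (contDiff_infty_iff_deriv.1 hφ.1).2
  have hψ : IsTestFunction fun x => x * deriv φ x := ⟨contDiff_id.mul hd1, hφ.2.deriv.mul_left⟩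
  obtain ⟨B, hB⟩ := hφ.exists_bound
  obtain ⟨B', hB'⟩ := hψ.exists_bound
  have hφc := hφ.1.continuous
  have hlin : ∀ s : ℝ, Continuous fun y : ℝ => s ^ ν * y := fun s => by fun_prop
  have key := hasDerivAt_integral_of_dominated_loc_of_deriv_le (μ := volume) (x₀ := t)
    (s := Ioi (t / 2)) (F := fun s y => m y * φ (s ^ ν * y))
    (F' := fun s y => ν / s * (m y * (s ^ ν * y * deriv φ (s ^ ν * y))))
    (bound := fun y => |ν| / (t / 2) * (|m y| * B')) (Ioi_mem_nhds (half_lt_self ht))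
    (Eventually.of_forall fun s =>
      h.integrable_profile.1.mul (hφc.comp (hlin s)).aestronglyMeasurable)
    (integrable_mul_bounded h.integrable_profile (hφc.comp (hlin t)) fun y => hB _)
    ((h.integrable_profile.1.mul
      (hψ.1.continuous.comp (hlin t)).aestronglyMeasurable).const_mul _)
    (Eventually.of_forall fun y s hs => ?_)
    ((h.integrable_profile.abs.mul_const B').const_mul _)
    (Eventually.of_forall fun y s hs => ?_)
  · have h2 := key.2
    rw [integral_const_mul, ← h.pairing_eq (fun x => x * deriv φ x) ht] at h2
    refine h2.congr_of_eventuallyEq ?_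
    filter_upwards [Ioi_mem_nhds ht] with s hs using h.pairing_eq φ hs
  · have hs : t / 2 < s := hs
    have hs0 : 0 < s := by linarith
    rw [norm_mul, norm_mul, norm_div, Real.norm_eq_abs, Real.norm_eq_abs, Real.norm_eq_abs,
      Real.norm_eq_abs, abs_of_pos hs0]
    refine mul_le_mul (div_le_div_of_nonneg_left (abs_nonneg _) (half_pos ht) hs.le)
      (mul_le_mul_of_nonneg_left (hB' _) (abs_nonneg _)) (by positivity) (by positivity)
  · have hs : t / 2 < s := hs
    have hs0 : 0 < s := by linarith
    have h3 := ((hφ.1.differentiable (by simp) (s ^ ν * y)).hasDerivAt.comp s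
      ((Real.hasDerivAt_rpow_const (p := ν) (Or.inl hs0.ne')).mul_const y)).const_mul (m y)
    refine h3.congr_deriv ?_
    rw [Real.rpow_sub_one hs0.ne']
    field_simp

end IsSelfSimilarKernel

/-- The Fourier symbol of `testOperator a K`. -/
noncomputable def testSymbol (a K κ : ℝ) : ℂ := a * (Complex.I * κ) - K * (κ : ℂ) ^ 2

open scoped FourierTransform in
/-- The inverse Fourier transform of a real function. -/
noncomputable def inverseFourier (φ : ℝ → ℝ) (ξ : ℝ) : ℂ := 𝓕 (fun x => (φ x : ℂ)) (-ξ)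

/-! ### Test functions on the Fourier side -/

theorem IsTestFunction.deriv {φ : ℝ → ℝ} (hφ : IsTestFunction φ) : IsTestFunction (deriv φ) :=
  ⟨(contDiff_infty_iff_deriv.1 hφ.1).2, hφ.2.deriv⟩

theorem IsTestFunction.integrable {φ : ℝ → ℝ} (hφ : IsTestFunction φ) : Integrable φ :=
  hφ.1.continuous.integrable_of_hasCompactSupport hφ.2

theorem inverseFourier_deriv {φ : ℝ → ℝ} (hφ : IsTestFunction φ) (ξ : ℝ) :
    inverseFourier (deriv φ) ξ =
      Complex.I * ((-2 * Real.pi * ξ : ℝ) : ℂ) * inverseFourier φ ξ := by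
  have hd : ∀ x, HasDerivAt (fun x => (φ x : ℂ)) ((deriv φ x : ℝ) : ℂ) x := fun x =>
    (hφ.1.differentiable (by simp) x).hasDerivAt.ofReal_comp
  have hd' : deriv (fun x => (φ x : ℂ)) = fun x => ((deriv φ x : ℝ) : ℂ) :=
    funext fun x => (hd x).deriv
  have h := Real.fourier_deriv hφ.integrable.ofReal (fun x => (hd x).differentiableAt)
    (hd' ▸ hφ.deriv.integrable.ofReal)
  rw [hd'] at h
  rw [inverseFourier, inverseFourier, h]
  simp only [smul_eq_mul]
  push_cast
  ring

theorem inverseFourier_testOperator {φ : ℝ → ℝ} (hφ : IsTestFunction φ) (a K ξ : ℝ) :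
    inverseFourier (testOperator a K φ) ξ =
      testSymbol a K (-2 * Real.pi * ξ) * inverseFourier φ ξ := by
  have h1 := inverseFourier_deriv hφ ξ
  have h2 := inverseFourier_deriv hφ.deriv ξ
  have h : inverseFourier (testOperator a K φ) ξ =
      a * inverseFourier (deriv φ) ξ + K * inverseFourier (deriv (deriv φ)) ξ := by
    simp only [inverseFourier, fourier_eq_integral_cexp]
    rw [← integral_const_mul, ← integral_const_mul]
    refine Eq.trans ?_ (integral_add
      ((integrable_cexp_mul hφ.deriv.integrable.ofReal _).const_mul _)
      ((integrable_cexp_mul hφ.deriv.deriv.integrable.ofReal _).const_mul _))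
    refine integral_congr_ae (Eventually.of_forall fun x => ?_)
    simp only [testOperator]
    push_cast
    ring
  rw [h, h2, h1, testSymbol]
  linear_combination (K : ℂ) * ((-2 * Real.pi * ξ : ℝ) : ℂ) ^ 2 * inverseFourier φ ξ * Complex.I_sq

open scoped FourierTransform SchwartzMap in
theorem IsTestFunction.exists_schwartz {φ : ℝ → ℝ} (hφ : IsTestFunction φ) :
    ∃ ψ : 𝓢(ℝ, ℂ), (∀ ξ, ψ ξ = inverseFourier φ ξ) ∧ ∀ x, 𝓕 (ψ : ℝ → ℂ) x = φ x := by
  have hc : HasCompactSupport (fun x => (φ x : ℂ)) := hφ.2.comp_left Complex.ofReal_zero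
  let Φ : 𝓢(ℝ, ℂ) := hc.toSchwartzMap (Complex.ofRealCLM.contDiff.comp hφ.1)
  refine ⟨𝓕⁻ Φ, fun ξ => ?_, fun x => ?_⟩
  · rw [SchwartzMap.fourierInv_coe, Real.fourierInv_eq_fourier_neg]
    rfl
  · rw [← SchwartzMap.fourier_coe, FourierTransform.fourier_fourierInv_eq]
    rfl

theorem IsTestFunction.continuous_inverseFourier {φ : ℝ → ℝ} (hφ : IsTestFunction φ) :
    Continuous (inverseFourier φ) := by
  obtain ⟨ψ, h1, -⟩ := hφ.exists_schwartz
  rw [← funext h1]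
  exact ψ.continuous

theorem IsTestFunction.integrable_inverseFourier {φ : ℝ → ℝ} (hφ : IsTestFunction φ) :
    Integrable (inverseFourier φ) := by
  obtain ⟨ψ, h1, -⟩ := hφ.exists_schwartz
  rw [← funext h1]
  exact ψ.integrable

theorem IsTestFunction.integral_inverseFourier {φ : ℝ → ℝ} (hφ : IsTestFunction φ) :
    ∫ ξ, inverseFourier φ ξ = φ 0 := by
  obtain ⟨ψ, h1, h2⟩ := hφ.exists_schwartz
  rw [← h2, fourier_eq_integral_cexp, ← funext h1]
  simp

/-- Parseval's formula, from the multiplication formula and φ = 𝓕(𝓕⁻¹φ); the argument -2πξ converts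
between the two Fourier conventions. -/
theorem IsFourierPair.integral_mul_eq {f φ : ℝ → ℝ} {P : ℝ → ℂ}
    (hf : IsFourierPair (fun x => (f x : ℂ)) P) (hφ : IsTestFunction φ) :
    ((∫ x, f x * φ x : ℝ) : ℂ) = ∫ ξ, P (-2 * Real.pi * ξ) * inverseFourier φ ξ := by
  obtain ⟨ψ, h1, h2⟩ := hφ.exists_schwartz
  have h := integral_fourier_mul_schwartz hf.1 ψ
  simp only [h2, h1, fourier_eq_integral_cexp, hf.2] at h
  rw [h, ← integral_complex_ofReal]
  push_cast
  rfl

theorem IsFourierPair.norm_le {f : ℝ → ℝ} {P : ℝ → ℂ}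
    (hf : IsFourierPair (fun x => (f x : ℂ)) P) (κ : ℝ) : ‖P κ‖ ≤ ∫ x, |f x| := by
  rw [← hf.2]
  refine (norm_integral_le_integral_norm _).trans_eq (integral_congr_ae (Eventually.of_forall
    fun x => ?_))
  beta_reduce
  rw [norm_mul, norm_cexp_I_mul, one_mul, Complex.norm_real, Real.norm_eq_abs]

/-- A self-similar kernel with symbol `E_β(testSymbol a K κ t^β)` is a mild solution. -/
theorem IsSelfSimilarKernel.isMildSolution {β a K ν : ℝ} {m : ℝ → ℝ} {G : ℝ → ℝ → ℝ}
    (h : IsSelfSimilarKernel ν m G) (hβ : 0 < β)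
    (hF : ∀ t, 0 < t → IsFourierPair (fun x => (G x t : ℂ))
      fun κ => mittagLeffler β (testSymbol a K κ * ((t ^ β : ℝ) : ℂ))) :
    IsMildSolution β a K G := by
  intro φ hφ t ht
  have hL := hφ.testOperator a K
  have hG := Real.Gamma_pos_of_pos hβ
  set M := ∫ y, |m y| with hM
  let ψ := inverseFourier φ
  let S : ℝ → ℂ := fun ξ => testSymbol a K (-2 * Real.pi * ξ)
  have hSc : Continuous S := by simp only [S, testSymbol]; fun_prop
  have hψL : ∀ ξ, inverseFourier (testOperator a K φ) ξ = S ξ * ψ ξ :=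
    inverseFourier_testOperator hφ a K
  have hSψ : Integrable fun ξ => S ξ * ψ ξ := funext hψL ▸ hL.integrable_inverseFourier
  -- As a Fourier transform, the symbol is bounded by the L¹ norm of the kernel, uniformly in ξ and
  -- τ; this is the bound that justifies Fubini.
  have hE : ∀ τ, 0 < τ → ∀ ξ, ‖mittagLeffler β (S ξ * ((τ ^ β : ℝ) : ℂ))‖ ≤ M := fun τ hτ ξ =>
    ((hF τ hτ).norm_le _).trans_eq (h.integral_abs hτ)
  have hEc : ∀ τ : ℝ, Continuous fun ξ => mittagLeffler β (S ξ * ((τ ^ β : ℝ) : ℂ)) := fun τ =>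
    (continuous_mittagLeffler hβ).comp (hSc.mul continuous_const)
  obtain ⟨B, hB⟩ := hL.exists_bound
  have hbd : ∀ τ ∈ Ioc 0 t, |pairing G (testOperator a K φ) τ| ≤ B * M * τ ^ ((1 : ℝ) - 1) := by
    intro τ hτ
    rw [sub_self, Real.rpow_zero, mul_one]
    exact h.abs_pairing_le hB hτ.1
  refine ⟨rlIntegrableAt_of_le hβ one_pos ⟨ht, le_rfl⟩
    (((h.continuousOn_pairing hL).mono Ioc_subset_Ioi_self).aestronglyMeasurable
      measurableSet_Ioc) hbd, ?_⟩
  let μ := volume.restrict (Ioc 0 t)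
  -- Integrated first in τ, f gives the integral equation of E_β at each frequency; integrated first
  -- in ξ, it gives the pairings by Parseval.
  let f : ℝ → ℝ → ℂ := fun ξ τ => (((t - τ) ^ (β - 1) : ℝ) : ℂ) *
    (mittagLeffler β (S ξ * ((τ ^ β : ℝ) : ℂ)) * (S ξ * ψ ξ))
  have hk := integrableOn_sub_rpow_mul_rpow one_pos hβ ht
  simp only [sub_self, Real.rpow_zero, mul_one] at hk
  have hfI : Integrable (Function.uncurry f) (volume.prod μ) := by
    have hdom := (hSψ.norm.mul_const M).mul_prod hk
    refine hdom.mono' (Measurable.aestronglyMeasurable ?_) ?_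
    · have := (continuous_mittagLeffler hβ).measurable
      have := hSc.measurable
      have : Measurable ψ := hφ.continuous_inverseFourier.measurable
      simp only [Function.uncurry_def, f]
      fun_prop
    · have hae : ∀ᵐ p : ℝ × ℝ ∂(volume.prod μ), p.2 ∈ Ioc 0 t :=
        Measure.quasiMeasurePreserving_snd.ae (ae_restrict_mem measurableSet_Ioc)
      filter_upwards [hae] with p hp
      simp only [Function.uncurry_def, f]
      rw [norm_mul, norm_mul, Complex.norm_real,
        Real.norm_of_nonneg (Real.rpow_nonneg (sub_nonneg.2 hp.2) _)]
      have h1 := mul_le_mul_of_nonneg_right (hE p.2 hp.1 p.1) (norm_nonneg (S p.1 * ψ p.1))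
      have h2 := mul_le_mul_of_nonneg_left h1 (Real.rpow_nonneg (sub_nonneg.2 hp.2) (β - 1))
      linarith
  have hswap := integral_integral_swap hfI
  have hleft : ∀ ξ, ∫ τ, f ξ τ ∂μ = (Real.Gamma β : ℂ) *
      (mittagLeffler β (S ξ * ((t ^ β : ℝ) : ℂ)) * ψ ξ - ψ ξ) := by
    intro ξ
    have e : ∀ τ, f ξ τ = (((t - τ) ^ (β - 1) : ℝ) : ℂ) *
        mittagLeffler β (S ξ * ((τ ^ β : ℝ) : ℂ)) * (S ξ * ψ ξ) := fun τ => (mul_assoc _ _ _).symm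
    simp only [e]
    rw [integral_mul_const, ← sub_one_mul, mittagLeffler_eq_one_add hβ ht]
    have : (Real.Gamma β : ℂ) ≠ 0 := by exact_mod_cast hG.ne'
    simp only [μ]
    push_cast
    field_simp
  have hright : ∀ τ ∈ Ioc 0 t, ∫ ξ, f ξ τ =
      (((t - τ) ^ (β - 1) * pairing G (testOperator a K φ) τ : ℝ) : ℂ) := by
    intro τ hτ
    have h1 := (hF τ hτ.1).integral_mul_eq hL
    simp only [hψL] at h1
    simp only [f]
    rw [integral_const_mul, Complex.ofReal_mul, pairing, h1]
  rw [setIntegral_congr_fun measurableSet_Ioc hright, integral_complex_ofReal] at hswap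
  simp only [hleft] at hswap
  have hI : Integrable fun ξ => mittagLeffler β (S ξ * ((t ^ β : ℝ) : ℂ)) * ψ ξ :=
    hφ.integrable_inverseFourier.bdd_mul (c := M) (hEc t).aestronglyMeasurable
      (Eventually.of_forall (hE t ht))
  have hp := (hF t ht).integral_mul_eq hφ
  rw [integral_const_mul, integral_sub hI hφ.integrable_inverseFourier,
    hφ.integral_inverseFourier] at hswap
  have hp' : ∫ ξ, mittagLeffler β (S ξ * ((t ^ β : ℝ) : ℂ)) * ψ ξ = (pairing G φ t : ℂ) := hp.symm
  rw [hp'] at hswap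
  have hreal : Real.Gamma β * (pairing G φ t - φ 0) =
      ∫ τ in Ioc 0 t, (t - τ) ^ (β - 1) * pairing G (testOperator a K φ) τ := by
    exact_mod_cast hswap
  rw [rlIntegral, intervalIntegral.integral_of_le ht.le, ← hreal]
  field_simp

/-! ### The fundamental solutions -/

theorem pairing_testOperator_zero_left (u : ℝ → ℝ → ℝ) (K : ℝ) (φ : ℝ → ℝ) (t : ℝ) :
    pairing u (testOperator 0 K φ) t = K * pairing u (deriv (deriv φ)) t := by
  rw [pairing, pairing, ← integral_const_mul]
  refine integral_congr_ae (Eventually.of_forall fun x => ?_)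
  simp only [testOperator]
  ring

theorem testOperator_one_zero (φ : ℝ → ℝ) : testOperator 1 0 φ = deriv φ := by
  funext x
  simp [testOperator]

/-- The time derivative is (ν/t)⟨G, xφ'⟩. Since xφ' vanishes at the origin, the mild equation has no
initial term for it and gives ⟨G, xφ'⟩ = O(t^β). -/
theorem IsSelfSimilarKernel.exists_abs_deriv_pairing_le {β a K ν : ℝ} {m : ℝ → ℝ}
    {G : ℝ → ℝ → ℝ} (h : IsSelfSimilarKernel ν m G) (hβ : 0 < β) (hs : IsMildSolution β a K G)
    {φ : ℝ → ℝ} (hφ : IsTestFunction φ) :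
    ∃ C : ℝ, 0 ≤ C ∧ ∀ t, 0 < t → |deriv (pairing G φ) t| ≤ C * t ^ (β - 1) := by
  have hψ : IsTestFunction fun x => x * deriv φ x :=
    ⟨contDiff_id.mul hφ.deriv.1, hφ.2.deriv.mul_left⟩
  obtain ⟨B, hB⟩ := (hψ.testOperator a K).exists_bound
  have hB0 : 0 ≤ B := (abs_nonneg _).trans (hB 0)
  have hM : 0 ≤ ∫ y, |m y| := integral_nonneg fun _ => abs_nonneg _
  have hG := Real.Gamma_pos_of_pos (add_pos one_pos hβ)
  refine ⟨|ν| * (B * (∫ y, |m y|) / Real.Gamma (1 + β)), by positivity, fun t ht => ?_⟩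
  have h1 := (hs _ hψ t ht).2
  have h2 := abs_rlIntegral_le hβ one_pos ⟨ht, le_rfl⟩ (C := B * ∫ y, |m y|)
    (f := pairing G (testOperator a K fun x => x * deriv φ x)) (fun τ hτ => by
      rw [sub_self, Real.rpow_zero, mul_one]; exact h.abs_pairing_le hB hτ.1)
  rw [h1, Real.Gamma_one, mul_one, zero_mul, sub_zero, add_sub_cancel_left] at h2
  rw [(h.hasDerivAt_pairing hφ ht).deriv, abs_mul, abs_div, abs_of_pos ht, Real.rpow_sub_one ht.ne']
  refine (mul_le_mul_of_nonneg_left h2 (by positivity)).trans_eq ?_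
  ring

/-- Self-similar mild solutions solve the equation in Caputo form. -/
theorem IsSelfSimilarKernel.hasCaputoDerivAt {β a K ν : ℝ} {m : ℝ → ℝ} {G : ℝ → ℝ → ℝ}
    (h : IsSelfSimilarKernel ν m G) (hν : 0 < ν) (hβ0 : 0 < β) (hβ1 : β < 1)
    (hs : IsMildSolution β a K G) {φ : ℝ → ℝ} (hφ : IsTestFunction φ) {t : ℝ} (ht : 0 < t) :
    HasCaputoDerivAt β (pairing G φ) (pairing G (testOperator a K φ) t) t := by
  have hψ : IsTestFunction fun x => x * deriv φ x :=
    ⟨contDiff_id.mul hφ.deriv.1, hφ.2.deriv.mul_left⟩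
  obtain ⟨C, hC0, hC⟩ := h.exists_abs_deriv_pairing_le hβ0 hs hφ
  refine hasCaputoDerivAt_of_hasRLIntegralAt hβ0 hβ1
    (fun t ht => (h.hasDerivAt_pairing hφ ht).differentiableAt) ?_
    (fun T => ⟨C, hC0, fun τ hτ => hC τ hτ.1⟩) ((h.startsFromDelta hν).initial φ hφ)
    (h.continuousOn_pairing (hφ.testOperator a K)) (hs φ hφ) ht
  have hc : ContinuousOn (fun t => ν / t * pairing G (fun x => x * deriv φ x) t) (Ioi 0) :=
    (continuousOn_const.div continuousOn_id fun t ht => ne_of_gt ht).mul (h.continuousOn_pairing hψ)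
  exact hc.congr fun t ht => (h.hasDerivAt_pairing hφ ht).deriv

theorem isMildSolution_of_hasCaputoDerivAt {β a K : ℝ} {u : ℝ → ℝ → ℝ} (hβ0 : 0 < β) (hβ1 : β < 1)
    (hu : StartsFromDelta u) (h : ∀ φ, IsTestFunction φ → ∀ t, 0 < t →
      HasCaputoDerivAt β (pairing u φ) (pairing u (testOperator a K φ) t) t) :
    IsMildSolution β a K u := fun φ hφ _ ht =>
  hasRLIntegralAt_of_hasCaputoDerivAt hβ0 hβ1 (h φ hφ) (hu.initial φ hφ) ht

theorem SolvesDiffusionIntegral.isMildSolution {β K : ℝ} {u : ℝ → ℝ → ℝ}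
    (h : SolvesDiffusionIntegral β K u) : IsMildSolution β 0 K u := by
  intro φ hφ t ht
  obtain ⟨v, hv, e⟩ := h φ hφ t ht
  rw [e, add_sub_cancel_left, funext (pairing_testOperator_zero_left u K φ)]
  exact hv.const_mul K

theorem IsMildSolution.solvesDiffusionIntegral {β K : ℝ} (hK : K ≠ 0) {u : ℝ → ℝ → ℝ}
    (h : IsMildSolution β 0 K u) : SolvesDiffusionIntegral β K u := by
  intro φ hφ t ht
  have h1 := (h φ hφ t ht).const_mul K⁻¹
  simp only [pairing_testOperator_zero_left, inv_mul_cancel_left₀ hK] at h1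
  exact ⟨_, h1, by rw [mul_inv_cancel_left₀ hK, add_sub_cancel]⟩

/-- The L¹ bound on u for bounded times makes ⟨u, φ''⟩ bounded near t = 0, so J^β of it vanishes at
0⁺ and the constant of integration is φ(0). -/
theorem SolvesDiffusionRL.solvesDiffusionIntegral {β K : ℝ} (hβ : 0 < β) {u : ℝ → ℝ → ℝ}
    (hu : StartsFromDelta u) (h : SolvesDiffusionRL β K u) : SolvesDiffusionIntegral β K u := by
  intro φ hφ t ht
  obtain ⟨B, hB⟩ := hφ.deriv.deriv.exists_bound
  obtain ⟨C, hC⟩ := hu.bounded 1 one_pos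
  refine hasRLIntegralAt_of_hasRLDerivAt hβ (h φ hφ) (hu.initial φ hφ) (C := B * C)
    (fun τ hτ => (abs_pairing_le (hu.integrable τ hτ.1) hB).trans
      (mul_le_mul_of_nonneg_left (hC τ hτ) ((abs_nonneg _).trans (hB 0)))) ht

/-- Solve the integral equation for J^β⟨u, φ''⟩ and differentiate; the hypothesis `hd` makes this
possible. -/
theorem SolvesDiffusionIntegral.solvesDiffusionRL {β K : ℝ} (hK : K ≠ 0) {u : ℝ → ℝ → ℝ}
    (h : SolvesDiffusionIntegral β K u)
    (hd : ∀ φ, IsTestFunction φ → ∀ t, 0 < t → DifferentiableAt ℝ (pairing u φ) t) :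
    SolvesDiffusionRL β K u := by
  intro φ hφ t ht
  have hd := (hd φ hφ t ht).hasDerivAt
  refine ⟨deriv (pairing u φ) t / K, ?_, by rwa [mul_div_cancel₀ _ hK]⟩
  rw [HasRLDerivAt, sub_sub_cancel]
  refine ⟨?_, ((hd.sub_const (φ 0)).div_const K).congr_of_eventuallyEq ?_⟩
  · filter_upwards [Ioi_mem_nhds ht] with τ hτ
    obtain ⟨v, hv, -⟩ := h φ hφ τ hτ
    exact hv.1
  · filter_upwards [Ioi_mem_nhds ht] with τ hτ
    obtain ⟨v, hv, e⟩ := h φ hφ τ hτ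
    rw [hv.2, e, add_sub_cancel_left, mul_div_cancel_left₀ _ hK]

theorem IsFourierPair.mass {f : ℝ → ℝ} {P : ℝ → ℂ} (hf : IsFourierPair (fun x => (f x : ℂ)) P)
    (hP : P 0 = 1) : ∫ x, f x = 1 := by
  have h := hf.2 0
  simp only [Complex.ofReal_zero, mul_zero, zero_mul, Complex.exp_zero, one_mul, hP] at h
  rw [integral_complex_ofReal] at h
  exact_mod_cast h

/-- A kernel that is self-similar, and whose Fourier transform at time one takes the value one at
the origin, is generated by its profile at time one. -/
theorem isSelfSimilarKernel_of_isFourierPair {ν : ℝ} {G : ℝ → ℝ → ℝ} {P : ℝ → ℂ}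
    (hf : IsFourierPair (fun x => (G x 1 : ℂ)) P) (hP : P 0 = 1)
    (hG : ∀ x t, 0 < t → G x t = t ^ (-ν) * G (x * t ^ (-ν)) 1) :
    IsSelfSimilarKernel ν (fun x => G x 1) G :=
  ⟨by simpa using hf.1.re, hf.mass hP, hG⟩

theorem isSelfSimilarKernel_driftGreen {β : ℝ} (hβ0 : 0 < β) (hβ1 : β < 1) :
    IsSelfSimilarKernel β (fun x => driftGreen β x 1) (driftGreen β) := by
  refine isSelfSimilarKernel_of_isFourierPair (isFourierPair_mWright_halfLine hβ0 hβ1 one_pos)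
    (by simp [mittagLeffler_zero]) fun x t ht => ?_
  have hp := Real.rpow_pos_of_pos ht (-β)
  simp only [driftGreen, mul_pos_iff_of_pos_right hp, Real.one_rpow, one_mul, div_one]
  rw [Real.rpow_neg ht.le, div_eq_mul_inv, mul_ite, mul_zero]

theorem isSelfSimilarKernel_diffusionGreen {β K : ℝ} (hβ0 : 0 < β) (hβ1 : β < 1) (hK : 0 < K) :
    IsSelfSimilarKernel (β / 2) (fun x => diffusionGreen β K x 1) (diffusionGreen β K) := by
  refine isSelfSimilarKernel_of_isFourierPair (isFourierPair_diffusionGreen hβ0 hβ1 hK one_pos)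
    (by simp [mittagLeffler_zero]) fun x t ht => ?_
  have hp := Real.rpow_pos_of_pos ht (-(β / 2))
  simp only [diffusionGreen_eq, Real.one_rpow, mul_one, abs_mul, abs_of_pos hp, mul_inv]
  rw [Real.rpow_neg ht.le]
  ring_nf

theorem isMildSolution_driftGreen {β : ℝ} (hβ0 : 0 < β) (hβ1 : β < 1) :
    IsMildSolution β 1 0 (driftGreen β) :=
  (isSelfSimilarKernel_driftGreen hβ0 hβ1).isMildSolution hβ0 fun t ht => by
    have h := isFourierPair_mWright_halfLine hβ0 hβ1 ht
    simpa [testSymbol] using h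

theorem isMildSolution_diffusionGreen {β K : ℝ} (hβ0 : 0 < β) (hβ1 : β < 1) (hK : 0 < K) :
    IsMildSolution β 0 K (diffusionGreen β K) :=
  (isSelfSimilarKernel_diffusionGreen hβ0 hβ1 hK).isMildSolution hβ0 fun t ht => by
    have h := isFourierPair_diffusionGreen hβ0 hβ1 hK ht
    simpa [testSymbol] using h

/-- For each equation it remains to show that G solves it and that its solutions are mild;
uniqueness is then the uniqueness of mild solutions. -/
theorem isTheFundamentalSolution_of_isMildSolution {β a K : ℝ} {Solves : (ℝ → ℝ → ℝ) → Prop}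
    {G : ℝ → ℝ → ℝ} (hβ : 0 < β) (hG : StartsFromDelta G) (hGs : Solves G)
    (h : ∀ u, StartsFromDelta u → Solves u → IsMildSolution β a K u) :
    IsTheFundamentalSolution Solves G :=
  ⟨⟨hG, hGs⟩, fun u hu hus _ ht => (h u hu hus).ae_eq hβ hu hG (h G hG hGs) ht⟩

theorem isTheFundamentalSolution_driftGreen {β : ℝ} (hβ0 : 0 < β) (hβ1 : β < 1) :
    IsTheFundamentalSolution (SolvesDriftCaputo β) (driftGreen β) := by
  have h := isSelfSimilarKernel_driftGreen hβ0 hβ1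
  refine isTheFundamentalSolution_of_isMildSolution (a := 1) (K := 0) hβ0 (h.startsFromDelta hβ0)
    (fun φ hφ t ht => ?_) fun u hu hs => isMildSolution_of_hasCaputoDerivAt hβ0 hβ1 hu
      fun φ hφ t ht => ?_
  · have := h.hasCaputoDerivAt hβ0 hβ0 hβ1 (isMildSolution_driftGreen hβ0 hβ1) hφ ht
    rwa [testOperator_one_zero] at this
  · rw [testOperator_one_zero]
    exact hs φ hφ t ht

section Diffusion

variable {β K : ℝ}

theorem startsFromDelta_diffusionGreen (hβ0 : 0 < β) (hβ1 : β < 1) (hK : 0 < K) :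
    StartsFromDelta (diffusionGreen β K) :=
  (isSelfSimilarKernel_diffusionGreen hβ0 hβ1 hK).startsFromDelta (half_pos hβ0)

theorem isTheFundamentalSolution_diffusionCaputo (hβ0 : 0 < β) (hβ1 : β < 1) (hK : 0 < K) :
    IsTheFundamentalSolution (SolvesDiffusionCaputo β K) (diffusionGreen β K) := by
  refine isTheFundamentalSolution_of_isMildSolution (a := 0) (K := K) hβ0
    (startsFromDelta_diffusionGreen hβ0 hβ1 hK) (fun φ hφ t ht => ?_) fun u hu hs =>
      isMildSolution_of_hasCaputoDerivAt hβ0 hβ1 hu fun φ hφ t ht => ?_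
  · have := (isSelfSimilarKernel_diffusionGreen hβ0 hβ1 hK).hasCaputoDerivAt (half_pos hβ0) hβ0 hβ1
      (isMildSolution_diffusionGreen hβ0 hβ1 hK) hφ ht
    rwa [pairing_testOperator_zero_left] at this
  · rw [pairing_testOperator_zero_left]
    exact hs φ hφ t ht

theorem isTheFundamentalSolution_diffusionIntegral (hβ0 : 0 < β) (hβ1 : β < 1) (hK : 0 < K) :
    IsTheFundamentalSolution (SolvesDiffusionIntegral β K) (diffusionGreen β K) :=
  isTheFundamentalSolution_of_isMildSolution hβ0 (startsFromDelta_diffusionGreen hβ0 hβ1 hK)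
    ((isMildSolution_diffusionGreen hβ0 hβ1 hK).solvesDiffusionIntegral hK.ne')
    fun _ _ hs => hs.isMildSolution

theorem isTheFundamentalSolution_diffusionRL (hβ0 : 0 < β) (hβ1 : β < 1) (hK : 0 < K) :
    IsTheFundamentalSolution (SolvesDiffusionRL β K) (diffusionGreen β K) :=
  isTheFundamentalSolution_of_isMildSolution hβ0 (startsFromDelta_diffusionGreen hβ0 hβ1 hK)
    (((isMildSolution_diffusionGreen hβ0 hβ1 hK).solvesDiffusionIntegral hK.ne').solvesDiffusionRL
      hK.ne' fun _ hφ _ ht => ((isSelfSimilarKernel_diffusionGreen hβ0 hβ1 hK).hasDerivAt_pairing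
        hφ ht).differentiableAt)
    fun _ hu hs => (hs.solvesDiffusionIntegral hβ0 hu).isMildSolution

end Diffusion

theorem mainTheorem8 (β : ℝ) (hβ0 : 0 < β) (hβ1 : β < 1) :
    -- the fundamental solution of the diffusion equation, in each of its three forms
    (∀ K : ℝ, 0 < K →
      IsTheFundamentalSolution (SolvesDiffusionCaputo β K) (diffusionGreen β K) ∧
      IsTheFundamentalSolution (SolvesDiffusionRL β K) (diffusionGreen β K) ∧
      IsTheFundamentalSolution (SolvesDiffusionIntegral β K) (diffusionGreen β K)) ∧
    -- its expression for K = 1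
    (∀ x t : ℝ, 0 < t → diffusionGreen β 1 x t =
      1 / 2 * t ^ (-(β / 2)) * mWright (β / 2) (|x| * t ^ (-(β / 2)))) ∧
    -- first strategy: invert the Fourier transform, then the Laplace transform
    (∀ s : ℂ, 0 < s.re → IsInverseFourier
      (fun κ : ℝ => s ^ ((β : ℂ) - 1) / (s ^ (β : ℂ) + (κ : ℂ) ^ 2))
      (fun x : ℝ => 1 / 2 * s ^ ((β : ℂ) / 2 - 1) *
        Complex.exp (-((|x| : ℝ) : ℂ) * s ^ ((β : ℂ) / 2)))) ∧
    (∀ x : ℝ, IsInverseLaplace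
      (fun s : ℂ => 1 / 2 * s ^ ((β : ℂ) / 2 - 1) *
        Complex.exp (-((|x| : ℝ) : ℂ) * s ^ ((β : ℂ) / 2)))
      (fun t : ℝ => (diffusionGreen β 1 x t : ℂ))) ∧
    -- second strategy: invert the Laplace transform, then the Fourier transform
    (∀ κ : ℝ, IsInverseLaplace
      (fun s : ℂ => s ^ ((β : ℂ) - 1) / (s ^ (β : ℂ) + (κ : ℂ) ^ 2))
      (fun t : ℝ => mittagLeffler β (-(κ : ℂ) ^ 2 * ((t ^ β : ℝ) : ℂ)))) ∧
    (∀ t : ℝ, 0 < t → IsInverseFourier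
      (fun κ : ℝ => mittagLeffler β (-(κ : ℂ) ^ 2 * ((t ^ β : ℝ) : ℂ)))
      (fun x : ℝ => (diffusionGreen β 1 x t : ℂ))) ∧
    -- the fundamental solution of the drift equation
    IsTheFundamentalSolution (SolvesDriftCaputo β) (driftGreen β) ∧
    -- first strategy
    (∀ s : ℂ, 0 < s.re → IsInverseFourier
      (fun κ : ℝ => s ^ ((β : ℂ) - 1) / (s ^ (β : ℂ) - Complex.I * κ))
      (fun x : ℝ => if 0 < x then
        s ^ ((β : ℂ) - 1) * Complex.exp (-(x : ℂ) * s ^ (β : ℂ)) else 0)) ∧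
    (∀ x : ℝ, x ≠ 0 → IsInverseLaplace
      (fun s : ℂ => if 0 < x then
        s ^ ((β : ℂ) - 1) * Complex.exp (-(x : ℂ) * s ^ (β : ℂ)) else 0)
      (fun t : ℝ => (driftGreen β x t : ℂ))) ∧
    -- second strategy
    (∀ κ : ℝ, IsInverseLaplace
      (fun s : ℂ => s ^ ((β : ℂ) - 1) / (s ^ (β : ℂ) - Complex.I * κ))
      (fun t : ℝ => mittagLeffler β (Complex.I * κ * ((t ^ β : ℝ) : ℂ)))) ∧
    (∀ t : ℝ, 0 < t → IsInverseFourier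
      (fun κ : ℝ => mittagLeffler β (Complex.I * κ * ((t ^ β : ℝ) : ℂ)))
      (fun x : ℝ => (driftGreen β x t : ℂ))) := by
  refine ⟨fun K hK => ⟨isTheFundamentalSolution_diffusionCaputo hβ0 hβ1 hK,
      isTheFundamentalSolution_diffusionRL hβ0 hβ1 hK,
      isTheFundamentalSolution_diffusionIntegral hβ0 hβ1 hK⟩,
    fun x t ht => diffusionGreen_one x ht,
    fun s hs => (isFourierPair_diffusion_symbol hβ0 hβ1 hs).isInverseFourier,
    fun x => (isLaplacePair_diffusionGreen hβ0 hβ1 x).isInverseLaplace,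
    fun κ => (isLaplacePair_mittagLeffler_neg_sq hβ0 hβ1 κ).isInverseLaplace,
    fun t ht => ?_,
    isTheFundamentalSolution_driftGreen hβ0 hβ1,
    fun s hs => (isFourierPair_drift_symbol hβ0 hβ1 hs).isInverseFourier,
    fun x _ => (isLaplacePair_driftGreen hβ0 hβ1 x).isInverseLaplace,
    fun κ => (isLaplacePair_mittagLeffler hβ0 hβ1 κ).isInverseLaplace,
    fun t ht => (isFourierPair_mWright_halfLine hβ0 hβ1 ht).isInverseFourier⟩
  have h := (isFourierPair_diffusionGreen hβ0 hβ1 one_pos ht).isInverseFourier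
  simpa only [Complex.ofReal_one, one_mul] using h
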